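/- Let $d\ge 2$ and write $\langle\xi\rangle=(1+|\xi|^2)^{1/2}$ for $\xi\in\mathbb{R}^{d-1}$. For $0<h\le 1$, a symbol $a(x,\xi)$ on $\mathbb{R}^{d-1}\times\mathbb{R}^{d-1}$ and a Schwartz function $f$ on $\mathbb{R}^{d-1}$ put $$(\mathrm{Op}_h(a)f)(x)=(2\pi h)^{-d+1}\int_{\mathbb{R}^{d-1}}\Big(\int_{\mathbb{R}^{d-1}}e^{-\frac ih\langle x-y,\xi\rangle}a(x,\xi)f(y)\,dy\Big)d\xi ,$$ and let $H_h^{r}(\mathbb{R}^{d-1})$, $r\in\mathbb{R}$, be the Sobolev space of order $r$ with the norm $\|u\|_{H^r_h}=\|\mathrm{Op}_h(\langle\xi\rangle^r)u\|_{L^2}$. **Proposition 2.4.** There exists an integer $s_d\ge 0$ depending only on $d$ such that the following holds. Let $\mu\ge 1$ be an integer and let $k,k'\in\mathbb{R}$ with $k'>k$. There is a constant $K>0$, depending only on $d,\mu,k,k'$, such that, for every $0<h\le 1$, every function $a:\mathbb{R}^{d-1}\times\mathbb{R}^{d-1}\to\mathbb{C}$ of class $C^\mu$ in $x$ and $C^\infty$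 in $\xi$ (the derivatives $\partial_\xi^\alpha\partial_x^\beta a$ with $|\beta|\le\mu$ exist and are continuous) and all real constants $C_{\alpha,\beta}$ with $$\left|\partial_\xi^\alpha\partial_x^\beta a(x,\xi)\right|\le C_{\alpha,\beta}\langle\xi\rangle^{k-|\alpha|}\qquad\text{for all }x,\xi\text{ and all multi-indices }\alpha,\beta\text{ with }|\beta|\le\mu,$$ the operator $\mathrm{Op}_h(a)$ extends from Schwartz functions to a bounded operator $H_h^{k'}(\mathbb{R}^{d-1})\to L^2(\mathbb{R}^{d-1})$ and $$\|\mathrm{Op}_h(a)\|_{H_h^{k'}\to L^2}\le K\Big(\sum_{|\alpha|+|\beta|\le s_d,\ |\beta|\le\mu}h^{\frac{|\alpha|+|\beta|}{2}}C_{\alpha,\beta}+h^{\mu/2}\log(1+h^{-1})\sum_{|\alpha|\le d,\ |\beta|\le\mu}C_{\alpha,\beta}\Big).$$ Moreover, if $\mu\ge s_d$, the second sum can be removed: $$\|\mathrm{Op}_h(a)\|_{H_h^{k'}\to L^2}\le K\sum_{|\alpha|+|\beta|\le s_d}h^{\frac{|\alpha|+|\beta|}{2}}C_{\alpha,\beta}.$$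 -/

import Mathlib

open MeasureTheory
open scoped SchwartzMap ContDiff ENNReal

noncomputable section

namespace SemiclassicalPsiDO

/-! ### Multi-indices and partial derivatives -/

/-- Real `n`-space with its Euclidean norm. -/
abbrev Space (n : ℕ) : Type := EuclideanSpace ℝ (Fin n)

/-- Multi-indices of length `n`. -/
abbrev MultiIndex (n : ℕ) : Type := Fin n → ℕ

/-- The order `|α| = α₁ + ⋯ + αₙ`. -/
def order {n : ℕ} (α : MultiIndex n) : ℕ := ∑ i, α i

/-- The finite set of multi-indices of order at most `m`. -/
def indicesLE (n m : ℕ) : Finset (MultiIndex n) :=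
  (Fintype.piFinset fun _ : Fin n => Finset.range (m + 1)).filter fun α => order α ≤ m

theorem mem_indicesLE {n m : ℕ} {α : MultiIndex n} : α ∈ indicesLE n m ↔ order α ≤ m := by
  simp only [indicesLE, Finset.mem_filter, Fintype.mem_piFinset, Finset.mem_range,
    and_iff_right_iff_imp]
  intro h i
  have : α i ≤ order α := Finset.single_le_sum (fun _ _ => Nat.zero_le _) (Finset.mem_univ i)
  omega

/-- The first partial derivative `∂_i f`. -/
def pderiv {n : ℕ} (i : Fin n) (f : Space n → ℂ) : Space n → ℂ :=
  fun x => fderiv ℝ f x (EuclideanSpace.single i 1)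

/-- The partial derivative `∂^α f = ∂₁^{α₁} ⋯ ∂ₙ^{αₙ} f`. -/
def mderiv {n : ℕ} (α : MultiIndex n) (f : Space n → ℂ) : Space n → ℂ :=
  (List.finRange n).foldr (fun i g => (pderiv i)^[α i] g) f

/-- The mixed derivative `∂_ξ^α ∂_x^β a (x, ξ)`. -/
def symbolDeriv {n : ℕ} (α β : MultiIndex n) (a : Space n → Space n → ℂ) (x ξ : Space n) : ℂ :=
  mderiv α (fun ζ => mderiv β (fun y => a y ζ) x) ξ

/-! ### Symbols of limited regularity in `x` -/

/-- The bracket `⟨ξ⟩ = (1 + |ξ|²)^{1/2}`. -/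
def bracket {n : ℕ} (ξ : Space n) : ℝ := (1 + ‖ξ‖ ^ 2) ^ (1 / 2 : ℝ)

/-- `a(x, ξ)` is of class `C^μ` in `x` and `C^∞` in `ξ` (the derivatives `∂_ξ^α ∂_x^β a` with
`|β| ≤ μ` exist and are continuous), and
`|∂_ξ^α ∂_x^β a(x, ξ)| ≤ C_{α,β} ⟨ξ⟩^{k - |α|}` for all `α` and all `β` with `|β| ≤ μ`. -/
structure IsSymbol {n : ℕ} (k : ℝ) (μ : ℕ) (a : Space n → Space n → ℂ)
    (C : MultiIndex n → MultiIndex n → ℝ) : Prop where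
  contDiff_fst : ∀ ξ, ContDiff ℝ μ fun x => a x ξ
  contDiff_snd : ∀ β, order β ≤ μ → ∀ x, ContDiff ℝ ∞ fun ξ => mderiv β (fun y => a y ξ) x
  continuous_deriv : ∀ α β, order β ≤ μ →
    Continuous fun p : Space n × Space n => symbolDeriv α β a p.1 p.2
  bound : ∀ α β, order β ≤ μ → ∀ x ξ,
    ‖symbolDeriv α β a x ξ‖ ≤ C α β * bracket ξ ^ (k - (order α : ℝ))

/-! ### Semiclassical quantization -/

/-- `Op_h(a) f (x) = (2πh)^{-n} ∫ (∫ e^{-i⟨x-y,ξ⟩/h} a(x,ξ) f(y) dy) dξ` for a Schwartz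
function `f`. -/
def Op {n : ℕ} (h : ℝ) (a : Space n → Space n → ℂ) (f : 𝓢(Space n, ℂ)) (x : Space n) : ℂ :=
  (((2 * Real.pi * h) ^ n : ℝ) : ℂ)⁻¹ *
    ∫ ξ : Space n, ∫ y : Space n,
      Complex.exp (-(Complex.I / (h : ℂ)) * ((inner ℝ (x - y) ξ : ℝ) : ℂ)) * a x ξ * f y

/-! ### Semiclassical Sobolev spaces -/

/-- The function `η ↦ ⟨2πhη⟩^k`: the symbol `⟨ξ⟩^k` of `⟨hD⟩^k` in terms of the frequency `η` of the
Fourier transform normalized by `e^{-2πi⟨x,η⟩}`. -/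
def bracketPow (n : ℕ) (h k : ℝ) (η : Space n) : ℂ :=
  ((bracket ((2 * Real.pi * h) • η) ^ k : ℝ) : ℂ)

/-- The operator `⟨hD⟩^k` on tempered distributions. -/
def bessel (n : ℕ) (h k : ℝ) : 𝓢'(Space n, ℂ) →L[ℂ] 𝓢'(Space n, ℂ) :=
  TemperedDistribution.fourierMultiplierCLM ℂ (bracketPow n h k)

theorem bracketPow_eq (n : ℕ) (h k : ℝ) :
    bracketPow n h k = fun η : Space n =>
      (((1 + ‖((2 * Real.pi * h) • ContinuousLinearMap.id ℝ (Space n)) η‖ ^ 2) ^ (k / 2) : ℝ) : ℂ) := by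
  funext η
  simp only [bracketPow, bracket, smul_apply, ContinuousLinearMap.id_apply]
  rw [← Real.rpow_mul (by positivity)]
  congr 2
  ring

theorem bracketPow_hasTemperateGrowth (n : ℕ) (h k : ℝ) :
    (bracketPow n h k).HasTemperateGrowth := by
  rw [bracketPow_eq]
  have h1 := Function.hasTemperateGrowth_one_add_norm_sq_rpow (Space n) (k / 2)
  have h2 := ((2 * Real.pi * h) • ContinuousLinearMap.id ℝ (Space n)).hasTemperateGrowth
  have := h1.comp h2
  fun_prop

theorem bessel_bessel (n : ℕ) (h k k' : ℝ) (u : 𝓢'(Space n, ℂ)) :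
    bessel n h k' (bessel n h k u) = bessel n h (k + k') u := by
  unfold bessel
  rw [TemperedDistribution.fourierMultiplierCLM_fourierMultiplierCLM_apply
    (bracketPow_hasTemperateGrowth _ _ _) (bracketPow_hasTemperateGrowth _ _ _)]
  congr 2
  funext x
  simp only [bracketPow, Pi.mul_apply]
  norm_cast
  rw [← Real.rpow_add (by unfold bracket; positivity), add_comm]

theorem bessel_zero (n : ℕ) (h : ℝ) (u : 𝓢'(Space n, ℂ)) : bessel n h 0 u = u := by
  have : bracketPow n h 0 = fun _ => 1 := by funext x; simp [bracketPow]
  simp [bessel, this]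

/-- The Hilbert space `L²(ℝⁿ)`. -/
abbrev L2 (n : ℕ) : Type := Lp ℂ 2 (volume : Measure (Space n))

/-- `H_h^k(ℝⁿ)` as a space of tempered distributions: all `u` with `⟨hD⟩^k u ∈ L²`. -/
def sobolevSubmodule (n : ℕ) (h k : ℝ) : Submodule ℂ 𝓢'(Space n, ℂ) :=
  (LinearMap.range (Lp.toTemperedDistributionCLM ℂ (volume : Measure (Space n)) 2).toLinearMap).comap
    (bessel n h k).toLinearMap

theorem mem_sobolevSubmodule {n : ℕ} {h k : ℝ} {u : 𝓢'(Space n, ℂ)} :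
    u ∈ sobolevSubmodule n h k ↔ ∃ v : L2 n, (v : 𝓢'(Space n, ℂ)) = bessel n h k u :=
  Iff.rfl

/-- The semiclassical Sobolev space `H_h^k(ℝⁿ)`. -/
def Sobolev (n : ℕ) (h k : ℝ) : Type := sobolevSubmodule n h k

namespace Sobolev

instance (n : ℕ) (h k : ℝ) : AddCommGroup (Sobolev n h k) :=
  inferInstanceAs (AddCommGroup (sobolevSubmodule n h k))

instance (n : ℕ) (h k : ℝ) : Module ℂ (Sobolev n h k) :=
  inferInstanceAs (Module ℂ (sobolevSubmodule n h k))

/-- The inclusion of `H_h^k(ℝⁿ)` in the tempered distributions. -/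
def toDistribution (n : ℕ) (h k : ℝ) : Sobolev n h k →ₗ[ℂ] 𝓢'(Space n, ℂ) :=
  (sobolevSubmodule n h k).subtype

theorem toTemperedDistribution_injective (n : ℕ) :
    Function.Injective (fun v : L2 n => (v : 𝓢'(Space n, ℂ))) := by
  have := LinearMap.ker_eq_bot.mp
    (Lp.ker_toTemperedDistributionCLM_eq_bot (F := ℂ) (μ := (volume : Measure (Space n))) (p := 2))
  exact this

theorem exists_potential {n : ℕ} {h k : ℝ} (u : Sobolev n h k) :
    ∃ v : L2 n, (v : 𝓢'(Space n, ℂ)) = bessel n h k (toDistribution n h k u) :=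
  mem_sobolevSubmodule.mp u.2

/-- The map `u ↦ ⟨hD⟩^k u` from `H_h^k(ℝⁿ)` to `L²(ℝⁿ)`. -/
def potential (n : ℕ) (h k : ℝ) : Sobolev n h k →ₗ[ℂ] L2 n where
  toFun u := Classical.choose (exists_potential u)
  map_add' u v := by
    apply toTemperedDistribution_injective
    have h1 := Classical.choose_spec (exists_potential u)
    have h2 := Classical.choose_spec (exists_potential v)
    have h3 := Classical.choose_spec (exists_potential (u + v))
    refine h3.trans ?_
    rw [map_add, map_add]
    exact (congrArg₂ (· + ·) h1.symm h2.symm).trans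
      (map_add (Lp.toTemperedDistributionCLM ℂ (volume : Measure (Space n)) 2) _ _).symm
  map_smul' c u := by
    apply toTemperedDistribution_injective
    have h1 := Classical.choose_spec (exists_potential u)
    have h3 := Classical.choose_spec (exists_potential (c • u))
    refine h3.trans ?_
    rw [map_smul, map_smul]
    exact (congrArg (c • ·) h1.symm).trans
      (map_smul (Lp.toTemperedDistributionCLM ℂ (volume : Measure (Space n)) 2) c _).symm

theorem potential_spec {n : ℕ} {h k : ℝ} (u : Sobolev n h k) :
    ((potential n h k u : L2 n) : 𝓢'(Space n, ℂ)) = bessel n h k (toDistribution n h k u) :=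
  Classical.choose_spec (exists_potential u)

theorem potential_injective (n : ℕ) (h k : ℝ) : Function.Injective (potential n h k) := by
  intro u v huv
  have h1 := potential_spec u
  rw [huv, potential_spec v] at h1
  have h2 := congrArg (bessel n h (-k)) h1
  rw [bessel_bessel, bessel_bessel, add_neg_cancel, bessel_zero, bessel_zero] at h2
  exact Subtype.ext h2.symm

/-- The norm of `H_h^k(ℝⁿ)` is `‖u‖ = ‖⟨hD⟩^k u‖_{L²}`. -/
instance (n : ℕ) (h k : ℝ) : NormedAddCommGroup (Sobolev n h k) :=
  NormedAddCommGroup.induced _ _ (potential n h k) (potential_injective n h k)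

instance (n : ℕ) (h k : ℝ) : NormedSpace ℂ (Sobolev n h k) :=
  NormedSpace.induced ℂ _ _ (potential n h k)

theorem norm_def {n : ℕ} {h k : ℝ} (u : Sobolev n h k) : ‖u‖ = ‖potential n h k u‖ := rfl

theorem bessel_schwartz (n : ℕ) (h k : ℝ) (f : 𝓢(Space n, ℂ)) :
    (((SchwartzMap.fourierMultiplierCLM ℂ (bracketPow n h k) f).toLp 2 : L2 n) : 𝓢'(Space n, ℂ)) =
      bessel n h k (f : 𝓢'(Space n, ℂ)) := by
  rw [bessel, Lp.toTemperedDistribution_toLp_eq,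
    TemperedDistribution.fourierMultiplierCLM_toTemperedDistributionCLM_eq
      (bracketPow_hasTemperateGrowth n h k)]

/-- A Schwartz function as an element of `H_h^k(ℝⁿ)`. -/
def ofSchwartz (n : ℕ) (h k : ℝ) (f : 𝓢(Space n, ℂ)) : Sobolev n h k :=
  ⟨(f : 𝓢'(Space n, ℂ)), mem_sobolevSubmodule.mpr ⟨_, bessel_schwartz n h k f⟩⟩

theorem potential_ofSchwartz (n : ℕ) (h k : ℝ) (f : 𝓢(Space n, ℂ)) :
    potential n h k (ofSchwartz n h k f) =
      (SchwartzMap.fourierMultiplierCLM ℂ (bracketPow n h k) f).toLp 2 :=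
  toTemperedDistribution_injective n
    ((potential_spec _).trans (bessel_schwartz n h k f).symm)

/-- On Schwartz functions the operator `⟨hD⟩^k` is `Op_h(⟨ξ⟩^k)`. -/
theorem fourierMultiplier_eq_Op (n : ℕ) {h : ℝ} (hh : 0 < h) (k : ℝ) (f : 𝓢(Space n, ℂ))
    (x : Space n) :
    SchwartzMap.fourierMultiplierCLM ℂ (bracketPow n h k) f x =
      Op h (fun _ ξ => ((bracket ξ ^ k : ℝ) : ℂ)) f x := by
  have hp : 0 < 2 * Real.pi * h := by positivity
  set G : Space n → ℂ := fun ξ => ∫ y : Space n,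
      Complex.exp (-(Complex.I / (h : ℂ)) * ((inner ℝ (x - y) ξ : ℝ) : ℂ)) *
        ((bracket ξ ^ k : ℝ) : ℂ) * f y with hG
  have h1 := Measure.integral_comp_smul (volume : Measure (Space n)) G (-(2 * Real.pi * h))
  have h2 : |((-(2 * Real.pi * h)) ^ Module.finrank ℝ (Space n))⁻¹| =
      ((2 * Real.pi * h) ^ n)⁻¹ := by
    rw [finrank_euclideanSpace_fin, abs_inv, abs_pow, abs_neg, abs_of_pos hp]
  rw [h2] at h1
  have h3 : Op h (fun _ ξ => ((bracket ξ ^ k : ℝ) : ℂ)) f x =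
      ∫ η, G ((-(2 * Real.pi * h)) • η) := by
    rw [h1, Complex.real_smul, Complex.ofReal_inv]
    rfl
  rw [h3, SchwartzMap.fourierMultiplierCLM_apply, SchwartzMap.fourierInv_coe,
    Real.fourierInv_eq', SchwartzMap.smulLeftCLM_apply (bracketPow_hasTemperateGrowth n h k),
    SchwartzMap.fourier_coe]
  refine integral_congr_ae (Filter.Eventually.of_forall fun η => ?_)
  simp only [hG, Real.fourier_eq', smul_eq_mul]
  rw [← mul_assoc, ← integral_const_mul]
  refine integral_congr_ae (Filter.Eventually.of_forall fun y => ?_)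
  have hb : bracketPow n h k η = ((bracket ((-(2 * Real.pi * h)) • η) ^ k : ℝ) : ℂ) := by
    simp only [bracketPow, bracket, neg_smul, norm_neg]
  have hc : (h : ℂ) ≠ 0 := by exact_mod_cast hh.ne'
  simp only [hb]
  have he : Complex.exp (-(Complex.I / (h : ℂ)) *
        ((inner ℝ (x - y) ((-(2 * Real.pi * h)) • η) : ℝ) : ℂ)) =
      Complex.exp (((2 * Real.pi * inner ℝ η x : ℝ) : ℂ) * Complex.I) *
        Complex.exp (((-2 * Real.pi * inner ℝ y η : ℝ) : ℂ) * Complex.I) := by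
    rw [← Complex.exp_add]
    congr 1
    rw [inner_smul_right, inner_sub_left, real_inner_comm x η]
    push_cast
    field_simp
    ring
  rw [he]
  ring

/-- Schwartz functions are dense in `H_h^k(ℝⁿ)`, so that a bounded operator on `H_h^k(ℝⁿ)` is
determined by its values on them. -/
theorem denseRange_ofSchwartz (n : ℕ) (h k : ℝ) : DenseRange (ofSchwartz n h k) := by
  intro u
  rw [Metric.mem_closure_range_iff]
  intro ε hε
  have hd := SchwartzMap.denseRange_toLpCLM (E := Space n) (F := ℂ)
    (μ := (volume : Measure (Space n))) (p := 2) (by norm_num)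
  obtain ⟨g, hg⟩ := Metric.mem_closure_range_iff.mp (hd (potential n h k u)) ε hε
  refine ⟨SchwartzMap.fourierMultiplierCLM ℂ (bracketPow n h (-k)) g, ?_⟩
  have key : potential n h k (ofSchwartz n h k
      (SchwartzMap.fourierMultiplierCLM ℂ (bracketPow n h (-k)) g)) = g.toLp 2 := by
    rw [potential_ofSchwartz, SchwartzMap.fourierMultiplierCLM_fourierMultiplierCLM_apply
      (bracketPow_hasTemperateGrowth _ _ _) (bracketPow_hasTemperateGrowth _ _ _)]
    have : bracketPow n h k * bracketPow n h (-k) = fun _ => 1 := by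
      funext x
      simp only [bracketPow, Pi.mul_apply]
      norm_cast
      rw [← Real.rpow_add (by unfold bracket; positivity), add_neg_cancel, Real.rpow_zero]
    rw [this, SchwartzMap.fourierMultiplierCLM_const]
    simp
  rw [dist_eq_norm, norm_def, map_sub, key, ← dist_eq_norm]
  exact hg

end Sobolev

/-- `T` is the bounded extension of `Op_h(a)` to an operator `H_h^k(ℝⁿ) → L²(ℝⁿ)`. -/
def IsOpExtension {n : ℕ} {h k : ℝ} (a : Space n → Space n → ℂ)
    (T : Sobolev n h k →L[ℂ] L2 n) : Prop :=
  ∀ f : 𝓢(Space n, ℂ), (T (Sobolev.ofSchwartz n h k f) : Space n → ℂ) =ᵐ[volume] Op h a f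

/-! ### The two weighted sums of symbol constants -/

/-- The sum of `h^{(|α|+|β|)/2} C_{α,β}` over `|α| + |β| ≤ s`, `|β| ≤ μ`. -/
def weightedSum {n : ℕ} (s μ : ℕ) (h : ℝ) (C : MultiIndex n → MultiIndex n → ℝ) : ℝ :=
  ∑ p ∈ (indicesLE n s ×ˢ indicesLE n μ).filter (fun p => order p.1 + order p.2 ≤ s),
    h ^ (((order p.1 : ℝ) + (order p.2 : ℝ)) / 2) * C p.1 p.2

/-- The sum of `C_{α,β}` over `|α| ≤ m`, `|β| ≤ μ`. -/
def plainSum {n : ℕ} (m μ : ℕ) (C : MultiIndex n → MultiIndex n → ℝ) : ℝ :=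
  ∑ α ∈ indicesLE n m, ∑ β ∈ indicesLE n μ, C α β

end SemiclassicalPsiDO

end

/-! Write `n = d - 1` and `δ = k' - k > 0`. Dividing `a` by `⟨ξ⟩^{k'}` and rescaling `x = ρx'`,
`ξ = ρη` with `ρ = (2πh)^{1/2}` turns the claim into an `L²` bound for an operator with kernel
`e^{-2πi⟨x,η⟩} σ(x,η)`, where `σ(x,η) = b(ρx,ρη)` and `b = a⟨ξ⟩^{-k'}` is a symbol of order `-δ`. By
duality this is a bound of the bilinear form `∫∫ e^{-2πi⟨x,η⟩} σ(x,η) F(η) v(x) dx dη` on `L² × L²`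
(`FormBound.eLpNorm_le`, `eLpNorm_Op_le`), and density of Schwartz functions then gives the bounded
extension (`exists_isOpExtension`). Each derivative of `σ` costs a factor `ρ`, that is, `h^{1/2}`.

Two kinds of symbols have bounded form without any regularity.

* Averages `∫∫ E(t) E'(τ) c(x - t, η - τ) dt dτ` of a bounded function `c` over a bounded cell of phase
  space (`FormBound.cell_average`). Translation moves the average onto the test functions; the
  remaining kernel `e^{-2πi⟨t,τ⟩}` on the cell is expanded in its exponential series, and each term
  is a product of two windowed Fourier transforms, to which Plancherel's theorem and the
  Cauchy–Schwarz inequality apply.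
* Orthant integrals `∫_{ξ < ρη} G(x,ξ) dξ` with `|G(x,ξ)| ≤ g(ξ)` and `g` integrable
  (`FormBound.orthant`): superpositions of multiplication operators composed with Fourier
  multipliers that are indicator functions.

A function is a sum of averages over the unit cube of its mixed first derivatives
(`IsMixedFamily.eq_sum_integral_cube`). If `n ≤ μ` this is used in both variables, and the first kind
of symbols suffices (`exists_formBound_regular`). In general, the binomial formula expresses `σ(x,η)`
by translates `σ(x - jt, η)`, `1 ≤ j ≤ μ`, and the `μ`-th difference of `σ` in `x` with step `-t`; this is
averaged over `t` in the unit cube (`exists_formBound_limited`). The translates become cell averages,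
with no derivatives in `x`. The differences are small of order `ρ^μ` but not regular; being of negative
order in `ξ`, they are orthant integrals of their full mixed `ξ`-derivative
(`IsMixedFamily.eq_integral_orthant`), which is integrable in `ξ`. Only derivatives in `ξ` with each
coordinate differentiated at most once occur, which is why `s_d = 2n` is enough and the second sum
is needed only for `|α| ≤ n`. -/

namespace SemiclassicalPsiDO

/-! ### Partial derivatives commute -/

section Calculus

variable {n : ℕ}

theorem contDiff_pderiv {m : ℕ} {f : Space n → ℂ} (i : Fin n)
    (hf : ContDiff ℝ ((m + 1 : ℕ) : WithTop ℕ∞) f) : ContDiff ℝ (m : WithTop ℕ∞) (pderiv i f) := by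
  have h : ContDiff ℝ (m : WithTop ℕ∞) (fderiv ℝ f) := hf.fderiv_right (by norm_cast)
  exact h.clm_apply contDiff_const

theorem pderiv_comm {f : Space n → ℂ} (hf : ContDiff ℝ 2 f) (i j : Fin n) :
    pderiv i (pderiv j f) = pderiv j (pderiv i f) := by
  funext x
  have h1 : Differentiable ℝ (fderiv ℝ f) :=
    (hf.fderiv_right (m := 1) (by norm_num)).differentiable one_ne_zero
  have h2 : ∀ v w : Space n, fderiv ℝ (fun y => fderiv ℝ f y v) x w =
      fderiv ℝ (fderiv ℝ f) x w v := by
    intro v w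
    rw [fderiv_clm_apply (h1 x) (differentiableAt_const v)]
    simp
  have h3 := (hf.contDiffAt (x := x)).isSymmSndFDerivAt (by simp)
  unfold pderiv
  rw [h2, h2]
  exact h3 _ _

theorem contDiff_pderiv_iterate {m k : ℕ} {f : Space n → ℂ} (i : Fin n)
    (hf : ContDiff ℝ ((m + k : ℕ) : WithTop ℕ∞) f) :
    ContDiff ℝ (m : WithTop ℕ∞) ((pderiv i)^[k] f) := by
  induction k generalizing f with
  | zero => simpa using hf
  | succ k ih => exact ih (contDiff_pderiv i hf)

theorem pderiv_iterate_comm {m : ℕ} {f : Space n → ℂ}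
    (hf : ContDiff ℝ ((m + 1 : ℕ) : WithTop ℕ∞) f) (i j : Fin n) :
    pderiv i ((pderiv j)^[m] f) = (pderiv j)^[m] (pderiv i f) := by
  induction m generalizing f with
  | zero => rfl
  | succ m ih =>
    rw [Function.iterate_succ_apply, Function.iterate_succ_apply, ih (contDiff_pderiv j hf),
      pderiv_comm (hf.of_le (by norm_cast; omega))]

/-- The iterated derivative `∂^α` restricted to the directions in a list. -/
noncomputable def listDeriv (l : List (Fin n)) (α : MultiIndex n) (f : Space n → ℂ) : Space n → ℂ :=
  l.foldr (fun i g => (pderiv i)^[α i] g) f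

theorem contDiff_listDeriv {m : ℕ} (l : List (Fin n)) {α : MultiIndex n} {f : Space n → ℂ}
    (hf : ContDiff ℝ ((m + (l.map α).sum : ℕ) : WithTop ℕ∞) f) :
    ContDiff ℝ (m : WithTop ℕ∞) (listDeriv l α f) := by
  induction l generalizing m with
  | nil => simpa [listDeriv] using hf
  | cons j l ih =>
    refine contDiff_pderiv_iterate j (ih ?_)
    convert hf using 2
    simp only [List.map_cons, List.sum_cons]
    ring

theorem listDeriv_add_of_notMem (l : List (Fin n)) {α : MultiIndex n} {f : Space n → ℂ} {i : Fin n}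
    (hi : i ∉ l) : listDeriv l (α + Pi.single i 1) f = listDeriv l α f := by
  induction l with
  | nil => rfl
  | cons j l ih =>
    have hj : j ≠ i := fun h => hi (h ▸ List.mem_cons_self)
    change (pderiv j)^[(α + Pi.single i 1 : MultiIndex n) j] (listDeriv l (α + Pi.single i 1) f) =
      (pderiv j)^[α j] (listDeriv l α f)
    rw [ih fun h => hi (List.mem_cons_of_mem _ h)]
    simp [Pi.single_eq_of_ne hj]

theorem listDeriv_add (l : List (Fin n)) (hl : l.Nodup) {α : MultiIndex n} {f : Space n → ℂ}
    (hf : ContDiff ℝ (((l.map α).sum + 1 : ℕ) : WithTop ℕ∞) f) {i : Fin n} (hi : i ∈ l) :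
    listDeriv l (α + Pi.single i 1) f = pderiv i (listDeriv l α f) := by
  induction l with
  | nil => simp at hi
  | cons j l ih =>
    change (pderiv j)^[(α + Pi.single i 1 : MultiIndex n) j] (listDeriv l (α + Pi.single i 1) f) =
      pderiv i ((pderiv j)^[α j] (listDeriv l α f))
    by_cases hij : i = j
    · subst hij
      rw [listDeriv_add_of_notMem l (List.nodup_cons.mp hl).1]
      simp [← Function.iterate_succ_apply']
    · have hil : i ∈ l := (List.mem_cons.mp hi).resolve_left hij
      rw [ih (List.nodup_cons.mp hl).2 _ hil, pderiv_iterate_comm]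
      · simp [Pi.single_eq_of_ne (Ne.symm hij)]
      · refine contDiff_listDeriv l ?_
        convert hf using 2
        simp only [List.map_cons, List.sum_cons]
        ring
      · exact hf.of_le (by simp only [List.map_cons, List.sum_cons]; norm_cast; omega)

theorem sum_map_finRange (α : MultiIndex n) : ((List.finRange n).map α).sum = order α := by
  rw [order, ← List.ofFn_eq_map, List.sum_ofFn]

theorem contDiff_mderiv {m : ℕ} {α : MultiIndex n} {f : Space n → ℂ}
    (hf : ContDiff ℝ ((m + order α : ℕ) : WithTop ℕ∞) f) :
    ContDiff ℝ (m : WithTop ℕ∞) (mderiv α f) :=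
  contDiff_listDeriv _ (by rwa [sum_map_finRange])

theorem mderiv_add_single {α : MultiIndex n} {f : Space n → ℂ}
    (hf : ContDiff ℝ ((order α + 1 : ℕ) : WithTop ℕ∞) f) (i : Fin n) :
    mderiv (α + Pi.single i 1) f = pderiv i (mderiv α f) :=
  listDeriv_add _ (List.nodup_finRange n) (by rwa [sum_map_finRange]) (List.mem_finRange i)

theorem mderiv_zero (f : Space n → ℂ) : mderiv 0 f = f := by
  suffices h : ∀ l : List (Fin n), listDeriv l 0 f = f from h _
  intro l
  induction l with
  | nil => rfl
  | cons j l ih => exact ih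

theorem order_add_single (α : MultiIndex n) (i : Fin n) :
    order (α + Pi.single i 1) = order α + 1 := by
  simp [order, Finset.sum_add_distrib]

theorem order_zero : order (0 : MultiIndex n) = 0 := by simp [order]

/-- The derivative of a differentiable function along a line parallel to a coordinate axis. -/
theorem hasDerivAt_line {f : Space n → ℂ} (hf : Differentiable ℝ f) (i : Fin n) (x : Space n)
    (s : ℝ) : HasDerivAt (fun s : ℝ => f (x + s • EuclideanSpace.single i 1))
      (pderiv i f (x + s • EuclideanSpace.single i 1)) s := by
  have h2 : HasDerivAt (fun s : ℝ => x + s • EuclideanSpace.single i (1 : ℝ))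
      (EuclideanSpace.single i (1 : ℝ)) s := by
    simpa using ((hasDerivAt_id s).smul_const (EuclideanSpace.single i (1 : ℝ))).const_add x
  exact (hf _).hasFDerivAt.comp_hasDerivAt s h2

/-- Differentiation under an integral over a compact interval, for jointly continuous data. -/
theorem hasDerivAt_intervalIntegral {f f' : ℝ → ℝ → ℂ} (hf : Continuous fun q : ℝ × ℝ => f q.1 q.2)
    (hf' : Continuous fun q : ℝ × ℝ => f' q.1 q.2)
    (h : ∀ u s, HasDerivAt (fun u => f u s) (f' u s) u) (a b u₀ : ℝ) :
    HasDerivAt (fun u => ∫ s in a..b, f u s) (∫ s in a..b, f' u₀ s) u₀ := by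
  obtain ⟨B, hB⟩ := (isCompact_Icc.prod (isCompact_uIcc (a := a) (b := b))).exists_bound_of_continuousOn
    (f := fun q : ℝ × ℝ => f' q.1 q.2) (s := Set.Icc (u₀ - 1) (u₀ + 1) ×ˢ Set.uIcc a b) hf'.continuousOn
  have hs : ∀ u, Continuous (f u) := fun u => hf.comp (by fun_prop : Continuous fun s : ℝ => (u, s))
  refine (intervalIntegral.hasDerivAt_integral_of_dominated_loc_of_deriv_le
    (F := f) (F' := f') (bound := fun _ => B) (s := Set.Icc (u₀ - 1) (u₀ + 1))
    (Icc_mem_nhds (by linarith) (by linarith))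
    (Filter.Eventually.of_forall fun u => (hs u).aestronglyMeasurable)
    ((hs u₀).intervalIntegrable _ _) ?_ ?_ ?_ ?_).2
  · exact (hf'.comp (by fun_prop : Continuous fun s => (u₀, s))).aestronglyMeasurable
  · exact Filter.Eventually.of_forall fun s hs u hu => hB (u, s) ⟨hu, Set.uIoc_subset_uIcc hs⟩
  · exact intervalIntegrable_const
  · exact Filter.Eventually.of_forall fun s _ u _ => h u s

end Calculus

/-! ### Jets of symbols -/

section Jets

variable {n : ℕ}

/-- A family `H S β` of functions of `(x, ξ)` that behaves like the mixed derivatives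
`∂_ξ^S ∂_x^β b` of a symbol `b = H ∅ 0`, where `S` is a set of coordinates (each coordinate of `ξ` is
differentiated at most once) and `|β| ≤ μ`. -/
structure IsJet (μ : ℕ) (H : Finset (Fin n) → MultiIndex n → Space n → Space n → ℂ) : Prop where
  continuous : ∀ S β, order β ≤ μ → Continuous fun p : Space n × Space n => H S β p.1 p.2
  deriv_snd : ∀ S β, order β ≤ μ → ∀ i, i ∉ S → ∀ x ξ, ∀ s : ℝ,
    HasDerivAt (fun s : ℝ => H S β x (ξ + s • EuclideanSpace.single i 1))
      (H (insert i S) β x (ξ + s • EuclideanSpace.single i 1)) s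
  deriv_fst : ∀ S β, order β + 1 ≤ μ → ∀ i, ∀ x ξ, ∀ s : ℝ,
    HasDerivAt (fun s : ℝ => H S β (x + s • EuclideanSpace.single i 1) ξ)
      (H S (β + Pi.single i 1) (x + s • EuclideanSpace.single i 1) ξ) s

/-- The multi-index with entries `1` on `S` and `0` elsewhere. -/
def indicator (S : Finset (Fin n)) : MultiIndex n := fun i => if i ∈ S then 1 else 0

theorem indicator_empty : indicator (∅ : Finset (Fin n)) = 0 := by
  funext i; simp [indicator]

theorem indicator_insert {S : Finset (Fin n)} {i : Fin n} (hi : i ∉ S) :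
    indicator (insert i S) = indicator S + Pi.single i 1 := by
  funext j
  by_cases hj : j = i
  · subst hj; simp [indicator, hi]
  · simp [indicator, hj]

theorem order_indicator (S : Finset (Fin n)) : order (indicator S) = S.card := by
  simp [order, indicator]

variable {k : ℝ} {μ : ℕ} {a : Space n → Space n → ℂ} {C : MultiIndex n → MultiIndex n → ℝ}

theorem IsSymbol.hasDerivAt_snd (ha : IsSymbol k μ a C) (α : MultiIndex n) {β : MultiIndex n}
    (hβ : order β ≤ μ) (i : Fin n) (x ξ : Space n) (s : ℝ) :
    HasDerivAt (fun s : ℝ => symbolDeriv α β a x (ξ + s • EuclideanSpace.single i 1))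
      (symbolDeriv (α + Pi.single i 1) β a x (ξ + s • EuclideanSpace.single i 1)) s := by
  have hsm := ha.contDiff_snd β hβ x
  have h1 : ContDiff ℝ ((1 : ℕ) : WithTop ℕ∞) (mderiv α fun ξ => mderiv β (fun y => a y ξ) x) :=
    contDiff_mderiv (hsm.of_le (by exact_mod_cast le_top))
  have h2 := hasDerivAt_line (h1.differentiable (by simp)) i ξ s
  rwa [← mderiv_add_single (hsm.of_le (by exact_mod_cast le_top))] at h2

/-- Differentiation in `x` of `∂_ξ^S ∂_x^β a`, in integrated form. It passes from `S` to
`insert i S` by differentiation under the integral, so that mixed derivatives may be taken in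
either order. -/
theorem IsSymbol.sub_eq_integral (ha : IsSymbol k μ a C) (S : Finset (Fin n)) {β : MultiIndex n}
    (hβ : order β + 1 ≤ μ) (i : Fin n) (x ξ : Space n) (t : ℝ) :
    symbolDeriv (indicator S) β a (x + t • EuclideanSpace.single i 1) ξ -
        symbolDeriv (indicator S) β a x ξ =
      ∫ s in (0 : ℝ)..t,
        symbolDeriv (indicator S) (β + Pi.single i 1) a (x + s • EuclideanSpace.single i 1) ξ := by
  have hβ' : order (β + Pi.single i 1) ≤ μ := by rwa [order_add_single]
  have hcont : ∀ T, Continuous fun p : Space n × Space n =>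
      symbolDeriv (indicator T) (β + Pi.single i 1) a p.1 p.2 :=
    fun T => ha.continuous_deriv _ _ hβ'
  induction S using Finset.induction_on generalizing x ξ with
  | empty =>
    simp only [indicator_empty, symbolDeriv, mderiv_zero]
    have h1 : ContDiff ℝ ((1 : ℕ) : WithTop ℕ∞) (mderiv β fun y => a y ξ) :=
      contDiff_mderiv ((ha.contDiff_fst ξ).of_le (by norm_cast; omega))
    have h2 := fun s => hasDerivAt_line (h1.differentiable (by simp)) i x s
    rw [← mderiv_add_single ((ha.contDiff_fst ξ).of_le (by norm_cast))] at h2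
    have h3 : Continuous fun s : ℝ =>
        mderiv (β + Pi.single i 1) (fun y => a y ξ) (x + s • EuclideanSpace.single i 1) := by
      have := hcont ∅
      simp only [indicator_empty, symbolDeriv, mderiv_zero] at this
      exact this.comp (by fun_prop : Continuous fun s : ℝ =>
        ((x + s • EuclideanSpace.single i 1, ξ) : Space n × Space n))
    rw [intervalIntegral.integral_eq_sub_of_hasDerivAt (fun s _ => h2 s)
      (h3.intervalIntegrable _ _)]
    simp
  | insert j S hj ih =>
    rw [indicator_insert hj]
    have hL := (ha.hasDerivAt_snd (indicator S) (by omega : order β ≤ μ) j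
      (x + t • EuclideanSpace.single i 1) ξ 0).sub
      (ha.hasDerivAt_snd (indicator S) (by omega : order β ≤ μ) j x ξ 0)
    have hc1 := hcont S
    have hc2 := hcont (insert j S)
    have hline : Continuous fun q : ℝ × ℝ => ((x + q.2 • EuclideanSpace.single i 1,
        ξ + q.1 • EuclideanSpace.single j 1) : Space n × Space n) := by fun_prop
    have hR := hasDerivAt_intervalIntegral
      (f := fun u s => symbolDeriv (indicator S) (β + Pi.single i 1) a
        (x + s • EuclideanSpace.single i 1) (ξ + u • EuclideanSpace.single j 1))
      (f' := fun u s => symbolDeriv (indicator (insert j S)) (β + Pi.single i 1) a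
        (x + s • EuclideanSpace.single i 1) (ξ + u • EuclideanSpace.single j 1))
      (by exact hc1.comp hline) (by exact hc2.comp hline)
      (fun u s => by
        rw [indicator_insert hj]
        exact ha.hasDerivAt_snd _ hβ' j _ ξ u) 0 t 0
    have heq := hL.unique (hR.congr_of_eventuallyEq
      (Filter.Eventually.of_forall fun u => ih x (ξ + u • EuclideanSpace.single j 1)))
    simpa [indicator_insert hj] using heq

theorem IsSymbol.isJet (ha : IsSymbol k μ a C) :
    IsJet μ fun S β x ξ => symbolDeriv (indicator S) β a x ξ where
  continuous S β hβ := ha.continuous_deriv _ _ hβ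
  deriv_snd S β hβ i hi x ξ s := by
    simp only [indicator_insert hi]
    exact ha.hasDerivAt_snd _ hβ i x ξ s
  deriv_fst S β hβ i x ξ s := by
    have hc : Continuous fun s : ℝ =>
        symbolDeriv (indicator S) (β + Pi.single i 1) a (x + s • EuclideanSpace.single i 1) ξ :=
      (ha.continuous_deriv (indicator S) _ (by rwa [order_add_single])).comp
        (by fun_prop : Continuous fun s : ℝ =>
          ((x + s • EuclideanSpace.single i 1, ξ) : Space n × Space n))
    have h1 := (intervalIntegral.integral_hasDerivAt_right (hc.intervalIntegrable 0 s)
      (hc.stronglyMeasurableAtFilter _ _) hc.continuousAt).const_add (symbolDeriv (indicator S) β a x ξ)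
    refine h1.congr_of_eventuallyEq (Filter.Eventually.of_forall fun t => ?_)
    simp only [← ha.sub_eq_integral S hβ i x ξ t]
    ring

end Jets

/-! ### Multiplication of a jet by a power of the bracket -/

section Bracket

variable {n : ℕ}

theorem bracket_pos (ξ : Space n) : 0 < bracket ξ := by unfold bracket; positivity

theorem one_le_bracket (ξ : Space n) : 1 ≤ bracket ξ :=
  Real.one_le_rpow (by nlinarith [sq_nonneg ‖ξ‖]) (by norm_num)

theorem bracket_rpow (ξ : Space n) (p : ℝ) : bracket ξ ^ p = (1 + ‖ξ‖ ^ 2) ^ (p / 2) := by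
  rw [bracket, ← Real.rpow_mul (by positivity)]
  congr 1
  ring

theorem abs_coord_le_bracket (ξ : Space n) (i : Fin n) : |ξ i| ≤ bracket ξ := by
  have h1 : ‖ξ i‖ ≤ ‖ξ‖ := PiLp.norm_apply_le ξ i
  have h2 : bracket ξ = √(1 + ‖ξ‖ ^ 2) := by rw [bracket, Real.sqrt_eq_rpow]
  rw [h2]
  exact h1.trans (Real.le_sqrt_of_sq_le (by linarith))

/-- The derivative `∂_ξ^S ⟨ξ⟩^p`, each coordinate in `S` being differentiated once. -/
noncomputable def bracketJet (p : ℝ) (S : Finset (Fin n)) (ξ : Space n) : ℝ :=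
  (∏ m ∈ Finset.range S.card, (p - 2 * m)) * (∏ j ∈ S, ξ j) * (1 + ‖ξ‖ ^ 2) ^ (p / 2 - S.card)

theorem bracketJet_empty (p : ℝ) (ξ : Space n) : bracketJet p ∅ ξ = bracket ξ ^ p := by
  simp [bracketJet, bracket_rpow]

theorem continuous_bracketJet (p : ℝ) (S : Finset (Fin n)) : Continuous (bracketJet p S) := by
  unfold bracketJet
  refine (continuous_const.mul (by fun_prop)).mul ?_
  exact (by fun_prop : Continuous fun ξ : Space n => 1 + ‖ξ‖ ^ 2).rpow_const
    fun ξ => Or.inl (by positivity)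

theorem norm_add_smul_single_sq (ξ : Space n) (i : Fin n) (s : ℝ) :
    ‖ξ + s • EuclideanSpace.single i (1 : ℝ)‖ ^ 2 = ‖ξ‖ ^ 2 + 2 * s * ξ i + s ^ 2 := by
  rw [norm_add_sq_real, inner_smul_right, EuclideanSpace.inner_single_right, norm_smul]
  simp
  ring

theorem hasDerivAt_bracketJet (p : ℝ) {S : Finset (Fin n)} {i : Fin n} (hi : i ∉ S) (ξ : Space n)
    (s : ℝ) : HasDerivAt (fun s : ℝ => bracketJet p S (ξ + s • EuclideanSpace.single i 1))
      (bracketJet p (insert i S) (ξ + s • EuclideanSpace.single i 1)) s := by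
  have hprod : ∀ s : ℝ, ∏ j ∈ S, (ξ + s • EuclideanSpace.single i (1 : ℝ)) j = ∏ j ∈ S, ξ j := by
    intro s
    refine Finset.prod_congr rfl fun j hj => ?_
    have : j ≠ i := fun h => hi (h ▸ hj)
    simp [this]
  have h1 : HasDerivAt (fun s : ℝ => 1 + ‖ξ + s • EuclideanSpace.single i (1 : ℝ)‖ ^ 2)
      (2 * (ξ i + s)) s := by
    simp only [norm_add_smul_single_sq]
    have h := ((((hasDerivAt_id' s).const_mul 2).mul_const (ξ i)).const_add (‖ξ‖ ^ 2)).fun_add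
      ((hasDerivAt_id' s).fun_pow 2)
    refine (h.const_add 1).congr_deriv ?_
    simp
    ring
  have h2 := (h1.rpow_const (p := p / 2 - S.card) (Or.inl (by positivity))).const_mul
    ((∏ m ∈ Finset.range S.card, (p - 2 * m)) * ∏ j ∈ S, ξ j)
  simp only [bracketJet, hprod, Finset.card_insert_of_notMem hi, Finset.prod_insert hi,
    Finset.prod_range_succ]
  refine h2.congr_deriv ?_
  rw [show p / 2 - ((S.card + 1 : ℕ) : ℝ) = p / 2 - S.card - 1 by push_cast; ring]
  simp
  ring

theorem exists_bracketJet_bound (n : ℕ) (p : ℝ) : ∃ K : ℝ, 0 < K ∧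
    ∀ (S : Finset (Fin n)) (ξ : Space n), |bracketJet p S ξ| ≤ K * bracket ξ ^ (p - S.card) := by
  refine ⟨1 + ∑ S : Finset (Fin n), |∏ m ∈ Finset.range S.card, (p - 2 * m)|, by positivity, ?_⟩
  intro S ξ
  have h1 : |∏ m ∈ Finset.range S.card, (p - 2 * (m : ℝ))| ≤
      1 + ∑ S : Finset (Fin n), |∏ m ∈ Finset.range S.card, (p - 2 * (m : ℝ))| := by
    have := Finset.single_le_sum (f := fun S : Finset (Fin n) =>
      |∏ m ∈ Finset.range S.card, (p - 2 * (m : ℝ))|) (fun _ _ => abs_nonneg _) (Finset.mem_univ S)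
    linarith
  have h2 : |∏ j ∈ S, ξ j| ≤ bracket ξ ^ (S.card : ℝ) := by
    rw [Finset.abs_prod, Real.rpow_natCast, ← Finset.prod_const]
    exact Finset.prod_le_prod (fun _ _ => abs_nonneg _) fun j _ => abs_coord_le_bracket ξ j
  have h3 : (1 + ‖ξ‖ ^ 2) ^ (p / 2 - S.card) = bracket ξ ^ (p - 2 * S.card) := by
    rw [bracket_rpow]
    congr 1
    ring
  rw [bracketJet, abs_mul, abs_mul, h3, abs_of_pos (Real.rpow_pos_of_pos (bracket_pos ξ) _), mul_assoc]
  have h4 : bracket ξ ^ (p - S.card) = bracket ξ ^ (S.card : ℝ) * bracket ξ ^ (p - 2 * S.card) := by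
    rw [← Real.rpow_add (bracket_pos ξ)]
    congr 1
    ring
  rw [h4]
  have := (Real.rpow_pos_of_pos (bracket_pos ξ) (p - 2 * S.card)).le
  gcongr

/-- The jet of the product of a symbol with `⟨ξ⟩^p`, by the Leibniz rule. -/
noncomputable def mulBracket (p : ℝ) (H : Finset (Fin n) → MultiIndex n → Space n → Space n → ℂ) :
    Finset (Fin n) → MultiIndex n → Space n → Space n → ℂ :=
  fun S β x ξ => ∑ R ∈ S.powerset, H R β x ξ * (bracketJet p (S \ R) ξ : ℂ)

theorem IsJet.mulBracket {μ : ℕ} {H : Finset (Fin n) → MultiIndex n → Space n → Space n → ℂ}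
    (hH : IsJet μ H) (p : ℝ) : IsJet μ (mulBracket p H) where
  continuous S β hβ := by
    refine continuous_finsetSum _ fun R _ => (hH.continuous R β hβ).mul ?_
    exact Complex.continuous_ofReal.comp ((continuous_bracketJet p _).comp continuous_snd)
  deriv_snd S β hβ i hi x ξ s := by
    have h1 : ∀ R ∈ S.powerset, HasDerivAt
        (fun s : ℝ => H R β x (ξ + s • EuclideanSpace.single i 1) *
          (bracketJet p (S \ R) (ξ + s • EuclideanSpace.single i 1) : ℂ))
        (H (insert i R) β x (ξ + s • EuclideanSpace.single i 1) *
          (bracketJet p (S \ R) (ξ + s • EuclideanSpace.single i 1) : ℂ) +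
        H R β x (ξ + s • EuclideanSpace.single i 1) *
          (bracketJet p (insert i (S \ R)) (ξ + s • EuclideanSpace.single i 1) : ℂ)) s := by
      intro R hR
      have hiR : i ∉ R := fun h => hi (Finset.mem_powerset.mp hR h)
      have hiSR : i ∉ S \ R := fun h => hi (Finset.mem_sdiff.mp h).1
      exact (hH.deriv_snd R β hβ i hiR x ξ s).mul (hasDerivAt_bracketJet p hiSR ξ s).ofReal_comp
    have h2 := HasDerivAt.fun_sum h1
    unfold SemiclassicalPsiDO.mulBracket
    refine h2.congr_deriv ?_
    rw [Finset.sum_powerset_insert hi, Finset.sum_add_distrib, add_comm]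
    congr 1
    · refine Finset.sum_congr rfl fun R hR => ?_
      rw [Finset.insert_sdiff_of_notMem _ fun h => hi (Finset.mem_powerset.mp hR h)]
    · refine Finset.sum_congr rfl fun R hR => ?_
      rw [Finset.insert_sdiff_insert, Finset.sdiff_insert_of_notMem hi]
  deriv_fst S β hβ i x ξ s :=
    HasDerivAt.fun_sum fun R _ => (hH.deriv_fst R β hβ i x ξ s).mul_const _

theorem norm_mulBracket_le {p K : ℝ} {H : Finset (Fin n) → MultiIndex n → Space n → Space n → ℂ}
    (hK : ∀ (S : Finset (Fin n)) (ξ : Space n), |bracketJet p S ξ| ≤ K * bracket ξ ^ (p - S.card))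
    {k : ℝ} {D : Finset (Fin n) → ℝ} {β : MultiIndex n} {x ξ : Space n} (S : Finset (Fin n))
    (hD : ∀ R, ‖H R β x ξ‖ ≤ D R * bracket ξ ^ (k - R.card)) :
    ‖mulBracket p H S β x ξ‖ ≤ K * (∑ R ∈ S.powerset, D R) * bracket ξ ^ (k + p - S.card) := by
  rw [Finset.mul_sum, Finset.sum_mul]
  refine (norm_sum_le _ _).trans (Finset.sum_le_sum fun R hR => ?_)
  rw [norm_mul, Complex.norm_real, Real.norm_eq_abs]
  have hc : ((S \ R).card : ℝ) = S.card - R.card := by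
    rw [Finset.card_sdiff_of_subset (Finset.mem_powerset.mp hR),
      Nat.cast_sub (Finset.card_le_card (Finset.mem_powerset.mp hR))]
  refine (mul_le_mul (hD R) (hK (S \ R) ξ) (abs_nonneg _) ((norm_nonneg _).trans (hD R))).trans
    (le_of_eq ?_)
  rw [hc, show k + p - (S.card : ℝ) = (k - R.card) + (p - (S.card - R.card)) by ring,
    Real.rpow_add (bracket_pos ξ)]
  ring

end Bracket

/-! ### Plancherel's theorem and the Cauchy–Schwarz inequality -/

section Plancherel

open scoped FourierTransform

theorem eLpNorm_two_sq {α : Type*} [MeasurableSpace α] (ν : Measure α) (f : α → ℂ) :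
    eLpNorm f 2 ν ^ 2 = ∫⁻ x, ‖f x‖ₑ ^ 2 ∂ν := by
  have := eLpNorm_nnreal_pow_eq_lintegral (f := f) (μ := ν) (p := 2) two_ne_zero
  simpa using this

theorem lintegral_enorm_mul_le {α : Type*} [MeasurableSpace α] (ν : Measure α) {f g : α → ℂ}
    (hf : AEStronglyMeasurable f ν) (hg : AEStronglyMeasurable g ν) :
    ∫⁻ x, ‖f x‖ₑ * ‖g x‖ₑ ∂ν ≤ eLpNorm f 2 ν * eLpNorm g 2 ν := by
  have h := ENNReal.lintegral_mul_le_Lp_mul_Lq ν Real.HolderConjugate.two_two hf.enorm hg.enorm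
  rw [eLpNorm_eq_lintegral_rpow_enorm_toReal two_ne_zero ENNReal.ofNat_ne_top,
    eLpNorm_eq_lintegral_rpow_enorm_toReal two_ne_zero ENNReal.ofNat_ne_top]
  simpa using h

variable {n : ℕ}

/-- The `L²` Fourier transform of a function in `L¹ ∩ L²` is given by the Fourier integral. -/
theorem fourier_toLp_ae_eq {g : Space n → ℂ} (h1 : Integrable g) (h2 : MemLp g 2) :
    ((𝓕 (h2.toLp g) : L2 n) : Space n → ℂ) =ᵐ[volume] 𝓕 g := by
  have hc : Continuous (𝓕 g) := VectorFourier.fourierIntegral_continuous Real.continuous_fourierChar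
    (L := innerₗ (Space n)) continuous_inner h1
  refine ae_eq_of_integral_contDiff_smul_eq
    ((Lp.memLp _).locallyIntegrable (by norm_num)) hc.locallyIntegrable fun φ hφ hφc => ?_
  have hφc' : HasCompactSupport fun x => (φ x : ℂ) := hφc.comp_left Complex.ofReal_zero
  have hφ' : ContDiff ℝ ∞ fun x => (φ x : ℂ) := Complex.ofRealCLM.contDiff.comp hφ
  set ψ : 𝓢(Space n, ℂ) := hφc'.toSchwartzMap hφ' with hψ
  have hψx : ∀ x, ψ x = (φ x : ℂ) := fun x => rfl
  have h3 : (𝓕 ((h2.toLp g : L2 n) : 𝓢'(Space n, ℂ))) ψ =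
      ((𝓕 (h2.toLp g) : L2 n) : 𝓢'(Space n, ℂ)) ψ := by
    rw [Lp.fourier_toTemperedDistribution_eq]
  rw [TemperedDistribution.fourier_apply, Lp.toTemperedDistribution_apply,
    Lp.toTemperedDistribution_apply] at h3
  have h4 : ∫ x, (𝓕 ψ) x • (h2.toLp g : L2 n) x = ∫ x, (𝓕 ψ) x • g x := by
    refine integral_congr_ae ?_
    filter_upwards [h2.coeFn_toLp] with x hx
    rw [hx]
  have h5 : ∫ x, (𝓕 ψ) x • g x = ∫ x, ψ x • 𝓕 g x := by
    have := VectorFourier.integral_fourierIntegral_smul_eq_flip (L := innerₗ (Space n))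
      (μ := volume) (ν := volume) (f := ψ) (g := g) Real.continuous_fourierChar continuous_inner
      ψ.integrable h1
    rw [flip_innerₗ] at this
    exact this
  calc ∫ x, φ x • (𝓕 (h2.toLp g) : L2 n) x = ∫ x, ψ x • (𝓕 (h2.toLp g) : L2 n) x := by
        simp [hψx]
    _ = ∫ x, ψ x • 𝓕 g x := by rw [← h3, h4, h5]
    _ = ∫ x, φ x • 𝓕 g x := by simp [hψx]

theorem eLpNorm_fourier_eq {g : Space n → ℂ} (h1 : Integrable g) (h2 : MemLp g 2) :
    eLpNorm (𝓕 g) 2 volume = eLpNorm g 2 volume := by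
  rw [← eLpNorm_congr_ae (fourier_toLp_ae_eq h1 h2)]
  have h3 := Lp.norm_fourier_eq (h2.toLp g)
  have h4 : ‖(𝓕 (h2.toLp g) : L2 n)‖ₑ = ‖h2.toLp g‖ₑ := by
    rw [← ofReal_norm, ← ofReal_norm, h3]
  rwa [Lp.enorm_def, Lp.enorm_def, eLpNorm_congr_ae h2.coeFn_toLp] at h4

end Plancherel

/-! ### Oscillatory forms -/

section Form

open scoped FourierTransform

variable {n : ℕ}

/-- The phase `e^{-2πi⟨x,η⟩}`. -/
noncomputable def phase (x η : Space n) : ℂ := (Real.fourierChar (-(inner ℝ x η : ℝ)) : ℂ)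

theorem norm_phase (x η : Space n) : ‖phase x η‖ = 1 := Circle.norm_coe _

theorem continuous_phase : Continuous fun p : Space n × Space n => phase p.1 p.2 := by
  unfold phase
  exact continuous_subtype_val.comp (Real.continuous_fourierChar.comp (by fun_prop))

theorem phase_add_left (x y η : Space n) : phase (x + y) η = phase x η * phase y η := by
  simp only [phase, inner_add_left, neg_add, AddChar.map_add_eq_mul, Circle.coe_mul]

theorem phase_add_right (x η ζ : Space n) : phase x (η + ζ) = phase x η * phase x ζ := by
  simp only [phase, inner_add_right, neg_add, AddChar.map_add_eq_mul, Circle.coe_mul]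

theorem phase_comm (x η : Space n) : phase x η = phase η x := by
  simp only [phase, real_inner_comm]

theorem fourier_eq_integral_phase (g : Space n → ℂ) (η : Space n) :
    𝓕 g η = ∫ x, phase x η * g x := by
  rw [Real.fourier_eq]
  rfl

/-- The functions against which oscillatory forms are tested: measurable functions in
`L¹ ∩ L²`. -/
structure IsTest (f : Space n → ℂ) : Prop where
  measurable : Measurable f
  integrable : Integrable f
  memLp : MemLp f 2

theorem IsTest.mul_bdd {f u : Space n → ℂ} (hf : IsTest f) (hu : Measurable u) {B : ℝ}
    (hB : ∀ x, ‖u x‖ ≤ B) : IsTest fun x => u x * f x where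
  measurable := hu.mul hf.measurable
  integrable := hf.integrable.bdd_mul hu.aestronglyMeasurable (Filter.Eventually.of_forall hB)
  memLp := by
    refine (hf.memLp.const_mul (B : ℂ)).mono (hu.mul hf.measurable).aestronglyMeasurable
      (Filter.Eventually.of_forall fun x => ?_)
    rw [norm_mul, norm_mul]
    gcongr
    exact (hB x).trans (by rw [Complex.norm_real]; exact le_abs_self B)

theorem IsTest.comp_add_left {f : Space n → ℂ} (hf : IsTest f) (x : Space n) :
    IsTest fun t => f (x + t) where
  measurable := hf.measurable.comp (measurable_const_add x)
  integrable := hf.integrable.comp_add_left x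
  memLp := hf.memLp.comp_measurePreserving (measurePreserving_add_left volume x)

/-- The form `∫∫ e^{-2πi⟨x,η⟩} σ(x,η) F(η) v(x) dx dη`. -/
noncomputable def form (σ : Space n → Space n → ℂ) (F v : Space n → ℂ) : ℂ :=
  ∫ p : Space n × Space n, phase p.1 p.2 * σ p.1 p.2 * (v p.1 * F p.2) ∂(volume.prod volume)

/-- A jointly measurable bounded symbol. -/
structure IsBddSymbol (σ : Space n → Space n → ℂ) (M : ℝ) : Prop where
  measurable : Measurable fun p : Space n × Space n => σ p.1 p.2
  bound : ∀ x η, ‖σ x η‖ ≤ M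

/-- The form of `σ` is bounded by `N` on `L² × L²`. The form is bilinear, without complex conjugation,
and is tested on `L¹ ∩ L²`, where its defining integral converges absolutely. -/
def FormBound (σ : Space n → Space n → ℂ) (N : ℝ≥0∞) : Prop :=
  ∀ F v, IsTest F → IsTest v → ‖form σ F v‖ₑ ≤ N * (eLpNorm F 2 volume * eLpNorm v 2 volume)

theorem FormBound.mono {σ : Space n → Space n → ℂ} {N N' : ℝ≥0∞} (h : FormBound σ N)
    (hN : N ≤ N') : FormBound σ N' := fun F v hF hv => (h F v hF hv).trans (by gcongr)

theorem measurable_phase : Measurable fun p : Space n × Space n => phase p.1 p.2 :=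
  continuous_phase.measurable

theorem IsTest.integrable_prod {F v : Space n → ℂ} (hF : IsTest F) (hv : IsTest v) :
    Integrable (fun p : Space n × Space n => v p.1 * F p.2) (volume.prod volume) := by
  exact hv.integrable.mul_prod hF.integrable

theorem IsBddSymbol.integrable_integrand {σ : Space n → Space n → ℂ} {M : ℝ}
    (hσ : IsBddSymbol σ M) {F v : Space n → ℂ} (hF : IsTest F) (hv : IsTest v) :
    Integrable (fun p : Space n × Space n => phase p.1 p.2 * σ p.1 p.2 * (v p.1 * F p.2))
      (volume.prod volume) := by
  refine (hF.integrable_prod hv).bdd_mul (c := M)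
    (measurable_phase.mul hσ.measurable).aestronglyMeasurable (Filter.Eventually.of_forall fun p => ?_)
  rw [norm_mul, norm_phase, one_mul]
  exact hσ.bound _ _

theorem FormBound.add {σ τ : Space n → Space n → ℂ} {M M' : ℝ} {N N' : ℝ≥0∞}
    (hσ : IsBddSymbol σ M) (hτ : IsBddSymbol τ M') (h : FormBound σ N) (h' : FormBound τ N') :
    FormBound (fun x η => σ x η + τ x η) (N + N') := by
  intro F v hF hv
  have : form (fun x η => σ x η + τ x η) F v = form σ F v + form τ F v := by
    unfold form
    rw [← integral_add (hσ.integrable_integrand hF hv) (hτ.integrable_integrand hF hv)]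
    congr 1
    funext p
    ring
  rw [this, add_mul]
  exact (enorm_add_le _ _).trans (add_le_add (h F v hF hv) (h' F v hF hv))

theorem FormBound.sum {ι : Type*} (s : Finset ι) {σ : ι → Space n → Space n → ℂ} {M : ι → ℝ}
    {N : ι → ℝ≥0∞} (hσ : ∀ i, IsBddSymbol (σ i) (M i)) (h : ∀ i ∈ s, FormBound (σ i) (N i)) :
    FormBound (fun x η => ∑ i ∈ s, σ i x η) (∑ i ∈ s, N i) := by
  intro F v hF hv
  have : form (fun x η => ∑ i ∈ s, σ i x η) F v = ∑ i ∈ s, form (σ i) F v := by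
    unfold form
    rw [← integral_finsetSum _ fun i _ => (hσ i).integrable_integrand hF hv]
    congr 1
    funext p
    rw [Finset.mul_sum, Finset.sum_mul]
  rw [this, Finset.sum_mul]
  exact (enorm_sum_le _ _).trans (Finset.sum_le_sum fun i hi => h i hi F v hF hv)

theorem FormBound.const_mul {σ : Space n → Space n → ℂ} {N : ℝ≥0∞} (h : FormBound σ N) (c : ℂ) :
    FormBound (fun x η => c * σ x η) (‖c‖ₑ * N) := by
  intro F v hF hv
  have : form (fun x η => c * σ x η) F v = c * form σ F v := by
    unfold form
    rw [← integral_const_mul]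
    congr 1
    funext p
    ring
  rw [this, enorm_mul, mul_assoc]
  gcongr
  exact h F v hF hv

/-- A superposition of symbols inherits the integrated form bound. -/
theorem FormBound.integral {T : Type*} [MeasurableSpace T] {ν : Measure T} [SFinite ν]
    {σ : T → Space n → Space n → ℂ} {M : T → ℝ} {N : T → ℝ≥0∞}
    (hm : Measurable fun q : T × (Space n × Space n) => σ q.1 q.2.1 q.2.2) (hMi : Integrable M ν)
    (hM : ∀ t x η, ‖σ t x η‖ ≤ M t) (h : ∀ t, FormBound (σ t) (N t)) :
    FormBound (fun x η => ∫ t, σ t x η ∂ν) (∫⁻ t, N t ∂ν) := by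
  intro F v hF hv
  have hmeas : Measurable fun q : T × (Space n × Space n) =>
      phase q.2.1 q.2.2 * σ q.1 q.2.1 q.2.2 * (v q.2.1 * F q.2.2) :=
    ((measurable_phase.comp measurable_snd).mul hm).mul
      ((hv.measurable.comp (measurable_fst.comp measurable_snd)).mul
        (hF.measurable.comp (measurable_snd.comp measurable_snd)))
  have hint : Integrable (fun q : T × (Space n × Space n) =>
      phase q.2.1 q.2.2 * σ q.1 q.2.1 q.2.2 * (v q.2.1 * F q.2.2)) (ν.prod (volume.prod volume)) := by
    refine (hMi.mul_prod (hF.integrable_prod hv).norm).mono hmeas.aestronglyMeasurable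
      (Filter.Eventually.of_forall fun q => ?_)
    rw [norm_mul, norm_mul, norm_phase, one_mul, norm_mul (M q.1), norm_norm]
    gcongr
    exact (hM _ _ _).trans (le_abs_self _)
  have h1 : form (fun x η => ∫ t, σ t x η ∂ν) F v = ∫ t, form (σ t) F v ∂ν := by
    unfold form
    rw [integral_integral_swap (f := fun t (p : Space n × Space n) =>
      phase p.1 p.2 * σ t p.1 p.2 * (v p.1 * F p.2)) hint]
    congr 1
    funext p
    rw [← integral_const_mul, ← integral_mul_const]
  rw [h1]
  have hfin : eLpNorm F 2 volume * eLpNorm v 2 volume ≠ ⊤ :=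
    ENNReal.mul_ne_top hF.memLp.eLpNorm_ne_top hv.memLp.eLpNorm_ne_top
  rw [← lintegral_mul_const' _ _ hfin]
  exact (enorm_integral_le_lintegral_enorm _).trans (lintegral_mono fun t => h t F v hF hv)

/-- A product symbol `u(x) w(η)` is a multiplication operator composed with a Fourier
multiplier. -/
theorem FormBound.mul_mul {u w : Space n → ℂ} {A B : ℝ} (hu : Measurable u) (hw : Measurable w)
    (hA : ∀ x, ‖u x‖ ≤ A) (hB : ∀ η, ‖w η‖ ≤ B) :
    FormBound (fun x η => u x * w η) (ENNReal.ofReal A * ENNReal.ofReal B) := by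
  intro F v hF hv
  have hsym : IsBddSymbol (fun x η => u x * w η) (A * B) :=
    ⟨(hu.comp measurable_fst).mul (hw.comp measurable_snd), fun x η => by
      rw [norm_mul]
      exact mul_le_mul (hA x) (hB η) (norm_nonneg _) ((norm_nonneg _).trans (hA x))⟩
  have hwF := hF.mul_bdd hw hB
  have huv := hv.mul_bdd hu hA
  have h1 : form (fun x η => u x * w η) F v = ∫ x, (u x * v x) * 𝓕 (fun η => w η * F η) x := by
    unfold form
    rw [integral_prod _ (hsym.integrable_integrand hF hv)]
    congr 1
    funext x
    rw [fourier_eq_integral_phase, ← integral_const_mul]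
    congr 1
    funext η
    simp only [phase_comm η x]
    ring
  have hcont : Continuous (𝓕 fun η => w η * F η) :=
    VectorFourier.fourierIntegral_continuous Real.continuous_fourierChar
      (L := innerₗ (Space n)) continuous_inner hwF.integrable
  have hle : ∀ {f g : Space n → ℂ} {D : ℝ}, (∀ x, ‖g x‖ ≤ D) →
      eLpNorm (fun x => g x * f x) 2 volume ≤ ENNReal.ofReal D * eLpNorm f 2 volume := by
    intro f g D hD
    refine eLpNorm_le_mul_eLpNorm_of_ae_le_mul (Filter.Eventually.of_forall fun x => ?_) _
    rw [norm_mul]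
    gcongr
    exact hD x
  calc ‖form (fun x η => u x * w η) F v‖ₑ
      ≤ ∫⁻ x, ‖u x * v x‖ₑ * ‖𝓕 (fun η => w η * F η) x‖ₑ := by
        rw [h1]
        refine (enorm_integral_le_lintegral_enorm _).trans (le_of_eq ?_)
        simp only [enorm_mul]
    _ ≤ eLpNorm (fun x => u x * v x) 2 volume * eLpNorm (fun η => w η * F η) 2 volume := by
        rw [← eLpNorm_fourier_eq hwF.integrable hwF.memLp]
        exact lintegral_enorm_mul_le _ huv.measurable.aestronglyMeasurable
          hcont.aestronglyMeasurable
    _ ≤ (ENNReal.ofReal A * eLpNorm v 2 volume) * (ENNReal.ofReal B * eLpNorm F 2 volume) :=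
        mul_le_mul' (hle hA) (hle hB)
    _ = _ := by ring

end Form

/-! ### Symbols that are averages over bounded cells of phase space -/

section Cells

open scoped FourierTransform Nat

variable {n : ℕ}

/-- The monomial `∏ᵢ t_{w i}` attached to a word `w` in the coordinates. -/
noncomputable def monomial {k : ℕ} (w : Fin k → Fin n) (t : Space n) : ℂ := ∏ i, (t (w i) : ℂ)

theorem continuous_monomial {k : ℕ} (w : Fin k → Fin n) : Continuous (monomial w) := by
  unfold monomial
  fun_prop

theorem norm_monomial_le {k : ℕ} (w : Fin k → Fin n) {t : Space n} {L : ℝ} (ht : ∀ i, |t i| ≤ L) :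
    ‖monomial w t‖ ≤ L ^ k := by
  rw [monomial, norm_prod]
  calc ∏ i, ‖(t (w i) : ℂ)‖ ≤ ∏ _i : Fin k, L :=
        Finset.prod_le_prod (fun _ _ => norm_nonneg _) fun i _ => by
          rw [Complex.norm_real]
          exact ht _
    _ = L ^ k := by simp

theorem inner_pow_eq_sum_monomial (t τ : Space n) (k : ℕ) :
    ((inner ℝ t τ : ℝ) : ℂ) ^ k = ∑ w : Fin k → Fin n, monomial w t * monomial w τ := by
  have h : ((inner ℝ t τ : ℝ) : ℂ) = ∑ i, (t i : ℂ) * (τ i : ℂ) := by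
    rw [PiLp.inner_apply]
    push_cast
    exact Finset.sum_congr rfl fun i _ => by simp [mul_comm]
  rw [h, Fintype.sum_pow]
  simp only [monomial, Finset.prod_mul_distrib]

theorem abs_inner_le {t τ : Space n} {L : ℝ} (ht : ∀ i, |t i| ≤ L) (hτ : ∀ i, |τ i| ≤ L) :
    |(inner ℝ t τ : ℝ)| ≤ n * L ^ 2 := by
  rw [PiLp.inner_apply]
  calc |∑ i, inner ℝ (t i) (τ i)| ≤ ∑ i, |inner ℝ (t i) (τ i)| := Finset.abs_sum_le_sum_abs _ _
    _ ≤ ∑ _i : Fin n, L ^ 2 := by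
        refine Finset.sum_le_sum fun i _ => ?_
        simp only [RCLike.inner_apply, conj_trivial, abs_mul, sq]
        exact mul_le_mul (hτ i) (ht i) (abs_nonneg _) ((abs_nonneg _).trans (hτ i))
    _ = n * L ^ 2 := by simp

theorem phase_hasSum (t τ : Space n) :
    HasSum (fun k : ℕ => (-(2 * Real.pi * Complex.I)) ^ k / (k ! : ℂ) * ((inner ℝ t τ : ℝ) : ℂ) ^ k)
      (phase t τ) := by
  have h := NormedSpace.expSeries_div_hasSum_exp (-(2 * Real.pi * Complex.I) * ((inner ℝ t τ : ℝ) : ℂ))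
  rw [← Complex.exp_eq_exp_ℂ] at h
  have h2 : phase t τ = Complex.exp (-(2 * Real.pi * Complex.I) * ((inner ℝ t τ : ℝ) : ℂ)) := by
    rw [phase, Real.fourierChar_apply]
    congr 1
    push_cast
    ring
  rw [h2]
  refine h.congr_fun fun k => ?_
  rw [mul_pow]
  ring

theorem tsum_ofReal_pow_div_factorial {r : ℝ} (hr : 0 ≤ r) :
    ∑' k : ℕ, ENNReal.ofReal (r ^ k / k !) = ENNReal.ofReal (Real.exp r) := by
  have h := NormedSpace.expSeries_div_hasSum_exp r
  rw [← Real.exp_eq_exp_ℝ] at h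
  rw [← h.tsum_eq, ENNReal.ofReal_tsum_of_nonneg (fun k => by positivity) h.summable]

/-- The kernel `e^{-2πi⟨t,τ⟩}` on a bounded set is an absolutely convergent sum of products of a
function of `t` and a function of `τ`, by the exponential series. -/
theorem enorm_integral_phase_le {μ₁ μ₂ : Measure (Space n)} [SFinite μ₁] [SFinite μ₂] {L : ℝ}
    (hμ₁ : ∀ᵐ t ∂μ₁, ∀ i, |t i| ≤ L) (hμ₂ : ∀ᵐ t ∂μ₂, ∀ i, |t i| ≤ L) {A B : Space n → ℂ}
    (hA : Integrable A μ₁) (hB : Integrable B μ₂) :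
    ‖∫ q : Space n × Space n, phase q.1 q.2 * (A q.1 * B q.2) ∂(μ₁.prod μ₂)‖ₑ ≤
      ∑' k : ℕ, ENNReal.ofReal ((2 * Real.pi) ^ k / k !) * ∑ w : Fin k → Fin n,
        ‖∫ t, monomial w t * A t ∂μ₁‖ₑ * ‖∫ τ, monomial w τ * B τ ∂μ₂‖ₑ := by
  have hint : Integrable (fun q : Space n × Space n => A q.1 * B q.2) (μ₁.prod μ₂) := hA.mul_prod hB
  set f : ℕ → Space n × Space n → ℂ := fun k q =>
    (-(2 * Real.pi * Complex.I)) ^ k / (k ! : ℂ) * ((inner ℝ q.1 q.2 : ℝ) : ℂ) ^ k *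
      (A q.1 * B q.2) with hf
  have hcoef : ∀ k : ℕ, ‖(-(2 * Real.pi * Complex.I)) ^ k / (k ! : ℂ)‖ = (2 * Real.pi) ^ k / k ! := by
    intro k
    rw [norm_div, norm_pow, norm_neg, norm_mul, norm_mul, Complex.norm_I, Complex.norm_real,
      Real.norm_eq_abs, abs_of_pos Real.pi_pos]
    simp
  have hcont : ∀ k : ℕ, Continuous fun q : Space n × Space n =>
      (-(2 * Real.pi * Complex.I)) ^ k / (k ! : ℂ) * ((inner ℝ q.1 q.2 : ℝ) : ℂ) ^ k := by
    intro k
    exact continuous_const.mul ((Complex.continuous_ofReal.comp (by fun_prop)).pow k)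
  have hmeas : ∀ k, AEStronglyMeasurable (f k) (μ₁.prod μ₂) := fun k =>
    (hcont k).aestronglyMeasurable.mul hint.aestronglyMeasurable
  have hae : ∀ᵐ q ∂(μ₁.prod μ₂), ∀ k, ‖f k q‖ₑ ≤
      ENNReal.ofReal ((2 * Real.pi * (n * L ^ 2)) ^ k / k !) * ‖A q.1 * B q.2‖ₑ := by
    have h1 : ∀ᵐ q ∂(μ₁.prod μ₂), ∀ i, |q.1 i| ≤ L := Measure.quasiMeasurePreserving_fst.ae hμ₁
    have h2 : ∀ᵐ q ∂(μ₁.prod μ₂), ∀ i, |q.2 i| ≤ L := Measure.quasiMeasurePreserving_snd.ae hμ₂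
    filter_upwards [h1, h2] with q hq1 hq2 k
    rw [hf, enorm_mul]
    gcongr
    rw [← ofReal_norm]
    refine ENNReal.ofReal_le_ofReal ?_
    rw [norm_mul, hcoef, norm_pow, Complex.norm_real, Real.norm_eq_abs,
      mul_pow (2 * Real.pi) (n * L ^ 2), div_mul_eq_mul_div]
    gcongr
    exact abs_inner_le hq1 hq2
  have hfin : ∑' k, ∫⁻ q, ‖f k q‖ₑ ∂(μ₁.prod μ₂) ≠ ⊤ := by
    refine ne_top_of_le_ne_top (b := ∑' k : ℕ, ENNReal.ofReal ((2 * Real.pi * (n * L ^ 2)) ^ k / k !) *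
      ∫⁻ q, ‖A q.1 * B q.2‖ₑ ∂(μ₁.prod μ₂)) ?_ (ENNReal.tsum_le_tsum fun k => ?_)
    · rw [ENNReal.tsum_mul_right, tsum_ofReal_pow_div_factorial (by positivity)]
      exact ENNReal.mul_ne_top ENNReal.ofReal_ne_top hint.2.ne
    · rw [← lintegral_const_mul' _ _ ENNReal.ofReal_ne_top]
      refine lintegral_mono_ae ?_
      filter_upwards [hae] with q hq using hq k
  have hsum : ∀ q : Space n × Space n, phase q.1 q.2 * (A q.1 * B q.2) = ∑' k, f k q := fun q =>
    ((phase_hasSum q.1 q.2).mul_right (A q.1 * B q.2)).tsum_eq.symm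
  simp only [hsum]
  rw [integral_tsum hmeas hfin]
  refine enorm_tsum_le_tsum_enorm.trans (ENNReal.tsum_le_tsum fun k => ?_)
  have hmon : ∀ (w : Fin k → Fin n) {μ : Measure (Space n)} {G : Space n → ℂ},
      (∀ᵐ t ∂μ, ∀ i, |t i| ≤ L) → Integrable G μ → Integrable (fun t => monomial w t * G t) μ := by
    intro w μ G hμ hG
    refine hG.bdd_mul (c := L ^ k) (continuous_monomial w).aestronglyMeasurable ?_
    filter_upwards [hμ] with t ht using norm_monomial_le w ht
  have hk : ∫ q, f k q ∂(μ₁.prod μ₂) = (-(2 * Real.pi * Complex.I)) ^ k / (k ! : ℂ) *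
      ∑ w : Fin k → Fin n, (∫ t, monomial w t * A t ∂μ₁) * ∫ τ, monomial w τ * B τ ∂μ₂ := by
    rw [← Finset.sum_congr rfl fun w _ => integral_prod_mul _ _,
      ← integral_finsetSum _ fun w _ => (hmon w hμ₁ hA).mul_prod (hmon w hμ₂ hB),
      ← integral_const_mul]
    congr 1
    funext q
    rw [hf]
    simp only [inner_pow_eq_sum_monomial]
    rw [mul_assoc, Finset.sum_mul]
    congr 1
    exact Finset.sum_congr rfl fun w _ => by ring
  rw [hk, enorm_mul, ← ofReal_norm, hcoef]
  gcongr
  refine (enorm_sum_le _ _).trans (le_of_eq ?_)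
  simp only [enorm_mul]

/-- The Fourier transform of `v`, translated by `x` and cut off to `s` with the weight `E`. -/
noncomputable def window (s : Set (Space n)) (E v : Space n → ℂ) (x η : Space n) : ℂ :=
  ∫ t in s, E t * (phase t η * v (x + t))

theorem measurable_window (s : Set (Space n)) {E v : Space n → ℂ} (hE : Measurable E)
    (hv : Measurable v) :
    StronglyMeasurable fun p : Space n × Space n => window s E v p.1 p.2 := by
  unfold window
  refine StronglyMeasurable.integral_prod_right (f := fun (p : Space n × Space n) (t : Space n) =>
    E t * (phase t p.2 * v (p.1 + t))) (Measurable.stronglyMeasurable ?_)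
  refine (hE.comp measurable_snd).mul ((measurable_phase.comp
    (measurable_snd.prodMk (measurable_snd.comp measurable_fst))).mul (hv.comp ?_))
  exact (measurable_fst.comp measurable_fst).add measurable_snd

/-- For fixed `x` the window is the Fourier transform of a function supported in `s`, so that
Plancherel's theorem in `η` and Tonelli's theorem in `x` compute its norm. -/
theorem eLpNorm_window_le {s : Set (Space n)} (hs : MeasurableSet s) {E v : Space n → ℂ}
    (hE : Measurable E) (hv : IsTest v) {B : ℝ} (hB : ∀ t ∈ s, ‖E t‖ ≤ B) :
    eLpNorm (fun p : Space n × Space n => window s E v p.1 p.2) 2 (volume.prod volume) ≤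
      ENNReal.ofReal B * volume s ^ (1 / 2 : ℝ) * eLpNorm v 2 volume := by
  have hE' : Measurable (s.indicator E) := hE.indicator hs
  have hB' : ∀ t, ‖s.indicator E t‖ ≤ max B 0 := by
    intro t
    by_cases ht : t ∈ s
    · rw [Set.indicator_of_mem ht]
      exact (hB t ht).trans (le_max_left _ _)
    · simp [Set.indicator_of_notMem ht]
  have htest : ∀ x, IsTest fun t => s.indicator E t * v (x + t) := fun x =>
    (hv.comp_add_left x).mul_bdd hE' hB'
  have hinner : ∀ x, ∫⁻ η, ‖window s E v x η‖ₑ ^ 2 ≤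
      ∫⁻ t in s, ENNReal.ofReal B ^ 2 * ‖v (x + t)‖ₑ ^ 2 := by
    intro x
    have h1 : (fun η => window s E v x η) = 𝓕 fun t => s.indicator E t * v (x + t) := by
      funext η
      rw [fourier_eq_integral_phase, window, ← integral_indicator hs]
      congr 1
      funext t
      by_cases ht : t ∈ s
      · simp only [Set.indicator_of_mem ht]
        ring
      · simp [Set.indicator_of_notMem ht]
    have h2 := eLpNorm_two_sq volume (fun η => window s E v x η)
    rw [h1, eLpNorm_fourier_eq (htest x).integrable (htest x).memLp, eLpNorm_two_sq] at h2
    rw [← h2, ← lintegral_indicator hs]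
    refine lintegral_mono fun t => ?_
    by_cases ht : t ∈ s
    · rw [Set.indicator_of_mem ht, Set.indicator_of_mem ht, enorm_mul, mul_pow]
      gcongr
      rw [← ofReal_norm]
      exact ENNReal.ofReal_le_ofReal (hB t ht)
    · simp [Set.indicator_of_notMem ht]
  have hvm : Measurable fun p : Space n × Space n => ‖v (p.1 + p.2)‖ₑ ^ 2 :=
    ((hv.measurable.comp (measurable_fst.add measurable_snd)).enorm.pow_const 2)
  have hsq : eLpNorm (fun p : Space n × Space n => window s E v p.1 p.2) 2 (volume.prod volume) ^ 2 ≤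
      (ENNReal.ofReal B * volume s ^ (1 / 2 : ℝ) * eLpNorm v 2 volume) ^ 2 := by
    rw [eLpNorm_two_sq, lintegral_prod _
      ((measurable_window s hE hv.measurable).measurable.enorm.pow_const 2).aemeasurable]
    calc ∫⁻ x, ∫⁻ η, ‖window s E v x η‖ₑ ^ 2
        ≤ ∫⁻ x, ∫⁻ t in s, ENNReal.ofReal B ^ 2 * ‖v (x + t)‖ₑ ^ 2 := lintegral_mono hinner
      _ = ∫⁻ t in s, ∫⁻ x, ENNReal.ofReal B ^ 2 * ‖v (x + t)‖ₑ ^ 2 :=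
          lintegral_lintegral_swap (hvm.const_mul _).aemeasurable
      _ = ∫⁻ _t in s, ENNReal.ofReal B ^ 2 * eLpNorm v 2 volume ^ 2 := by
          refine lintegral_congr fun t => ?_
          rw [lintegral_const_mul' _ _ (by simp), eLpNorm_two_sq,
            lintegral_add_right_eq_self (fun x => ‖v x‖ₑ ^ 2) t]
      _ = (ENNReal.ofReal B * volume s ^ (1 / 2 : ℝ) * eLpNorm v 2 volume) ^ 2 := by
          rw [setLIntegral_const, mul_pow, mul_pow, ← ENNReal.rpow_natCast (volume s ^ (1 / 2 : ℝ)),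
            ← ENNReal.rpow_mul]
          norm_num
          ring
  exact (ENNReal.pow_le_pow_left_iff two_ne_zero).mp hsq

theorem integrable_window {s : Set (Space n)} (hs : MeasurableSet s) {E v : Space n → ℂ}
    (hE : Measurable E) (hE1 : ∀ t ∈ s, ‖E t‖ ≤ 1) (hv : IsTest v) (x η : Space n) :
    Integrable (fun t => E t * (phase t η * v (x + t))) (volume.restrict s) := by
  have h2 : Continuous fun t : Space n => phase t η := by
    unfold phase
    exact continuous_subtype_val.comp (Real.continuous_fourierChar.comp (by fun_prop))
  have h3 := (hv.comp_add_left x).mul_bdd h2.measurable fun t => (norm_phase t η).le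
  refine h3.integrable.restrict.bdd_mul (c := 1) hE.aestronglyMeasurable ?_
  filter_upwards [ae_restrict_mem hs] with t ht using hE1 t ht

theorem measurable_window_monomial {s : Set (Space n)} {E v : Space n → ℂ} {k : ℕ}
    (w : Fin k → Fin n) (hE : Measurable E) (hv : Measurable v) :
    StronglyMeasurable fun p : Space n × Space n =>
      window s (fun t => monomial w t * E t) v p.1 p.2 :=
  measurable_window s (E := fun t => monomial w t * E t)
    ((continuous_monomial w).measurable.mul hE) hv

theorem measurable_window_monomial_swap {s : Set (Space n)} {E v : Space n → ℂ} {k : ℕ}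
    (w : Fin k → Fin n) (hE : Measurable E) (hv : Measurable v) :
    StronglyMeasurable fun p : Space n × Space n =>
      window s (fun t => monomial w t * E t) v p.2 p.1 := by
  have h := (measurable_window_monomial (s := s) w hE hv).measurable
  exact (h.comp measurable_swap).stronglyMeasurable

theorem eLpNorm_window_monomial_le {s : Set (Space n)} (hs : MeasurableSet s) {L : ℝ}
    (hL : ∀ t ∈ s, ∀ i, |t i| ≤ L) {E v : Space n → ℂ} (hE : Measurable E)
    (hE1 : ∀ t ∈ s, ‖E t‖ ≤ 1) (hv : IsTest v) {k : ℕ} (w : Fin k → Fin n) :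
    eLpNorm (fun p : Space n × Space n => window s (fun t => monomial w t * E t) v p.1 p.2) 2
      (volume.prod volume) ≤ ENNReal.ofReal (L ^ k) * volume s ^ (1 / 2 : ℝ) *
        eLpNorm v 2 volume := by
  refine eLpNorm_window_le (E := fun t => monomial w t * E t) hs
    ((continuous_monomial w).measurable.mul hE) hv fun t ht => ?_
  rw [norm_mul, ← mul_one (L ^ k)]
  exact mul_le_mul (norm_monomial_le w (hL t ht)) (hE1 t ht) (norm_nonneg _)
    ((norm_nonneg _).trans (norm_monomial_le w (hL t ht)))

/-- The pairing of the two windows attached to a word is controlled by Plancherel's theorem. -/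
theorem lintegral_window_mul_le {s s' : Set (Space n)} (hs : MeasurableSet s)
    (hs' : MeasurableSet s') {L : ℝ} (hL : ∀ t ∈ s, ∀ i, |t i| ≤ L)
    (hL' : ∀ t ∈ s', ∀ i, |t i| ≤ L) {E E' F v : Space n → ℂ} (hE : Measurable E)
    (hE' : Measurable E') (hE1 : ∀ t ∈ s, ‖E t‖ ≤ 1) (hE1' : ∀ t ∈ s', ‖E' t‖ ≤ 1)
    (hF : IsTest F) (hv : IsTest v) {k : ℕ} (w : Fin k → Fin n) :
    ∫⁻ p : Space n × Space n, ‖window s (fun t => monomial w t * E t) v p.1 p.2‖ₑ *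
        ‖window s' (fun t => monomial w t * E' t) F p.2 p.1‖ₑ ∂(volume.prod volume) ≤
      ENNReal.ofReal (L ^ k) ^ 2 * (volume s ^ (1 / 2 : ℝ) * volume s' ^ (1 / 2 : ℝ) *
        (eLpNorm F 2 volume * eLpNorm v 2 volume)) := by
  refine (lintegral_enorm_mul_le _
    (measurable_window_monomial w hE hv.measurable).aestronglyMeasurable
    (measurable_window_monomial_swap w hE' hF.measurable).aestronglyMeasurable).trans ?_
  have h := eLpNorm_comp_measurePreserving (p := 2)
    (measurable_window_monomial (s := s') w hE' hF.measurable).aestronglyMeasurable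
    (Measure.measurePreserving_swap (μ := (volume : Measure (Space n)))
      (ν := (volume : Measure (Space n))))
  refine (mul_le_mul' (eLpNorm_window_monomial_le hs hL hE hE1 hv w)
    (h.le.trans (eLpNorm_window_monomial_le hs' hL' hE' hE1' hF w))).trans (le_of_eq ?_)
  ring

theorem exp_coeff_mul_sum_le (n k : ℕ) (L : ℝ) (X : ℝ≥0∞) :
    ENNReal.ofReal ((2 * Real.pi) ^ k / k !) *
      ∑ _w : Fin k → Fin n, ENNReal.ofReal (L ^ k) ^ 2 * X ≤
      ENNReal.ofReal ((2 * Real.pi * (n * L ^ 2)) ^ k / k !) * X := by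
  have h1 : ENNReal.ofReal (L ^ k) ^ 2 ≤ ENNReal.ofReal ((L ^ 2) ^ k) := by
    by_cases h : 0 ≤ L ^ k
    · rw [← ENNReal.ofReal_pow h, ← pow_mul, ← pow_mul, mul_comm]
    · rw [ENNReal.ofReal_of_nonpos (not_le.mp h).le]
      simp
  rw [Finset.sum_const, Finset.card_univ, Fintype.card_fun, Fintype.card_fin, Fintype.card_fin,
    nsmul_eq_mul, ← mul_assoc, ← mul_assoc]
  gcongr
  calc ENNReal.ofReal ((2 * Real.pi) ^ k / k !) * ((n ^ k : ℕ) : ℝ≥0∞) * ENNReal.ofReal (L ^ k) ^ 2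
      ≤ ENNReal.ofReal ((2 * Real.pi) ^ k / k !) * ENNReal.ofReal ((n : ℝ) ^ k) *
        ENNReal.ofReal ((L ^ 2) ^ k) := by
        gcongr
        rw [← ENNReal.ofReal_natCast]
        push_cast
        rfl
    _ = ENNReal.ofReal ((2 * Real.pi * (n * L ^ 2)) ^ k / k !) := by
        rw [← ENNReal.ofReal_mul (by positivity), ← ENNReal.ofReal_mul (by positivity)]
        congr 1
        rw [mul_pow (2 * Real.pi), mul_pow (n : ℝ)]
        ring

/-- After a shear of phase space the average acts on the test functions, and the exponential series
separates the two cells. -/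
theorem enorm_form_cell_average_le {s s' : Set (Space n)} (hs : MeasurableSet s)
    (hs' : MeasurableSet s') (hvs : volume s ≠ ⊤) (hvs' : volume s' ≠ ⊤) {L : ℝ}
    (hL : ∀ t ∈ s, ∀ i, |t i| ≤ L) (hL' : ∀ t ∈ s', ∀ i, |t i| ≤ L) {E E' : Space n → ℂ}
    (hE : Measurable E) (hE' : Measurable E') (hE1 : ∀ t ∈ s, ‖E t‖ ≤ 1)
    (hE1' : ∀ t ∈ s', ‖E' t‖ ≤ 1) {c : Space n → Space n → ℂ} {M : ℝ} (hc : IsBddSymbol c M)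
    {F v : Space n → ℂ} (hF : IsTest F) (hv : IsTest v) :
    ‖form (fun x η => ∫ q, E q.1 * E' q.2 * c (x - q.1) (η - q.2)
        ∂((volume.restrict s).prod (volume.restrict s'))) F v‖ₑ ≤
      ∫⁻ p : Space n × Space n, ENNReal.ofReal M *
        ∑' k : ℕ, ENNReal.ofReal ((2 * Real.pi) ^ k / k !) * ∑ w : Fin k → Fin n,
          ‖window s (fun t => monomial w t * E t) v p.1 p.2‖ₑ *
          ‖window s' (fun t => monomial w t * E' t) F p.2 p.1‖ₑ ∂(volume.prod volume) := by
  have : IsFiniteMeasure (volume.restrict s) := isFiniteMeasure_restrict.mpr hvs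
  have : IsFiniteMeasure (volume.restrict s') := isFiniteMeasure_restrict.mpr hvs'
  set Q := (volume.restrict s).prod (volume.restrict s') with hQ
  have hQs : ∀ᵐ q ∂Q, q.1 ∈ s ∧ q.2 ∈ s' := by
    have h1 : ∀ᵐ q ∂Q, q.1 ∈ s := Measure.quasiMeasurePreserving_fst.ae (ae_restrict_mem hs)
    have h2 : ∀ᵐ q ∂Q, q.2 ∈ s' := Measure.quasiMeasurePreserving_snd.ae (ae_restrict_mem hs')
    filter_upwards [h1, h2] with q hq1 hq2 using ⟨hq1, hq2⟩
  set Ψ : (Space n × Space n) × (Space n × Space n) → ℂ := fun r =>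
    phase r.2.1 r.2.2 * (E r.1.1 * E' r.1.2 * c (r.2.1 - r.1.1) (r.2.2 - r.1.2)) *
      (v r.2.1 * F r.2.2) with hΨ
  have hΨm : Measurable Ψ := by
    refine ((measurable_phase.comp measurable_snd).mul (((hE.comp (by fun_prop)).mul
      (hE'.comp (by fun_prop))).mul (hc.measurable.comp (g := fun p : Space n × Space n => c p.1 p.2)
        (f := fun r : (Space n × Space n) × (Space n × Space n) =>
          (r.2.1 - r.1.1, r.2.2 - r.1.2)) (by fun_prop)))).mul
      ((hv.measurable.comp (by fun_prop)).mul (hF.measurable.comp (by fun_prop)))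
  have hΨi : Integrable Ψ (Q.prod (volume.prod volume)) := by
    have h1 : Integrable (fun r : (Space n × Space n) × (Space n × Space n) =>
        (M : ℂ) * (v r.2.1 * F r.2.2)) (Q.prod (volume.prod volume)) :=
      Integrable.mul_prod (integrable_const (M : ℂ)) (hF.integrable_prod hv)
    refine h1.mono hΨm.aestronglyMeasurable ?_
    filter_upwards [Measure.quasiMeasurePreserving_fst.ae hQs] with r hr
    simp only [hΨ, norm_mul, norm_phase, one_mul]
    gcongr
    calc ‖E r.1.1‖ * ‖E' r.1.2‖ * ‖c (r.2.1 - r.1.1) (r.2.2 - r.1.2)‖ ≤ 1 * 1 * M := by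
          gcongr
          · exact hE1 _ hr.1
          · exact hE1' _ hr.2
          · exact hc.bound _ _
      _ ≤ ‖(M : ℂ)‖ := by
          rw [Complex.norm_real, one_mul, one_mul]
          exact le_abs_self M
  -- The shear moves the average from the symbol to the test functions.
  have hshear : MeasurePreserving (fun r : (Space n × Space n) × (Space n × Space n) =>
      (r.1, r.2 + r.1)) (Q.prod (volume.prod volume)) (Q.prod (volume.prod volume)) :=
    MeasurePreserving.skew_product (g := fun q p : Space n × Space n => p + q)
      (MeasurePreserving.id Q) (by fun_prop)
      (Filter.Eventually.of_forall fun q => map_add_right_eq_self _ q)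
  have hΦi := hshear.integrable_comp_of_integrable hΨi
  have hform : form (fun x η => ∫ q, E q.1 * E' q.2 * c (x - q.1) (η - q.2) ∂Q) F v =
      ∫ p, ∫ q, Ψ (q, p + q) ∂Q ∂(volume.prod volume) := by
    calc form (fun x η => ∫ q, E q.1 * E' q.2 * c (x - q.1) (η - q.2) ∂Q) F v
        = ∫ p, ∫ q, Ψ (q, p) ∂Q ∂(volume.prod volume) := by
          unfold form
          congr 1
          funext p
          simp only [hΨ]
          rw [← integral_const_mul, ← integral_mul_const]
      _ = ∫ q, ∫ p, Ψ (q, p) ∂(volume.prod volume) ∂Q :=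
          (integral_integral_swap (f := fun q p => Ψ (q, p)) hΨi).symm
      _ = ∫ q, ∫ p, Ψ (q, p + q) ∂(volume.prod volume) ∂Q := by
          congr 1
          funext q
          exact (integral_add_right_eq_self (fun p => Ψ (q, p)) q).symm
      _ = ∫ p, ∫ q, Ψ (q, p + q) ∂Q ∂(volume.prod volume) :=
          integral_integral_swap (f := fun q p => Ψ (q, p + q)) hΦi
  rw [hform]
  refine (enorm_integral_le_lintegral_enorm _).trans (lintegral_mono fun p => ?_)
  have h1 : ∫ q, Ψ (q, p + q) ∂Q = phase p.1 p.2 * c p.1 p.2 *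
      ∫ q, phase q.1 q.2 * ((E q.1 * (phase q.1 p.2 * v (p.1 + q.1))) *
        (E' q.2 * (phase q.2 p.1 * F (p.2 + q.2)))) ∂Q := by
    rw [← integral_const_mul]
    congr 1
    funext q
    simp only [hΨ, Prod.fst_add, Prod.snd_add, add_sub_cancel_right, phase_add_left,
      phase_add_right, phase_comm q.2 p.1]
    ring
  have h2 := enorm_integral_phase_le (μ₁ := volume.restrict s) (μ₂ := volume.restrict s') (L := L)
    (by filter_upwards [ae_restrict_mem hs] with t ht using hL t ht)
    (by filter_upwards [ae_restrict_mem hs'] with t ht using hL' t ht)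
    (integrable_window hs hE hE1 hv p.1 p.2) (integrable_window hs' hE' hE1' hF p.2 p.1)
  rw [h1, enorm_mul]
  refine mul_le_mul' ?_ (h2.trans (le_of_eq ?_))
  · rw [← ofReal_norm]
    refine ENNReal.ofReal_le_ofReal ?_
    rw [norm_mul, norm_phase, one_mul]
    exact hc.bound _ _
  · simp only [window, mul_assoc]

/-- A symbol that is an average of translates of a bounded function over a bounded cell of phase
space has bounded form, whatever the regularity of that function and of the weights. -/
theorem FormBound.cell_average {s s' : Set (Space n)} (hs : MeasurableSet s)
    (hs' : MeasurableSet s') (hvs : volume s ≠ ⊤) (hvs' : volume s' ≠ ⊤) {L : ℝ}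
    (hL : ∀ t ∈ s, ∀ i, |t i| ≤ L) (hL' : ∀ t ∈ s', ∀ i, |t i| ≤ L) {E E' : Space n → ℂ}
    (hE : Measurable E) (hE' : Measurable E') (hE1 : ∀ t ∈ s, ‖E t‖ ≤ 1)
    (hE1' : ∀ t ∈ s', ‖E' t‖ ≤ 1) {c : Space n → Space n → ℂ} {M : ℝ} (hc : IsBddSymbol c M) :
    FormBound (fun x η => ∫ q, E q.1 * E' q.2 * c (x - q.1) (η - q.2)
        ∂((volume.restrict s).prod (volume.restrict s')))
      (ENNReal.ofReal M * (ENNReal.ofReal (Real.exp (2 * Real.pi * (n * L ^ 2))) *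
        (volume s ^ (1 / 2 : ℝ) * volume s' ^ (1 / 2 : ℝ)))) := by
  intro F v hF hv
  set X := volume s ^ (1 / 2 : ℝ) * volume s' ^ (1 / 2 : ℝ) *
    (eLpNorm F 2 volume * eLpNorm v 2 volume) with hX
  refine (enorm_form_cell_average_le hs hs' hvs hvs' hL hL' hE hE' hE1 hE1' hc hF hv).trans ?_
  calc _ = ENNReal.ofReal M * ∑' k : ℕ, ENNReal.ofReal ((2 * Real.pi) ^ k / k !) *
          ∑ w : Fin k → Fin n, ∫⁻ p : Space n × Space n,
            ‖window s (fun t => monomial w t * E t) v p.1 p.2‖ₑ *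
            ‖window s' (fun t => monomial w t * E' t) F p.2 p.1‖ₑ ∂(volume.prod volume) := by
        have hmeasw : ∀ k : ℕ, ∀ w : Fin k → Fin n, Measurable fun p : Space n × Space n =>
            ‖window s (fun t => monomial w t * E t) v p.1 p.2‖ₑ *
            ‖window s' (fun t => monomial w t * E' t) F p.2 p.1‖ₑ := fun k w =>
          (measurable_window_monomial w hE hv.measurable).measurable.enorm.mul
            (measurable_window_monomial_swap w hE' hF.measurable).measurable.enorm
        rw [lintegral_const_mul' _ _ ENNReal.ofReal_ne_top, lintegral_tsum fun k =>
          ((Finset.measurable_fun_sum _ fun w _ => hmeasw k w).const_mul _).aemeasurable]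
        congr 2
        funext k
        rw [lintegral_const_mul' _ _ ENNReal.ofReal_ne_top,
          lintegral_finsetSum _ fun w _ => hmeasw k w]
    _ ≤ ENNReal.ofReal M * ∑' k : ℕ, ENNReal.ofReal ((2 * Real.pi * (n * L ^ 2)) ^ k / k !) * X := by
        gcongr ENNReal.ofReal M * ∑' k, ?_ with k
        refine le_trans ?_ (exp_coeff_mul_sum_le n k L X)
        gcongr with w
        exact lintegral_window_mul_le hs hs' hL hL' hE hE' hE1 hE1' hF hv w
    _ = _ := by
        rw [ENNReal.tsum_mul_right, tsum_ofReal_pow_div_factorial (by positivity), hX]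
        ring

end Cells

/-! ### Integral representations by mixed first derivatives -/

section Representation

variable {n : ℕ}

/-- Exchanging the `i`-th coordinate of a point with an independent copy preserves the product
measure. -/
theorem measurePreserving_update_swap (ν : Measure ℝ) [SigmaFinite ν] (i : Fin n) :
    MeasurePreserving (fun q : (Fin n → ℝ) × ℝ => (Function.update q.1 i q.2, q.1 i))
      ((Measure.pi fun _ => ν).prod ν) ((Measure.pi fun _ => ν).prod ν) := by
  have hm : Measurable fun q : (Fin n → ℝ) × ℝ => (Function.update q.1 i q.2, q.1 i) :=
    measurable_update'.prodMk ((measurable_pi_apply i).comp measurable_fst)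
  refine ⟨hm, Measure.ext_of_lintegral _ fun f hf => ?_⟩
  have hfm : Measurable fun q : (Fin n → ℝ) × ℝ => f (Function.update q.1 i q.2, q.1 i) :=
    hf.comp hm
  rw [lintegral_map hf hm, lintegral_prod _ hfm.aemeasurable, lintegral_prod _ hf.aemeasurable]
  refine lintegral_eq_of_lmarginal_eq {i} hfm.lintegral_prod_right'
    hf.lintegral_prod_right' ?_
  funext x
  simp only [lmarginal_singleton, Function.update_idem, Function.update_self]
  refine lintegral_lintegral_swap (f := fun ρ σ => f (Function.update x i σ, ρ))
    (Measurable.aemeasurable ?_)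
  exact hf.comp (((measurable_update x).comp measurable_snd).prodMk measurable_fst)

/-- A coordinate carrying the normalized weight `g` may be replaced by a new integration
variable. -/
theorem integral_update_swap (ν : Measure ℝ) [SigmaFinite ν] (i : Fin n) {g : ℝ → ℂ}
    {Φ : (Fin n → ℝ) → ℂ} (hg : Integrable g ν) (hg1 : ∫ σ, g σ ∂ν = 1)
    (hΦ : Integrable Φ (Measure.pi fun _ => ν)) :
    ∫ τ, ∫ σ, g (τ i) * Φ (Function.update τ i σ) ∂ν ∂(Measure.pi fun _ => ν) =
      ∫ τ, Φ τ ∂(Measure.pi fun _ => ν) := by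
  have hT := measurePreserving_update_swap ν i
  have h1 : Integrable (fun q : (Fin n → ℝ) × ℝ => g q.2 * Φ q.1)
      ((Measure.pi fun _ => ν).prod ν) := by
    simpa only [mul_comm] using hΦ.mul_prod hg
  have h2 := hT.integrable_comp_of_integrable h1
  calc ∫ τ, ∫ σ, g (τ i) * Φ (Function.update τ i σ) ∂ν ∂(Measure.pi fun _ => ν)
      = ∫ q, g (q.1 i) * Φ (Function.update q.1 i q.2) ∂((Measure.pi fun _ => ν).prod ν) :=
        (integral_prod _ h2).symm
    _ = ∫ q, g q.2 * Φ q.1 ∂(Measure.map (fun q : (Fin n → ℝ) × ℝ =>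
          (Function.update q.1 i q.2, q.1 i)) ((Measure.pi fun _ => ν).prod ν)) := by
        rw [integral_map hT.measurable.aemeasurable (by rw [hT.map_eq]; exact h1.aestronglyMeasurable)]
    _ = ∫ q, Φ q.1 * g q.2 ∂((Measure.pi fun _ => ν).prod ν) := by
        rw [hT.map_eq]
        simp only [mul_comm]
    _ = ∫ τ, Φ τ ∂(Measure.pi fun _ => ν) := by
        rw [integral_prod_mul, hg1, mul_one]

/-- The vector with coordinates `τ j` for `j ∈ J` and `0` otherwise. -/
noncomputable def shift (J : Finset (Fin n)) (τ : Fin n → ℝ) : Space n :=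
  WithLp.toLp 2 fun j => if j ∈ J then τ j else 0

theorem shift_insert {J : Finset (Fin n)} {i : Fin n} (hi : i ∉ J) (τ : Fin n → ℝ) (σ : ℝ) :
    shift (insert i J) (Function.update τ i σ) = shift J τ + σ • EuclideanSpace.single i 1 := by
  ext j
  by_cases hj : j = i
  · subst hj; simp [shift, hi]
  · simp [shift, hj]

/-- The weight of the term `S` in the partial representation over the coordinates `J`: coordinates
in `S` carry `κ₁`, the other coordinates in `J` carry `κ₀`, and those outside `J` carry `g`. -/
noncomputable def repWeight (g κ₀ κ₁ : ℝ → ℂ) (J S : Finset (Fin n)) (τ : Fin n → ℝ) : ℂ :=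
  ∏ j, if j ∈ S then κ₁ (τ j) else if j ∈ J then κ₀ (τ j) else g (τ j)

theorem repWeight_update {g κ₀ κ₁ : ℝ → ℂ} {J S J' S' : Finset (Fin n)} {i : Fin n} {κ : ℝ → ℂ}
    (hJ : i ∉ J) (hS : i ∉ S) (hJ' : J' = insert i J)
    (hκ : ∀ σ, (if i ∈ S' then κ₁ σ else if i ∈ J' then κ₀ σ else g σ) = κ σ)
    (hS' : ∀ j, j ≠ i → (j ∈ S' ↔ j ∈ S)) (τ : Fin n → ℝ) (σ : ℝ) :
    g (τ i) * repWeight g κ₀ κ₁ J' S' (Function.update τ i σ) =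
      κ σ * repWeight g κ₀ κ₁ J S τ := by
  subst hJ'
  unfold repWeight
  rw [← Finset.mul_prod_erase Finset.univ _ (Finset.mem_univ i),
    ← Finset.mul_prod_erase Finset.univ (fun j => if j ∈ S then κ₁ (τ j) else
      if j ∈ J then κ₀ (τ j) else g (τ j)) (Finset.mem_univ i)]
  simp only [Function.update_self, hκ, hJ, hS, if_false]
  have : ∏ j ∈ Finset.univ.erase i, (if j ∈ S' then κ₁ (Function.update τ i σ j) else
      if j ∈ insert i J then κ₀ (Function.update τ i σ j) else g (Function.update τ i σ j)) =
      ∏ j ∈ Finset.univ.erase i, (if j ∈ S then κ₁ (τ j) else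
        if j ∈ J then κ₀ (τ j) else g (τ j)) := by
    refine Finset.prod_congr rfl fun j hj => ?_
    have hji := Finset.ne_of_mem_erase hj
    simp [hS' j hji, hji]
  rw [this]
  ring

/-- If each one-variable derivative admits a representation formula with kernels `κ₀`, `κ₁`, then a
function is represented by its mixed first derivatives. The coordinates outside `J` carry the
normalized dummy weight `g`, so that the formula is an integral over the full product space at
every stage of the induction. -/
theorem eq_sum_integral_repWeight (ν : Measure ℝ) [SigmaFinite ν] {g κ₀ κ₁ : ℝ → ℂ}
    (hg : Integrable g ν) (hg1 : ∫ σ, g σ ∂ν = 1) {F : Finset (Fin n) → Space n → ℂ}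
    (hrep : ∀ S i, i ∉ S → ∀ η, F S η = ∫ σ, (κ₀ σ * F S (η - σ • EuclideanSpace.single i 1) +
      κ₁ σ * F (insert i S) (η - σ • EuclideanSpace.single i 1)) ∂ν)
    (hint : ∀ J S, S ⊆ J → ∀ η, Integrable (fun τ => repWeight g κ₀ κ₁ J S τ *
      F S (η - shift J τ)) (Measure.pi fun _ => ν)) (J : Finset (Fin n)) (η : Space n) :
    F ∅ η = ∑ S ∈ J.powerset, ∫ τ, repWeight g κ₀ κ₁ J S τ * F S (η - shift J τ)
      ∂(Measure.pi fun _ => ν) := by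
  induction J using Finset.induction_on with
  | empty =>
    have h1 : ∀ τ : Fin n → ℝ, shift ∅ τ = 0 := fun τ => by ext j; simp [shift]
    simp only [Finset.powerset_empty, Finset.sum_singleton, h1, sub_zero]
    rw [integral_mul_const]
    have h2 : ∫ τ, repWeight g κ₀ κ₁ ∅ ∅ τ ∂(Measure.pi fun _ : Fin n => ν) = 1 := by
      simp only [repWeight, Finset.notMem_empty, if_false]
      rw [integral_fintype_prod_eq_prod (fun _ => g)]
      simp [hg1]
    rw [h2, one_mul]
  | insert i J hi ih =>
    rw [ih, Finset.sum_powerset_insert hi, ← Finset.sum_add_distrib]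
    refine Finset.sum_congr rfl fun S hS => ?_
    have hSJ := Finset.mem_powerset.mp hS
    have hiS : i ∉ S := fun h => hi (hSJ h)
    rw [← integral_add (hint _ _ (hSJ.trans (Finset.subset_insert i J)) η)
      (hint _ _ (Finset.insert_subset_insert i hSJ) η),
      ← integral_update_swap ν i hg hg1 ((hint _ _ (hSJ.trans (Finset.subset_insert i J)) η).fun_add
        (hint _ _ (Finset.insert_subset_insert i hSJ) η))]
    refine integral_congr_ae (Filter.Eventually.of_forall fun τ => ?_)
    simp only
    rw [hrep S i hiS, ← integral_const_mul]
    refine integral_congr_ae (Filter.Eventually.of_forall fun σ => ?_)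
    have h1 := repWeight_update (g := g) (κ₀ := κ₀) (κ₁ := κ₁) (S' := S) (κ := κ₀) hi hiS rfl
      (fun σ => by simp [hiS]) (fun j _ => Iff.rfl) τ σ
    have h2 := repWeight_update (g := g) (κ₀ := κ₀) (κ₁ := κ₁) (S' := insert i S) (κ := κ₁) hi hiS
      rfl (fun σ => by simp) (fun j hj => by simp [hj]) τ σ
    simp only [shift_insert hi]
    rw [sub_sub]
    linear_combination -F S (η - (shift J τ + σ • EuclideanSpace.single i 1)) * h1 -
      F (insert i S) (η - (shift J τ + σ • EuclideanSpace.single i 1)) * h2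

end Representation

/-! ### Averages over cubes and integrals over orthants -/

section MixedFamily

variable {n : ℕ}

/-- A family indexed by sets of coordinates that behaves like the mixed first derivatives
`F S = ∂^S (F ∅)`. -/
structure IsMixedFamily (F : Finset (Fin n) → Space n → ℂ) : Prop where
  continuous : ∀ S, Continuous (F S)
  deriv : ∀ S i, i ∉ S → ∀ η, ∀ s : ℝ,
    HasDerivAt (fun s : ℝ => F S (η + s • EuclideanSpace.single i 1))
      (F (insert i S) (η + s • EuclideanSpace.single i 1)) s

theorem IsMixedFamily.deriv_neg {F : Finset (Fin n) → Space n → ℂ} (hF : IsMixedFamily F)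
    {S : Finset (Fin n)} {i : Fin n} (hi : i ∉ S) (η : Space n) (s : ℝ) :
    HasDerivAt (fun s : ℝ => F S (η - s • EuclideanSpace.single i 1))
      (-F (insert i S) (η - s • EuclideanSpace.single i 1)) s := by
  have h := (hF.deriv S i hi η (-s)).scomp s (hasDerivAt_neg s)
  simpa [Function.comp_def, sub_eq_add_neg] using h

theorem continuous_shift (J : Finset (Fin n)) : Continuous (shift J) := by
  unfold shift
  refine (PiLp.continuous_toLp 2 _).comp (continuous_pi fun j => ?_)
  split_ifs <;> fun_prop

theorem integral_pi_restrict (I : Set ℝ) (G : Space n → ℂ) :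
    ∫ τ, G (WithLp.toLp 2 τ) ∂(Measure.pi fun _ : Fin n => volume.restrict I) =
      ∫ t in {t : Space n | ∀ i, t i ∈ I}, G t := by
  rw [← Measure.restrict_pi_pi]
  have h := (PiLp.volume_preserving_toLp (Fin n)).setIntegral_preimage_emb
    (MeasurableEquiv.toLp 2 (Fin n → ℝ)).measurableEmbedding G {t : Space n | ∀ i, t i ∈ I}
  rw [← h]
  congr 2
  ext τ
  simp

/-- The unit cube `[0,1]ⁿ`. -/
def unitCube (n : ℕ) : Set (Space n) := {t | ∀ i, t i ∈ Set.Icc (0 : ℝ) 1}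

/-- The weight `∏_{j ∈ S} (1 - t_j)`. -/
noncomputable def cubeWeight (S : Finset (Fin n)) (t : Space n) : ℂ := ∏ j ∈ S, (1 - (t j : ℂ))

theorem continuous_cubeWeight (S : Finset (Fin n)) : Continuous (cubeWeight S) := by
  unfold cubeWeight
  fun_prop

theorem norm_cubeWeight_le (S : Finset (Fin n)) {t : Space n} (ht : t ∈ unitCube n) :
    ‖cubeWeight S t‖ ≤ 1 := by
  rw [cubeWeight, norm_prod]
  refine Finset.prod_le_one (fun _ _ => norm_nonneg _) fun j _ => ?_
  have h : (1 : ℂ) - (t j : ℂ) = ((1 - t j : ℝ) : ℂ) := by push_cast; rfl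
  rw [h, Complex.norm_real, Real.norm_eq_abs, abs_le]
  constructor <;> linarith [(ht j).1, (ht j).2]

theorem abs_le_of_mem_unitCube {t : Space n} (ht : t ∈ unitCube n) (i : Fin n) : |t i| ≤ 1 :=
  abs_le.mpr ⟨by linarith [(ht i).1], (ht i).2⟩

theorem isCompact_unitCube (n : ℕ) : IsCompact (unitCube n) := by
  refine Metric.isCompact_of_isClosed_isBounded ?_ ?_
  · unfold unitCube
    rw [Set.ofPred_forall]
    exact isClosed_iInter fun i => isClosed_Icc.preimage (by fun_prop : Continuous fun t : Space n => t i)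
  · refine (Metric.isBounded_iff_subset_closedBall 0).mpr ⟨√n, fun t ht => ?_⟩
    rw [mem_closedBall_zero_iff, EuclideanSpace.norm_eq]
    refine Real.sqrt_le_sqrt ?_
    calc ∑ i, ‖t i‖ ^ 2 ≤ ∑ _i : Fin n, (1 : ℝ) := Finset.sum_le_sum fun i _ => by
          rw [Real.norm_eq_abs]
          exact pow_le_one₀ (abs_nonneg _) (abs_le_of_mem_unitCube ht i)
      _ = n := by simp

theorem volume_unitCube (n : ℕ) : volume (unitCube n) = 1 := by
  have h := (PiLp.volume_preserving_toLp (Fin n)).measure_preimage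
    (isCompact_unitCube n).measurableSet.nullMeasurableSet
  have h2 : WithLp.toLp 2 ⁻¹' unitCube n = Set.univ.pi fun _ : Fin n => Set.Icc (0 : ℝ) 1 := by
    ext τ
    simp only [unitCube, Set.mem_preimage, Set.mem_ofPred_eq, Set.mem_univ_pi]
  rw [← h, h2, volume_pi, Measure.pi_pi]
  simp

/-- Representation of a function by averages of its mixed first derivatives over a unit cube; in
one variable `f(η) = ∫₀¹ (f(η - τ) + (1 - τ) f'(η - τ)) dτ`. -/
theorem IsMixedFamily.eq_sum_integral_cube {F : Finset (Fin n) → Space n → ℂ}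
    (hF : IsMixedFamily F) (η : Space n) :
    F ∅ η = ∑ S, ∫ t in unitCube n, cubeWeight S t * F S (η - t) := by
  set κ : ℝ → ℂ := fun σ => 1 - (σ : ℂ) with hκ
  have hκc : Continuous κ := by fun_prop
  have hline : ∀ (S : Finset (Fin n)) (i : Fin n) (η : Space n), Continuous fun σ : ℝ =>
      F S (η - σ • EuclideanSpace.single i 1) := fun S i η => (hF.continuous S).comp (by fun_prop)
  have h := eq_sum_integral_repWeight (volume.restrict (Set.Icc (0 : ℝ) 1)) (g := fun _ => 1)
    (κ₀ := fun _ => 1) (κ₁ := κ) (F := F) (integrable_const _) (by simp) ?_ ?_ Finset.univ η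
  · rw [h, Finset.powerset_univ]
    refine Finset.sum_congr rfl fun S _ => ?_
    rw [unitCube, ← integral_pi_restrict (Set.Icc (0 : ℝ) 1) fun t => cubeWeight S t * F S (η - t)]
    congr 1
    funext τ
    have h1 : shift Finset.univ τ = WithLp.toLp 2 τ := by ext j; simp [shift]
    rw [h1]
    congr 1
    simp [repWeight, cubeWeight, hκ, Finset.prod_ite_mem]
  · intro S i hi η
    have hd : ∀ σ ∈ Set.uIcc (0 : ℝ) 1, HasDerivAt
        (fun σ : ℝ => -(κ σ * F S (η - σ • EuclideanSpace.single i 1)))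
        (1 * F S (η - σ • EuclideanSpace.single i 1) +
          κ σ * F (insert i S) (η - σ • EuclideanSpace.single i 1)) σ := by
      intro σ _
      have h1 : HasDerivAt κ (-1) σ := by
        simpa using (Complex.ofRealCLM.hasDerivAt (x := σ)).const_sub 1
      refine ((h1.mul (hF.deriv_neg hi η σ)).neg).congr_deriv ?_
      ring
    have hc : Continuous fun σ : ℝ => 1 * F S (η - σ • EuclideanSpace.single i 1) +
        κ σ * F (insert i S) (η - σ • EuclideanSpace.single i 1) :=
      (continuous_const.mul (hline S i η)).add (hκc.mul (hline _ i η))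
    rw [integral_Icc_eq_integral_Ioc, ← intervalIntegral.integral_of_le zero_le_one,
      intervalIntegral.integral_eq_sub_of_hasDerivAt hd (hc.intervalIntegrable _ _)]
    simp [hκ]
  · intro J S _ η
    rw [← Measure.restrict_pi_pi]
    refine ContinuousOn.integrableOn_compact
      (isCompact_univ_pi fun _ => isCompact_Icc) (Continuous.continuousOn ?_)
    refine Continuous.mul ?_ ((hF.continuous S).comp (continuous_const.sub (continuous_shift J)))
    unfold repWeight
    refine continuous_finsetProd _ fun j _ => ?_
    split_ifs
    · exact hκc.comp (continuous_apply j)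
    · exact continuous_const
    · exact continuous_const

/-- The bound `⟨η⟩^{-δ-|J|}` splits into integrable factors in the single coordinates. -/
theorem bracket_rpow_le_prod {δ : ℝ} (hδ : 0 < δ) (J : Finset (Fin n)) (η : Space n) :
    bracket η ^ (-δ - J.card) ≤ ∏ j ∈ J, (1 + ‖η j‖ ^ 2) ^ (-(1 + δ / (n + 1)) / 2) := by
  have hcard : (J.card : ℝ) ≤ n := by
    have := Finset.card_le_univ J
    rw [Fintype.card_fin] at this
    exact_mod_cast this
  calc bracket η ^ (-δ - J.card) ≤ bracket η ^ (-(1 + δ / (n + 1)) * J.card) := by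
        refine Real.rpow_le_rpow_of_exponent_le (one_le_bracket η) ?_
        have : δ / (n + 1) * J.card ≤ δ := by
          rw [div_mul_eq_mul_div, div_le_iff₀ (by positivity)]
          nlinarith
        linarith
    _ = ∏ _j ∈ J, bracket η ^ (-(1 + δ / (n + 1))) := by
        rw [Real.rpow_mul (bracket_pos η).le, Real.rpow_natCast, Finset.prod_const]
    _ ≤ ∏ j ∈ J, (1 + ‖η j‖ ^ 2) ^ (-(1 + δ / (n + 1)) / 2) := by
        refine Finset.prod_le_prod (fun _ _ => (Real.rpow_pos_of_pos (bracket_pos η) _).le)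
          fun j _ => ?_
        rw [bracket_rpow]
        refine Real.rpow_le_rpow_of_nonpos (by positivity) ?_ ?_
        · have := PiLp.norm_apply_le η j
          gcongr
        · have : 0 < δ / (n + 1) := by positivity
          linarith

theorem integrable_coord_decay {ε : ℝ} (hε : 0 < ε) (c : ℝ) :
    Integrable fun σ : ℝ => (1 + ‖c - σ‖ ^ 2) ^ (-(1 + ε) / 2) := by
  have h : Integrable fun σ : ℝ => (1 + ‖σ‖ ^ 2) ^ (-(1 + ε) / 2) :=
    integrable_rpow_neg_one_add_norm_sq (by simp [hε])
  exact h.comp_sub_left c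

/-- A function with decaying mixed first derivatives is the integral of its full mixed derivative
over an orthant. -/
theorem IsMixedFamily.eq_integral_orthant {F : Finset (Fin n) → Space n → ℂ}
    (hF : IsMixedFamily F) {δ D : ℝ} (hδ : 0 < δ)
    (hD : ∀ S η, ‖F S η‖ ≤ D * bracket η ^ (-δ - S.card)) (η : Space n) :
    F ∅ η = ∫ ξ in {ξ : Space n | ∀ i, ξ i < η i}, F Finset.univ ξ := by
  have hD0 : 0 ≤ D := by
    have := (norm_nonneg _).trans (hD ∅ 0)
    exact nonneg_of_mul_nonneg_left this (Real.rpow_pos_of_pos (bracket_pos _) _)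
  have hline : ∀ (S : Finset (Fin n)) (i : Fin n) (η : Space n), Continuous fun σ : ℝ =>
      F S (η - σ • EuclideanSpace.single i 1) := fun S i η => (hF.continuous S).comp (by fun_prop)
  have hε : 0 < δ / (n + 1) := by positivity
  have h := eq_sum_integral_repWeight (volume.restrict (Set.Ioi (0 : ℝ)))
    (g := fun σ => (Real.exp (-σ) : ℂ)) (κ₀ := fun _ => 0) (κ₁ := fun _ => 1) (F := F)
    (integrableOn_exp_neg_Ioi 0).ofReal
    (by rw [integral_complex_ofReal, integral_exp_neg_Ioi_zero]; simp) ?_ ?_ Finset.univ η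
  · have h0 : ∀ S : Finset (Fin n), S ≠ Finset.univ → ∀ τ : Fin n → ℝ,
        repWeight (fun σ => (Real.exp (-σ) : ℂ)) (fun _ => 0) (fun _ => 1) Finset.univ S τ = 0 := by
      intro S hS τ
      obtain ⟨j, hj⟩ : ∃ j, j ∉ S := by
        by_contra! hall
        exact hS (Finset.eq_univ_of_forall hall)
      exact Finset.prod_eq_zero (Finset.mem_univ j) (by simp [hj])
    rw [h, Finset.powerset_univ, Finset.sum_eq_single Finset.univ
      (fun S _ hS => by simp only [h0 S hS, zero_mul, integral_zero]) (by simp)]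
    have h1 : ∀ τ : Fin n → ℝ, shift Finset.univ τ = WithLp.toLp 2 τ := by
      intro τ; ext j; simp [shift]
    simp only [repWeight, Finset.mem_univ, if_true, Finset.prod_const_one, one_mul, h1]
    rw [integral_pi_restrict (Set.Ioi (0 : ℝ)) fun t => F Finset.univ (η - t),
      ← integral_indicator, ← integral_indicator, ← integral_sub_left_eq_self _ volume η]
    · congr 1
      funext t
      simp only [Set.indicator, Set.mem_ofPred_eq, Set.mem_Ioi, PiLp.sub_apply, sub_pos,
        sub_sub_cancel]
      congr
    · simp only [Set.ofPred_forall]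
      exact MeasurableSet.iInter fun i => measurableSet_lt (by fun_prop) (by fun_prop)
    · simp only [Set.ofPred_forall, Set.mem_Ioi]
      exact MeasurableSet.iInter fun i => measurableSet_lt (by fun_prop) (by fun_prop)
  · intro S i hi η
    have hdecay : ∀ S : Finset (Fin n), ∀ σ : ℝ, i ∈ S →
        ‖F S (η - σ • EuclideanSpace.single i 1)‖ ≤
          D * (1 + ‖η i - σ‖ ^ 2) ^ (-(1 + δ) / 2) := by
      intro S σ hiS
      refine (hD _ _).trans ?_
      gcongr
      have hc : (1 : ℝ) ≤ S.card := by exact_mod_cast Finset.card_pos.mpr ⟨i, hiS⟩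
      refine (Real.rpow_le_rpow_of_exponent_le (one_le_bracket _)
        (by linarith : -δ - (S.card : ℝ) ≤ -(1 + δ))).trans ?_
      rw [bracket_rpow]
      refine Real.rpow_le_rpow_of_nonpos (by positivity) ?_ (by linarith)
      have := PiLp.norm_apply_le (η - σ • EuclideanSpace.single i (1 : ℝ)) i
      simp only [PiLp.sub_apply, PiLp.smul_apply, PiLp.single_apply, if_true, smul_eq_mul,
        mul_one] at this
      gcongr
    have hlim : Filter.Tendsto (fun σ : ℝ => F S (η - σ • EuclideanSpace.single i 1)) Filter.atTop
        (nhds 0) := by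
      have hb : Filter.Tendsto (fun σ : ℝ => D * (1 + (σ - η i) ^ 2) ^ (-(δ / 2))) Filter.atTop
          (nhds (D * 0)) := by
        refine Filter.Tendsto.const_mul D ((tendsto_rpow_neg_atTop (by positivity)).comp ?_)
        exact Filter.tendsto_atTop_add_const_left _ _ ((Filter.tendsto_pow_atTop two_ne_zero).comp
          (Filter.tendsto_atTop_add_const_right _ (-η i) Filter.tendsto_id))
      rw [mul_zero] at hb
      refine squeeze_zero_norm (fun σ => ?_) hb
      refine (hD _ _).trans ?_
      gcongr
      refine (Real.rpow_le_rpow_of_exponent_le (one_le_bracket _)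
        (by linarith [(Nat.cast_nonneg S.card : (0 : ℝ) ≤ S.card)] :
          -δ - (S.card : ℝ) ≤ -δ)).trans ?_
      rw [bracket_rpow, neg_div]
      refine Real.rpow_le_rpow_of_nonpos (by positivity) ?_ (by linarith)
      have := PiLp.norm_apply_le (η - σ • EuclideanSpace.single i (1 : ℝ)) i
      simp only [PiLp.sub_apply, PiLp.smul_apply, PiLp.single_apply, if_true, smul_eq_mul,
        mul_one, Real.norm_eq_abs] at this
      have h2 := pow_le_pow_left₀ (abs_nonneg _) this 2
      rw [sq_abs] at h2
      nlinarith
    have hint : IntegrableOn (fun σ : ℝ => -F (insert i S) (η - σ • EuclideanSpace.single i 1))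
        (Set.Ioi 0) := by
      refine Integrable.integrableOn (((integrable_coord_decay hδ (η i)).const_mul D).mono'
        (hline _ i η).neg.aestronglyMeasurable (Filter.Eventually.of_forall fun σ => ?_))
      rw [norm_neg]
      exact hdecay _ σ (Finset.mem_insert_self i S)
    have h2 := integral_Ioi_of_hasDerivAt_of_tendsto (hline S i η).continuousWithinAt
      (fun σ _ => hF.deriv_neg hi η σ) hint hlim
    rw [integral_neg] at h2
    simpa using h2.symm
  · intro J S hSJ η
    by_cases hS : S = J
    · subst hS
      have hm : ∀ j : Fin n, Integrable (fun σ : ℝ => if j ∈ S then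
          (1 + ‖η j - σ‖ ^ 2) ^ (-(1 + δ / (n + 1)) / 2) else Real.exp (-σ))
          (volume.restrict (Set.Ioi (0 : ℝ))) := by
        intro j
        by_cases hj : j ∈ S
        · simp only [hj, if_true]
          exact (integrable_coord_decay hε (η j)).restrict
        · simp only [hj, if_false]
          exact integrableOn_exp_neg_Ioi 0
      refine ((Integrable.fintype_prod hm).const_mul D).mono' (Continuous.aestronglyMeasurable ?_)
        (Filter.Eventually.of_forall fun τ => ?_)
      · refine Continuous.mul ?_ ((hF.continuous S).comp (continuous_const.sub (continuous_shift S)))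
        unfold repWeight
        refine continuous_finsetProd _ fun j _ => ?_
        split_ifs <;> fun_prop
      · have h1 : ∏ j, (if j ∈ S then (1 + ‖η j - τ j‖ ^ 2) ^ (-(1 + δ / (n + 1)) / 2)
            else Real.exp (-τ j)) = (∏ j, if j ∈ S then 1 else Real.exp (-τ j)) *
            ∏ j ∈ S, (1 + ‖η j - τ j‖ ^ 2) ^ (-(1 + δ / (n + 1)) / 2) := by
          have h4 : ∏ j ∈ S, (1 + ‖η j - τ j‖ ^ 2) ^ (-(1 + δ / (n + 1)) / 2) =
              ∏ j, if j ∈ S then (1 + ‖η j - τ j‖ ^ 2) ^ (-(1 + δ / (n + 1)) / 2) else 1 := by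
            simp [Finset.prod_ite_mem]
          rw [h4, ← Finset.prod_mul_distrib]
          refine Finset.prod_congr rfl fun j _ => ?_
          split_ifs <;> simp
        have h2 : ‖repWeight (fun σ => (Real.exp (-σ) : ℂ)) (fun _ => 0) (fun _ => 1) S S τ‖ =
            ∏ j, if j ∈ S then 1 else Real.exp (-τ j) := by
          rw [repWeight, norm_prod]
          refine Finset.prod_congr rfl fun j _ => ?_
          split_ifs
          · simp
          · rw [Complex.norm_real, Real.norm_eq_abs, Real.abs_exp]
        rw [norm_mul, h1, h2, mul_left_comm]
        have h3 : 0 ≤ ∏ j, (if j ∈ S then 1 else Real.exp (-τ j)) :=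
          Finset.prod_nonneg fun j _ => by split_ifs <;> positivity
        refine mul_le_mul_of_nonneg_left ((hD _ _).trans ?_) h3
        refine mul_le_mul_of_nonneg_left ((bracket_rpow_le_prod hδ S _).trans (le_of_eq ?_)) hD0
        refine Finset.prod_congr rfl fun j hj => ?_
        simp [shift, hj]
    · obtain ⟨j, hjJ, hjS⟩ := Finset.exists_of_ssubset (Finset.ssubset_iff_subset_ne.mpr ⟨hSJ, hS⟩)
      have h0 : ∀ τ : Fin n → ℝ,
          repWeight (fun σ => (Real.exp (-σ) : ℂ)) (fun _ => 0) (fun _ => 1) J S τ = 0 := fun τ =>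
        Finset.prod_eq_zero (Finset.mem_univ j) (by simp [hjJ, hjS])
      simp only [h0, zero_mul]
      exact integrable_zero _ _ _

end MixedFamily

/-! ### Symbols without regularity in `x` -/

section Rough

variable {n : ℕ}

theorem integrable_bracket {δ : ℝ} (hδ : 0 < δ) :
    Integrable fun ξ : Space n => bracket ξ ^ (-δ - n : ℝ) := by
  have h := integrable_rpow_neg_one_add_norm_sq (E := Space n) (μ := volume) (r := n + δ)
    (by rw [finrank_euclideanSpace_fin]; linarith)
  refine h.congr (Filter.Eventually.of_forall fun ξ => ?_)
  simp only [bracket_rpow]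
  congr 1
  ring

theorem measurableSet_orthant (ρ : ℝ) :
    MeasurableSet {q : Space n × Space n | ∀ i, q.1 i < ρ * q.2 i} := by
  rw [Set.ofPred_forall]
  refine MeasurableSet.iInter fun i => measurableSet_lt ?_ ?_ <;> fun_prop

/-- A symbol which is an orthant integral of an integrable density is a superposition of
multiplication operators composed with indicator Fourier multipliers, so that its form is bounded
without any regularity in `x`. -/
theorem FormBound.orthant {G : Space n → Space n → ℂ}
    (hG : Measurable fun p : Space n × Space n => G p.1 p.2) {δ D : ℝ} (hδ : 0 < δ)
    (hD : ∀ x ξ, ‖G x ξ‖ ≤ D * bracket ξ ^ (-δ - n : ℝ)) (ρ : ℝ) :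
    FormBound (fun x η => ∫ ξ in {ξ : Space n | ∀ i, ξ i < ρ * η i}, G x ξ)
      (ENNReal.ofReal (D * ∫ ξ : Space n, bracket ξ ^ (-δ - n : ℝ))) := by
  set χ : Space n → Space n → ℂ := fun ξ η =>
    Set.indicator {q : Space n × Space n | ∀ i, q.1 i < ρ * q.2 i} (fun _ => 1) (ξ, η) with hχ
  have hχm : Measurable fun q : Space n × Space n => χ q.1 q.2 :=
    measurable_const.indicator (measurableSet_orthant ρ)
  have hχ1 : ∀ ξ η, ‖χ ξ η‖ ≤ 1 := by
    intro ξ η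
    refine (norm_indicator_le_norm_self _ _).trans ?_
    simp
  have hD0 : 0 ≤ D := nonneg_of_mul_nonneg_left ((norm_nonneg _).trans (hD 0 0))
    (Real.rpow_pos_of_pos (bracket_pos _) _)
  have hσ : ∀ x η, ∫ ξ in {ξ : Space n | ∀ i, ξ i < ρ * η i}, G x ξ = ∫ ξ, G x ξ * χ ξ η := by
    intro x η
    have hs : MeasurableSet {ξ : Space n | ∀ i, ξ i < ρ * η i} := by
      rw [Set.ofPred_forall]
      refine MeasurableSet.iInter fun i => measurableSet_lt ?_ ?_ <;> fun_prop
    rw [← integral_indicator hs]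
    congr 1
    funext ξ
    simp [hχ, Set.indicator]
  simp only [hσ]
  refine (FormBound.integral (T := Space n) (ν := volume) (σ := fun ξ x η => G x ξ * χ ξ η)
    (M := fun ξ => D * bracket ξ ^ (-δ - n : ℝ))
    (N := fun ξ => ENNReal.ofReal (D * bracket ξ ^ (-δ - n : ℝ)) * ENNReal.ofReal 1) ?_
    ((integrable_bracket hδ).const_mul D) (fun ξ x η => ?_) (fun ξ => ?_)).mono (le_of_eq ?_)
  · have h1 : Measurable fun q : Space n × (Space n × Space n) => ((q.2.1, q.1) : Space n × Space n) := by
      fun_prop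
    have h2 : Measurable fun q : Space n × (Space n × Space n) => ((q.1, q.2.2) : Space n × Space n) := by
      fun_prop
    exact (hG.comp h1).mul (hχm.comp h2)
  · rw [norm_mul]
    calc ‖G x ξ‖ * ‖χ ξ η‖ ≤ (D * bracket ξ ^ (-δ - n : ℝ)) * 1 := by
          have := Real.rpow_pos_of_pos (bracket_pos ξ) (-δ - n)
          gcongr
          · exact hD x ξ
          · exact hχ1 ξ η
      _ = _ := mul_one _
  · exact FormBound.mul_mul (hG.comp measurable_prodMk_right) (hχm.comp measurable_prodMk_left)
      (fun x => hD x ξ) (hχ1 ξ)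
  · simp only [ENNReal.ofReal_one, mul_one]
    rw [← integral_const_mul, ofReal_integral_eq_lintegral_ofReal
      ((integrable_bracket hδ).const_mul D) (Filter.Eventually.of_forall fun ξ => ?_)]
    have := Real.rpow_pos_of_pos (bracket_pos ξ) (-δ - n)
    simp only [Pi.zero_apply]
    positivity

end Rough

/-! ### Iterated differences -/

section Differences

variable {n : ℕ}

theorem norm_add_sub_le_of_hasDerivAt {g : Space n → ℂ} {g' : Fin n → Space n → ℂ} {B : ℝ}
    (hg : ∀ i x, ∀ s : ℝ, HasDerivAt (fun s : ℝ => g (x + s • EuclideanSpace.single i 1))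
      (g' i (x + s • EuclideanSpace.single i 1)) s)
    (hB : ∀ i x, ‖g' i x‖ ≤ B) (x v : Space n) : ‖g (x + v) - g x‖ ≤ (∑ i, |v i|) * B := by
  have key : ∀ J : Finset (Fin n), ‖g (x + shift J v) - g x‖ ≤ (∑ i ∈ J, |v i|) * B := by
    intro J
    induction J using Finset.induction_on with
    | empty =>
      have : shift ∅ (v : Fin n → ℝ) = 0 := by ext j; simp [shift]
      simp [this]
    | insert i J hi ih =>
      have h1 : shift (insert i J) v = shift J v + v i • EuclideanSpace.single i 1 := by
        have := shift_insert hi (v : Fin n → ℝ) (v i)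
        rwa [Function.update_eq_self] at this
      have h2 := (convex_univ (𝕜 := ℝ) (E := ℝ)).norm_image_sub_le_of_norm_hasDerivWithin_le
        (fun s _ => (hg i (x + shift J v) s).hasDerivWithinAt) (fun s _ => hB i _)
        (Set.mem_univ 0) (Set.mem_univ (v i))
      simp only [zero_smul, add_zero, sub_zero, Real.norm_eq_abs] at h2
      rw [Finset.sum_insert hi, add_mul, h1, ← add_assoc]
      calc ‖g (x + shift J v + v i • EuclideanSpace.single i 1) - g x‖
          ≤ ‖g (x + shift J v + v i • EuclideanSpace.single i 1) - g (x + shift J v)‖ +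
            ‖g (x + shift J v) - g x‖ := norm_sub_le_norm_sub_add_norm_sub _ _ _
        _ ≤ |v i| * B + (∑ i ∈ J, |v i|) * B := add_le_add (by rwa [mul_comm]) ih
  have hv : shift Finset.univ (v : Fin n → ℝ) = v := by ext j; simp [shift]
  simpa [hv] using key Finset.univ

theorem hasDerivAt_fwdDiff_iter {g g' : Space n → ℂ} {i : Fin n} (v : Space n)
    (hg : ∀ x, ∀ s : ℝ, HasDerivAt (fun s : ℝ => g (x + s • EuclideanSpace.single i 1))
      (g' (x + s • EuclideanSpace.single i 1)) s) (m : ℕ) (x : Space n) (s : ℝ) :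
    HasDerivAt (fun s : ℝ => (fwdDiff v)^[m] g (x + s • EuclideanSpace.single i 1))
      ((fwdDiff v)^[m] g' (x + s • EuclideanSpace.single i 1)) s := by
  induction m generalizing x with
  | zero => exact hg x s
  | succ m ih =>
    simp only [Function.iterate_succ_apply', fwdDiff, add_right_comm x _ v]
    exact (ih (x + v)).sub (ih x)

/-- The `μ`-th difference of a function of class `C^μ` is controlled by its derivatives of
order `μ`. -/
theorem norm_fwdDiff_iter_le {μ : ℕ} {f : MultiIndex n → Space n → ℂ}
    (hf : ∀ β, order β + 1 ≤ μ → ∀ i x, ∀ s : ℝ,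
      HasDerivAt (fun s : ℝ => f β (x + s • EuclideanSpace.single i 1))
        (f (β + Pi.single i 1) (x + s • EuclideanSpace.single i 1)) s)
    {M : ℝ} (hM : ∀ β, order β = μ → ∀ x, ‖f β x‖ ≤ M) (v : Space n) (m : ℕ) :
    ∀ β, order β + m = μ → ∀ x, ‖(fwdDiff v)^[m] (f β) x‖ ≤ (∑ i, |v i|) ^ m * M := by
  induction m with
  | zero =>
    intro β hβ x
    simpa using hM β hβ x
  | succ m ih =>
    intro β hβ x
    rw [Function.iterate_succ_apply', fwdDiff, pow_succ', mul_assoc]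
    exact norm_add_sub_le_of_hasDerivAt (g := (fwdDiff v)^[m] (f β))
      (g' := fun i => (fwdDiff v)^[m] (f (β + Pi.single i 1)))
      (fun i x s => hasDerivAt_fwdDiff_iter v (fun x s => hf β (by omega) i x s) m x s)
      (fun i x => ih _ (by rw [order_add_single]; omega) x) x v

end Differences

/-! ### Sums of cell averages -/

section JetBounds

open scoped Pointwise

variable {n : ℕ} {μ : ℕ} {H : Finset (Fin n) → MultiIndex n → Space n → Space n → ℂ}

theorem hasDerivAt_line_scale {g g' : Space n → ℂ} {i : Fin n}
    (hg : ∀ x, ∀ s : ℝ, HasDerivAt (fun s : ℝ => g (x + s • EuclideanSpace.single i 1))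
      (g' (x + s • EuclideanSpace.single i 1)) s) (ρ : ℝ) (x : Space n) (s : ℝ) :
    HasDerivAt (fun s : ℝ => g (ρ • (x + s • EuclideanSpace.single i 1)))
      (ρ * g' (ρ • (x + s • EuclideanSpace.single i 1))) s := by
  have h := (hg (ρ • x) (ρ * s)).scomp s ((hasDerivAt_id' s).const_mul ρ)
  simpa [Function.comp_def, smul_add, smul_smul] using h

theorem IsMixedFamily.scale {F : Finset (Fin n) → Space n → ℂ} (hF : IsMixedFamily F) (ρ : ℝ) :
    IsMixedFamily fun S η => (ρ : ℂ) ^ S.card * F S (ρ • η) where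
  continuous S := continuous_const.mul ((hF.continuous S).comp (continuous_const_smul ρ))
  deriv S i hi η s := by
    refine ((hasDerivAt_line_scale (fun x s => hF.deriv S i hi x s) ρ η s).const_mul
      ((ρ : ℂ) ^ S.card)).congr_deriv ?_
    rw [Finset.card_insert_of_notMem hi]
    ring

theorem IsJet.scale_fst (hH : IsJet μ H) (ρ : ℝ) :
    IsJet μ fun S β x ξ => (ρ : ℂ) ^ order β * H S β (ρ • x) ξ where
  continuous S β hβ := continuous_const.mul ((hH.continuous S β hβ).comp
    (by fun_prop : Continuous fun p : Space n × Space n => ((ρ • p.1, p.2) : Space n × Space n)))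
  deriv_snd S β hβ i hi x ξ s := (hH.deriv_snd S β hβ i hi (ρ • x) ξ s).const_mul _
  deriv_fst S β hβ i x ξ s := by
    refine ((hasDerivAt_line_scale (g := fun y => H S β y ξ)
      (g' := fun y => H S (β + Pi.single i 1) y ξ) (fun x s => hH.deriv_fst S β hβ i x ξ s) ρ x s).const_mul ((ρ : ℂ) ^ order β)).congr_deriv ?_
    rw [order_add_single]
    ring

theorem IsJet.mixed_snd (hH : IsJet μ H) {β : MultiIndex n} (hβ : order β ≤ μ) (x : Space n) :
    IsMixedFamily fun S ξ => H S β x ξ where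
  continuous S := (hH.continuous S β hβ).comp
    (by fun_prop : Continuous fun ξ : Space n => ((x, ξ) : Space n × Space n))
  deriv S i hi ξ s := hH.deriv_snd S β hβ i hi x ξ s

theorem IsJet.mixed_fst (hH : IsJet μ H) (hn : n ≤ μ) (S : Finset (Fin n)) (ξ : Space n) :
    IsMixedFamily fun B x => H S (indicator B) x ξ where
  continuous B := (hH.continuous S _ (by
      rw [order_indicator]; exact (Finset.card_le_univ B).trans (by simpa using hn))).comp
    (by fun_prop : Continuous fun x : Space n => ((x, ξ) : Space n × Space n))
  deriv B i hi x s := by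
    rw [indicator_insert hi]
    refine hH.deriv_fst S _ ?_ i x ξ s
    rw [order_indicator, ← Finset.card_insert_of_notMem hi]
    exact (Finset.card_le_univ _).trans (by simpa using hn)

/-- Finite sums of averages of continuous bounded functions over translates in a compact cell of
phase space. -/
theorem exists_formBound_cells {ι : Type*} [Fintype ι] {s s' : Set (Space n)} (hs : IsCompact s)
    (hs' : IsCompact s') {E E' : ι → Space n → ℂ} (hE : ∀ i, Continuous (E i))
    (hE' : ∀ i, Continuous (E' i)) (hE1 : ∀ i, ∀ t ∈ s, ‖E i t‖ ≤ 1)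
    (hE1' : ∀ i, ∀ t ∈ s', ‖E' i t‖ ≤ 1) : ∃ A : ℝ, 0 ≤ A ∧
    ∀ (c : ι → Space n → Space n → ℂ) (M : ι → ℝ),
      (∀ i, Continuous fun p : Space n × Space n => c i p.1 p.2) → (∀ i x η, ‖c i x η‖ ≤ M i) →
      FormBound (fun x η => ∑ i, ∫ t in s, ∫ t' in s', E i t * E' i t' * c i (x - t) (η - t'))
        (ENNReal.ofReal (A * ∑ i, M i)) := by
  have : IsFiniteMeasure ((volume : Measure (Space n)).restrict s) :=
    ⟨by simpa using hs.measure_lt_top⟩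
  have : IsFiniteMeasure ((volume : Measure (Space n)).restrict s') :=
    ⟨by simpa using hs'.measure_lt_top⟩
  obtain ⟨L, hL, hL'⟩ : ∃ L : ℝ, (∀ t ∈ s, ∀ i, |t i| ≤ L) ∧ ∀ t ∈ s', ∀ i, |t i| ≤ L := by
    obtain ⟨L, hL⟩ := (hs.union hs').isBounded.exists_norm_le
    have h : ∀ t ∈ s ∪ s', ∀ i, |t i| ≤ L := fun t ht i => (PiLp.norm_apply_le t i).trans (hL t ht)
    exact ⟨L, fun t ht => h t (Or.inl ht), fun t ht => h t (Or.inr ht)⟩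
  set A : ℝ≥0∞ := ENNReal.ofReal (Real.exp (2 * Real.pi * (n * L ^ 2))) *
    (volume s ^ (1 / 2 : ℝ) * volume s' ^ (1 / 2 : ℝ)) with hA
  have hAtop : A ≠ ⊤ := by
    refine ENNReal.mul_ne_top ENNReal.ofReal_ne_top (ENNReal.mul_ne_top ?_ ?_)
    · exact ENNReal.rpow_ne_top_of_nonneg (by norm_num) hs.measure_lt_top.ne
    · exact ENNReal.rpow_ne_top_of_nonneg (by norm_num) hs'.measure_lt_top.ne
  refine ⟨A.toReal, by positivity, fun c M hc hM => ?_⟩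
  have hM0 : ∀ i, 0 ≤ M i := fun i => (norm_nonneg _).trans (hM i 0 0)
  set τ : ι → Space n → Space n → ℂ := fun i x η =>
    ∫ q, E i q.1 * E' i q.2 * c i (x - q.1) (η - q.2)
      ∂((volume.restrict s).prod (volume.restrict s')) with hτ
  have hcont : ∀ i, Continuous fun p : (Space n × Space n) × (Space n × Space n) =>
      E i p.2.1 * E' i p.2.2 * c i (p.1.1 - p.2.1) (p.1.2 - p.2.2) := fun i =>
    (((hE i).comp (by fun_prop)).mul ((hE' i).comp (by fun_prop))).mul
      ((hc i).comp₂ (by fun_prop) (by fun_prop))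
  have hrep : (fun x η => ∑ i, ∫ t in s, ∫ t' in s', E i t * E' i t' * c i (x - t) (η - t')) =
      fun x η => ∑ i, τ i x η := by
    funext x η
    refine Finset.sum_congr rfl fun i _ => (integral_prod
      (fun q => E i q.1 * E' i q.2 * c i (x - q.1) (η - q.2)) ?_).symm
    have h : Continuous fun q : Space n × Space n => E i q.1 * E' i q.2 * c i (x - q.1) (η - q.2) :=
      (((hE i).comp (by fun_prop)).mul ((hE' i).comp (by fun_prop))).mul
        ((hc i).comp₂ (by fun_prop) (by fun_prop))
    rw [Measure.prod_restrict]
    exact h.continuousOn.integrableOn_compact (hs.prod hs')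
  have hτb : ∀ i, FormBound (τ i) (ENNReal.ofReal (M i) * A) := fun i =>
    FormBound.cell_average hs.measurableSet hs'.measurableSet hs.measure_lt_top.ne
      hs'.measure_lt_top.ne hL hL' (hE i).measurable (hE' i).measurable (hE1 i) (hE1' i)
      ⟨(hc i).measurable, hM i⟩
  have hτs : ∀ i, IsBddSymbol (τ i)
      (M i * ((volume.restrict s).prod (volume.restrict s')).real Set.univ) := by
    intro i
    refine ⟨((hcont i).stronglyMeasurable.integral_prod_right).measurable, fun x η => ?_⟩
    refine norm_integral_le_of_norm_le_const ?_
    rw [Measure.prod_restrict]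
    filter_upwards [ae_restrict_mem (hs.measurableSet.prod hs'.measurableSet)] with q hq
    rw [norm_mul, norm_mul]
    exact (mul_le_of_le_one_left (norm_nonneg _)
      (mul_le_one₀ (hE1 i _ hq.1) (norm_nonneg _) (hE1' i _ hq.2))).trans (hM _ _ _)
  rw [hrep]
  refine (FormBound.sum Finset.univ hτs fun i _ => hτb i).mono (le_of_eq ?_)
  rw [← Finset.sum_mul, ← ENNReal.ofReal_sum_of_nonneg fun i _ => hM0 i,
    ENNReal.ofReal_mul (by positivity), ENNReal.ofReal_toReal hAtop, mul_comm]

theorem integrableOn_setIntegral {s s' : Set (Space n)} (hs : IsCompact s) (hs' : IsCompact s')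
    {f : Space n → Space n → ℂ} (hf : Continuous fun q : Space n × Space n => f q.1 q.2) :
    IntegrableOn (fun t => ∫ t' in s', f t t') s := by
  have h : Integrable (fun q : Space n × Space n => f q.1 q.2)
      ((volume.restrict s).prod (volume.restrict s')) := by
    rw [Measure.prod_restrict]
    exact hf.continuousOn.integrableOn_compact (hs.prod hs')
  exact h.integral_prod_left

/-- Averages of a symbol over translates in `x` have bounded form without any regularity
in `x`. -/
theorem exists_formBound_translates (n : ℕ) {l : ℝ} (hl : 0 < l) : ∃ A : ℝ, 0 ≤ A ∧
    ∀ (c : Finset (Fin n) → Space n → Space n → ℂ) (M : Finset (Fin n) → ℝ),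
      (∀ S, Continuous fun p : Space n × Space n => c S p.1 p.2) →
      (∀ x, IsMixedFamily fun S η => c S x η) → (∀ S x η, ‖c S x η‖ ≤ M S) →
      FormBound (fun x η => ∫ t in unitCube n, c ∅ (x - l • t) η)
        (ENNReal.ofReal (A * ∑ S, M S)) := by
  have hsc : IsCompact (l • unitCube n) := (isCompact_unitCube n).smul l
  obtain ⟨A, hA0, hA⟩ := exists_formBound_cells (ι := Finset (Fin n)) hsc (isCompact_unitCube n)
    (E := fun _ _ => 1) (E' := cubeWeight) (fun _ => continuous_const) continuous_cubeWeight
    (by simp) (fun S t ht => norm_cubeWeight_le S ht)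
  have hw : 0 ≤ (l ^ n)⁻¹ := by positivity
  refine ⟨(l ^ n)⁻¹ * A, by positivity, fun c M hc hmix hM => ?_⟩
  have hrep : (fun x η => ∫ t in unitCube n, c ∅ (x - l • t) η) = fun x η =>
      (((l ^ n)⁻¹ : ℝ) : ℂ) * ∑ S, ∫ t in l • unitCube n, ∫ t' in unitCube n,
        1 * cubeWeight S t' * c S (x - t) (η - t') := by
    funext x η
    -- the substitution `t ↦ l • t` turns the translates into an average over the cube `l • [0,1]ⁿ`
    have h1 := Measure.setIntegral_comp_smul_of_pos (volume : Measure (Space n))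
      (fun t => c ∅ (x - t) η) (unitCube n) hl
    rw [finrank_euclideanSpace_fin] at h1
    rw [h1, Complex.real_smul]
    congr 1
    have h2 : ∀ t, c ∅ (x - t) η =
        ∑ S, ∫ t' in unitCube n, 1 * cubeWeight S t' * c S (x - t) (η - t') := by
      intro t
      simp only [one_mul]
      exact (hmix (x - t)).eq_sum_integral_cube η
    simp only [h2]
    refine integral_finsetSum _ fun S _ => integrableOn_setIntegral hsc (isCompact_unitCube n) ?_
    exact (continuous_const.mul ((continuous_cubeWeight S).comp (by fun_prop))).mul
      ((hc S).comp₂ (by fun_prop) (by fun_prop))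
  rw [hrep]
  refine ((hA c M hc hM).const_mul _).mono (le_of_eq ?_)
  rw [← ofReal_norm, Complex.norm_real, Real.norm_of_nonneg hw, ← ENNReal.ofReal_mul hw, mul_assoc]

/-- A symbol with bounded mixed first derivatives in both variables has bounded form. -/
theorem exists_formBound_mixed (n : ℕ) : ∃ A : ℝ, 0 ≤ A ∧
    ∀ (c : Finset (Fin n) → Finset (Fin n) → Space n → Space n → ℂ)
      (M : Finset (Fin n) → Finset (Fin n) → ℝ),
      (∀ S B, Continuous fun p : Space n × Space n => c S B p.1 p.2) →
      (∀ B x, IsMixedFamily fun S η => c S B x η) → (∀ S η, IsMixedFamily fun B x => c S B x η) →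
      (∀ S B x η, ‖c S B x η‖ ≤ M S B) →
      FormBound (c ∅ ∅) (ENNReal.ofReal (A * ∑ S, ∑ B, M S B)) := by
  have hsc := isCompact_unitCube n
  obtain ⟨A, hA0, hA⟩ := exists_formBound_cells (ι := Finset (Fin n) × Finset (Fin n)) hsc hsc
    (E := fun P => cubeWeight P.2) (E' := fun P => cubeWeight P.1)
    (fun P => continuous_cubeWeight P.2) (fun P => continuous_cubeWeight P.1)
    (fun P t ht => norm_cubeWeight_le P.2 ht) (fun P t ht => norm_cubeWeight_le P.1 ht)
  refine ⟨A, hA0, fun c M hc hmix hmix' hM => ?_⟩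
  have h := hA (fun P => c P.1 P.2) (fun P => M P.1 P.2) (fun P => hc P.1 P.2)
    (fun P => hM P.1 P.2)
  rw [Fintype.sum_prod_type] at h
  refine (congrArg (FormBound · _) ?_).mpr h
  funext x η
  have h2 : ∀ B t, cubeWeight B t * c ∅ B (x - t) η =
      ∑ S, ∫ t' in unitCube n, cubeWeight B t * cubeWeight S t' * c S B (x - t) (η - t') := by
    intro B t
    have := (hmix B (x - t)).eq_sum_integral_cube η
    simp only [mul_assoc, integral_const_mul]
    rw [← Finset.mul_sum, ← this]
  rw [(hmix' ∅ η).eq_sum_integral_cube x, Fintype.sum_prod_type_right]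
  refine Finset.sum_congr rfl fun B _ => ?_
  simp only [h2]
  refine integral_finsetSum _ fun S _ => integrableOn_setIntegral hsc hsc ?_
  exact (((continuous_cubeWeight B).comp (by fun_prop)).mul
    ((continuous_cubeWeight S).comp (by fun_prop))).mul
      ((hc S B).comp₂ (by fun_prop) (by fun_prop))

end JetBounds

/-! ### Symbols of limited regularity in `x` -/

section LimitedRegularity

variable {n : ℕ} {μ : ℕ} {H : Finset (Fin n) → MultiIndex n → Space n → Space n → ℂ}

/-- The binomial formula for iterated differences. -/
theorem fwdDiff_iter_eq_sum (f : Space n → ℂ) (m : ℕ) (v x : Space n) :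
    (fwdDiff v)^[m] f x =
      ∑ j ∈ Finset.range (m + 1), (((-1) ^ (m - j) * m.choose j : ℤ) : ℂ) * f (x + (j : ℝ) • v) := by
  rw [fwdDiff_iter_eq_sum_shift]
  refine Finset.sum_congr rfl fun j _ => ?_
  rw [zsmul_eq_mul, Nat.cast_smul_eq_nsmul]

/-- The average of `μ`-th differences in `x` over the unit cube, bounded by writing the symbol as an
orthant integral of its full mixed derivative in `ξ`. -/
theorem formBound_average_fwdDiff {δ : ℝ} (hδ : 0 < δ)
    {D : Finset (Fin n) → MultiIndex n → ℝ} (hH : IsJet μ H)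
    (hD : ∀ S β, order β ≤ μ → ∀ x ξ, ‖H S β x ξ‖ ≤ D S β * bracket ξ ^ (-δ - S.card)) {DD : ℝ}
    (hDD0 : 0 ≤ DD) (hDD : ∀ β, order β = μ → D Finset.univ β ≤ DD) (ρ : ℝ) :
    FormBound (fun x η => ∫ t in unitCube n, (fwdDiff (-t))^[μ] (fun y => H ∅ 0 y (ρ • η)) x)
      (ENNReal.ofReal ((n : ℝ) ^ μ * DD * ∫ ξ : Space n, bracket ξ ^ (-δ - n : ℝ))) := by
  have hb : ∀ (ξ : Space n) (p : ℝ), 0 < bracket ξ ^ p := fun ξ p =>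
    Real.rpow_pos_of_pos (bracket_pos ξ) p
  have h00 : order (0 : MultiIndex n) ≤ μ := by rw [order_zero]; exact Nat.zero_le _
  have hD0 : ∀ S β, order β ≤ μ → 0 ≤ D S β := fun S β hβ =>
    nonneg_of_mul_nonneg_left ((norm_nonneg _).trans (hD S β hβ 0 0)) (hb _ _)
  set D' : ℝ := ∑ S, D S 0 with hD'
  have hDle : ∀ S, D S 0 ≤ D' := fun S =>
    Finset.single_le_sum (f := fun S => D S 0) (fun S _ => hD0 S 0 h00) (Finset.mem_univ S)
  have horth : ∀ x ξ, H ∅ 0 x ξ = ∫ ζ in {ζ : Space n | ∀ i, ζ i < ξ i}, H Finset.univ 0 x ζ :=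
    fun x ξ => (hH.mixed_snd h00 x).eq_integral_orthant hδ (D := D') (fun S ζ =>
      (hD S 0 h00 x ζ).trans (mul_le_mul_of_nonneg_right (hDle S) (hb _ _).le)) ξ
  have hbound : ∀ x ξ, ‖H Finset.univ 0 x ξ‖ ≤ D' * bracket ξ ^ (-δ - n : ℝ) := by
    intro x ξ
    have := (hD Finset.univ 0 h00 x ξ).trans (mul_le_mul_of_nonneg_right (hDle _) (hb _ _).le)
    simpa using this
  have hint : ∀ x, Integrable fun ξ => H Finset.univ 0 x ξ := fun x =>
    ((integrable_bracket hδ).const_mul D').mono'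
      ((hH.mixed_snd h00 x).continuous _).aestronglyMeasurable
      (Filter.Eventually.of_forall fun ξ => hbound x ξ)
  set c : ℕ → ℂ := fun j => (((-1) ^ (μ - j) * μ.choose j : ℤ) : ℂ) with hc
  set G : Space n → Space n → Space n → ℂ := fun t x ξ =>
    (fwdDiff (-t))^[μ] (fun y => H Finset.univ 0 y ξ) x with hG
  have hrep : ∀ t x η, (fwdDiff (-t))^[μ] (fun y => H ∅ 0 y (ρ • η)) x =
      ∫ ξ in {ξ : Space n | ∀ i, ξ i < ρ * η i}, G t x ξ := by
    intro t x η
    simp only [hG, fwdDiff_iter_eq_sum]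
    rw [integral_finsetSum _ fun j _ => ((hint _).const_mul _).integrableOn]
    refine Finset.sum_congr rfl fun j _ => ?_
    rw [integral_const_mul, horth]
    rfl
  have hcont : ∀ S, Continuous fun q : Space n × (Space n × Space n) =>
      (fwdDiff (-q.1))^[μ] (fun y => H S 0 y q.2.2) q.2.1 := by
    intro S
    simp only [fwdDiff_iter_eq_sum]
    exact continuous_finsetSum _ fun j _ => continuous_const.mul
      ((hH.continuous S 0 h00).comp₂ (by fun_prop) (by fun_prop))
  have hpt : ∀ t, FormBound (fun x η => (fwdDiff (-t))^[μ] (fun y => H ∅ 0 y (ρ • η)) x)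
      (ENNReal.ofReal ((∑ i, |t i|) ^ μ * DD * ∫ ξ : Space n, bracket ξ ^ (-δ - n : ℝ))) := by
    intro t
    simp only [hrep]
    refine FormBound.orthant ?_ hδ (fun x ξ => ?_) ρ
    · exact ((hcont Finset.univ).comp (by fun_prop :
        Continuous fun p : Space n × Space n => ((t, p) : Space n × (Space n × Space n)))).measurable
    · have h := norm_fwdDiff_iter_le (f := fun β y => H Finset.univ β y ξ) (μ := μ)
        (fun β hβ i x s => hH.deriv_fst _ β hβ i x ξ s) (M := DD * bracket ξ ^ (-δ - n : ℝ))
        (fun β hβ y => ?_) (-t) μ 0 (by rw [order_zero, zero_add]) x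
      · simpa [mul_assoc] using h
      · have := (hD Finset.univ β hβ.le y ξ).trans
          (mul_le_mul_of_nonneg_right (hDD β hβ) (hb _ _).le)
        simpa using this
  have : IsFiniteMeasure ((volume : Measure (Space n)).restrict (unitCube n)) :=
    ⟨by simpa using (isCompact_unitCube n).measure_lt_top⟩
  have hsc : Continuous fun q : Space n × (Space n × Space n) =>
      (q.1, (q.2.1, ρ • q.2.2)) := by fun_prop
  have hI : 0 ≤ ∫ ξ : Space n, bracket ξ ^ (-δ - n : ℝ) :=
    integral_nonneg fun ξ => (hb _ _).le
  refine (FormBound.integral (ν := volume.restrict (unitCube n))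
    (σ := fun t x η => (fwdDiff (-t))^[μ] (fun y => H ∅ 0 y (ρ • η)) x)
    (M := fun _ => ∑ j ∈ Finset.range (μ + 1), ‖c j‖ * D') ((hcont ∅).comp hsc).measurable
    (integrable_const _) (fun t x η => ?_) hpt).mono ?_
  · rw [fwdDiff_iter_eq_sum]
    refine (norm_sum_le _ _).trans (Finset.sum_le_sum fun j _ => ?_)
    rw [norm_mul]
    refine mul_le_mul_of_nonneg_left ((hD ∅ 0 h00 _ _).trans ?_) (norm_nonneg _)
    refine (mul_le_of_le_one_right (hD0 _ _ h00) ?_).trans (hDle ∅)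
    exact Real.rpow_le_one_of_one_le_of_nonpos (one_le_bracket _) (by simp [hδ.le])
  · refine (setLIntegral_mono' (isCompact_unitCube n).measurableSet
      (g := fun _ => ENNReal.ofReal ((n : ℝ) ^ μ * DD * ∫ ξ : Space n, bracket ξ ^ (-δ - n : ℝ)))
      fun t ht => ENNReal.ofReal_le_ofReal ?_).trans ?_
    · have h1 : ∑ i, |t i| ≤ n := by
        refine (Finset.sum_le_sum fun i _ => abs_le_of_mem_unitCube ht i).trans ?_
        simp
      gcongr
    · rw [setLIntegral_const, volume_unitCube, mul_one]

theorem isBddSymbol_integral_unitCube {f : Space n → Space n → Space n → ℂ} {M : ℝ}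
    (hf : Continuous fun q : (Space n × Space n) × Space n => f q.2 q.1.1 q.1.2)
    (hM : ∀ t x η, ‖f t x η‖ ≤ M) : IsBddSymbol (fun x η => ∫ t in unitCube n, f t x η) M where
  measurable := (hf.stronglyMeasurable.integral_prod_right).measurable
  bound x η := by
    have h := norm_setIntegral_le_of_norm_le_const (s := unitCube n) (μ := volume)
      (isCompact_unitCube n).measure_lt_top fun t _ => hM t x η
    simpa [Measure.real, volume_unitCube] using h

/-- A symbol of class `C^μ` in `x`: its averages over translates are bounded without regularity, the
remaining `μ`-th differences through derivatives of order `μ`. -/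
theorem exists_formBound_limited (n μ : ℕ) {δ : ℝ} (hδ : 0 < δ) : ∃ A : ℝ, 0 ≤ A ∧
    ∀ (H : Finset (Fin n) → MultiIndex n → Space n → Space n → ℂ)
      (D : Finset (Fin n) → MultiIndex n → ℝ), IsJet μ H →
      (∀ S β, order β ≤ μ → ∀ x ξ, ‖H S β x ξ‖ ≤ D S β * bracket ξ ^ (-δ - S.card)) →
      ∀ DD : ℝ, 0 ≤ DD → (∀ β, order β = μ → D Finset.univ β ≤ DD) → ∀ ρ : ℝ, 0 < ρ →
      FormBound (fun x η => H ∅ 0 x (ρ • η))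
        (ENNReal.ofReal (A * (∑ S, ρ ^ S.card * D S 0 + DD))) := by
  choose A hA0 hA using fun j : ℕ => exists_formBound_translates n (l := (j : ℝ) + 1) (by positivity)
  set c : ℕ → ℂ := fun j => (((-1) ^ (μ - j) * μ.choose j : ℤ) : ℂ) with hc
  have hI : 0 ≤ ∫ ξ : Space n, bracket ξ ^ (-δ - n : ℝ) :=
    integral_nonneg fun ξ => (Real.rpow_pos_of_pos (bracket_pos ξ) _).le
  set A₁ : ℝ := (n : ℝ) ^ μ * ∫ ξ : Space n, bracket ξ ^ (-δ - n : ℝ) with hA₁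
  set A₂ : ℝ := ∑ j ∈ Finset.range μ, ‖c (j + 1)‖ * A j with hA₂
  have hA₁0 : 0 ≤ A₁ := by positivity
  have hA₂0 : 0 ≤ A₂ := Finset.sum_nonneg fun j _ => mul_nonneg (norm_nonneg _) (hA0 j)
  refine ⟨A₁ + A₂, by positivity, fun H D hH hD DD hDD0 hDD ρ hρ => ?_⟩
  have h00 : order (0 : MultiIndex n) ≤ μ := by rw [order_zero]; exact Nat.zero_le _
  have hD0 : ∀ S, 0 ≤ D S 0 := fun S =>
    nonneg_of_mul_nonneg_left ((norm_nonneg _).trans (hD S 0 h00 0 0))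
      (Real.rpow_pos_of_pos (bracket_pos _) _)
  have hle : ∀ S x ξ, ‖H S 0 x ξ‖ ≤ D S 0 := by
    intro S x ξ
    refine (hD S 0 h00 x ξ).trans (mul_le_of_le_one_right (hD0 S) ?_)
    refine Real.rpow_le_one_of_one_le_of_nonpos (one_le_bracket _) ?_
    have : (0 : ℝ) ≤ S.card := Nat.cast_nonneg _
    linarith
  set M : Finset (Fin n) → ℝ := fun S => ρ ^ S.card * D S 0 with hM
  have hM0 : 0 ≤ ∑ S, M S := Finset.sum_nonneg fun S _ => mul_nonneg (by positivity) (hD0 S)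
  -- the averages over translates in `x`
  have hlow : ∀ j : ℕ, FormBound
      (fun x η => ∫ t in unitCube n, H ∅ 0 (x - ((j : ℝ) + 1) • t) (ρ • η))
      (ENNReal.ofReal (A j * ∑ S, M S)) := by
    intro j
    have h := hA j (fun S x η => (ρ : ℂ) ^ S.card * H S 0 x (ρ • η)) M
      (fun S => continuous_const.mul
        ((hH.continuous S 0 h00).comp₂ continuous_fst (continuous_snd.const_smul ρ)))
      (fun x => (hH.mixed_snd h00 x).scale ρ) (fun S x η => ?_)
    · simpa using h
    · rw [norm_mul, norm_pow, Complex.norm_real, Real.norm_of_nonneg hρ.le]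
      exact mul_le_mul_of_nonneg_left (hle _ _ _) (by positivity)
  have hlows : ∀ j : ℕ, IsBddSymbol
      (fun x η => ∫ t in unitCube n, H ∅ 0 (x - ((j : ℝ) + 1) • t) (ρ • η)) (D ∅ 0) := fun j =>
    isBddSymbol_integral_unitCube (f := fun t x η => H ∅ 0 (x - ((j : ℝ) + 1) • t) (ρ • η))
      ((hH.continuous ∅ 0 h00).comp₂ (by fun_prop) (by fun_prop)) fun _ _ _ => hle _ _ _
  have hhigh := formBound_average_fwdDiff hδ hH hD hDD0 hDD ρ
  have hhighs : IsBddSymbol (fun x η => ∫ t in unitCube n,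
      (fwdDiff (-t))^[μ] (fun y => H ∅ 0 y (ρ • η)) x)
      (∑ j ∈ Finset.range (μ + 1), ‖c j‖ * D ∅ 0) := by
    refine isBddSymbol_integral_unitCube
      (f := fun t x η => (fwdDiff (-t))^[μ] (fun y => H ∅ 0 y (ρ • η)) x) ?_ fun t x η => ?_
    · simp only [fwdDiff_iter_eq_sum]
      exact continuous_finsetSum _ fun j _ => continuous_const.mul
        ((hH.continuous ∅ 0 h00).comp₂ (by fun_prop) (by fun_prop))
    · rw [fwdDiff_iter_eq_sum]
      refine (norm_sum_le _ _).trans (Finset.sum_le_sum fun j _ => ?_)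
      rw [norm_mul]
      exact mul_le_mul_of_nonneg_left (hle _ _ _) (norm_nonneg _)
  -- the coefficient of the undisplaced term in the `μ`-th difference is `(-1)^μ`
  have hs : ((-1 : ℂ) ^ μ) * (-1) ^ μ = 1 := by rw [← mul_pow]; simp
  have hrep : (fun x η => H ∅ 0 x (ρ • η)) = fun x η =>
      (-1 : ℂ) ^ μ * (∫ t in unitCube n, (fwdDiff (-t))^[μ] (fun y => H ∅ 0 y (ρ • η)) x) +
        ∑ j ∈ Finset.range μ, (-(-1 : ℂ) ^ μ * c (j + 1)) *
          ∫ t in unitCube n, H ∅ 0 (x - ((j : ℝ) + 1) • t) (ρ • η) := by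
    funext x η
    have h1 : ∀ t, (fwdDiff (-t))^[μ] (fun y => H ∅ 0 y (ρ • η)) x =
        (∑ j ∈ Finset.range μ, c (j + 1) * H ∅ 0 (x - ((j : ℝ) + 1) • t) (ρ • η)) +
          (-1) ^ μ * H ∅ 0 x (ρ • η) := by
      intro t
      rw [fwdDiff_iter_eq_sum, Finset.sum_range_succ']
      simp [hc, sub_eq_add_neg]
    have hint : ∀ j : ℕ, Continuous fun t => H ∅ 0 (x - ((j : ℝ) + 1) • t) (ρ • η) := fun j =>
      (hH.continuous ∅ 0 h00).comp₂ (by fun_prop) (by fun_prop)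
    have hint' : ∀ j ∈ Finset.range μ, Integrable
        (fun t => c (j + 1) * H ∅ 0 (x - ((j : ℝ) + 1) • t) (ρ • η))
        (volume.restrict (unitCube n)) := fun j _ =>
      (continuous_const.mul (hint j)).continuousOn.integrableOn_compact (isCompact_unitCube n)
    have hvol : (volume : Measure (Space n)).real (unitCube n) = 1 := by
      simp [Measure.real, volume_unitCube]
    simp only [h1]
    rw [integral_add (integrable_finsetSum _ hint')
      (continuous_const.continuousOn.integrableOn_compact (isCompact_unitCube n)),
      integral_finsetSum _ hint', setIntegral_const, hvol, one_smul, mul_add, ← mul_assoc, hs,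
      one_mul, Finset.mul_sum]
    simp only [integral_const_mul, neg_mul, Finset.sum_neg_distrib, mul_assoc]
    ring
  have hcm : ∀ {σ : Space n → Space n → ℂ} {B : ℝ} (z : ℂ), IsBddSymbol σ B →
      IsBddSymbol (fun x η => z * σ x η) (‖z‖ * B) := fun z h =>
    ⟨h.measurable.const_mul z, fun x η => by
      rw [norm_mul]; exact mul_le_mul_of_nonneg_left (h.bound x η) (norm_nonneg z)⟩
  have hsum : IsBddSymbol (fun x η => ∑ j ∈ Finset.range μ, (-(-1 : ℂ) ^ μ * c (j + 1)) *
          ∫ t in unitCube n, H ∅ 0 (x - ((j : ℝ) + 1) • t) (ρ • η))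
      (∑ j ∈ Finset.range μ, ‖-(-1 : ℂ) ^ μ * c (j + 1)‖ * D ∅ 0) :=
    ⟨Finset.measurable_fun_sum _ fun j _ => (hcm _ (hlows j)).measurable, fun x η =>
      (norm_sum_le _ _).trans (Finset.sum_le_sum fun j _ => (hcm _ (hlows j)).bound x η)⟩
  rw [hrep]
  refine (FormBound.add (hcm _ hhighs) hsum (hhigh.const_mul _)
    (FormBound.sum (Finset.range μ) (fun j => hcm _ (hlows j))
      fun j _ => (hlow j).const_mul _)).mono ?_
  have hn1 : ‖(-1 : ℂ) ^ μ‖ = 1 := by simp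
  have hmul : ∀ j, ‖-(-1 : ℂ) ^ μ * c (j + 1)‖ₑ * ENNReal.ofReal (A j * ∑ S, M S) =
      ENNReal.ofReal (‖c (j + 1)‖ * A j * ∑ S, M S) := by
    intro j
    rw [← ofReal_norm, norm_mul, norm_neg, hn1, one_mul, ← ENNReal.ofReal_mul (norm_nonneg _),
      mul_assoc]
  simp only [hmul]
  rw [← ofReal_norm, hn1, ENNReal.ofReal_one, one_mul, ← ENNReal.ofReal_sum_of_nonneg fun j _ =>
    mul_nonneg (mul_nonneg (norm_nonneg _) (hA0 j)) hM0, ← Finset.sum_mul,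
    ← ENNReal.ofReal_add (by positivity) (by positivity)]
  refine ENNReal.ofReal_le_ofReal ?_
  have e1 : 0 ≤ A₁ * ∑ S, M S := by positivity
  have e2 : 0 ≤ A₂ * DD := by positivity
  calc (n : ℝ) ^ μ * DD * (∫ ξ : Space n, bracket ξ ^ (-δ - n : ℝ)) + A₂ * ∑ S, M S
      = A₁ * DD + A₂ * ∑ S, M S := by rw [hA₁]; ring
    _ ≤ (A₁ + A₂) * (∑ S, M S + DD) := by linarith

/-- With `n ≤ μ` derivatives in `x` the cube representation is available in both variables. -/
theorem exists_formBound_regular {n μ : ℕ} (hn : n ≤ μ) : ∃ A : ℝ, 0 ≤ A ∧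
    ∀ (H : Finset (Fin n) → MultiIndex n → Space n → Space n → ℂ)
      (D : Finset (Fin n) → MultiIndex n → ℝ), IsJet μ H →
      (∀ S β, order β ≤ μ → ∀ x ξ, ‖H S β x ξ‖ ≤ D S β) → ∀ ρ : ℝ, 0 < ρ →
      FormBound (fun x η => H ∅ 0 x (ρ • η))
        (ENNReal.ofReal (A * ∑ S, ∑ B, ρ ^ S.card * D S (indicator B))) := by
  obtain ⟨A, hA0, hA⟩ := exists_formBound_mixed n
  refine ⟨A, hA0, fun H D hH hD ρ hρ => ?_⟩
  have hB : ∀ B : Finset (Fin n), order (indicator B) ≤ μ := fun B => by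
    rw [order_indicator]
    exact (Finset.card_le_univ B).trans (by simpa using hn)
  have h := hA (fun S B x η => (ρ : ℂ) ^ S.card * H S (indicator B) x (ρ • η))
    (fun S B => ρ ^ S.card * D S (indicator B))
    (fun S B => continuous_const.mul
      ((hH.continuous S _ (hB B)).comp₂ continuous_fst (continuous_snd.const_smul ρ)))
    (fun B x => (hH.mixed_snd (hB B) x).scale ρ)
    (fun S η => ⟨fun B => continuous_const.mul ((hH.mixed_fst hn S (ρ • η)).continuous B),
      fun B i hi x s => ((hH.mixed_fst hn S (ρ • η)).deriv B i hi x s).const_mul _⟩)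
    (fun S B x η => ?_)
  · simpa [indicator_empty] using h
  · rw [norm_mul, norm_pow, Complex.norm_real, Real.norm_of_nonneg hρ.le]
    exact mul_le_mul_of_nonneg_left (hD _ _ (hB B) _ _) (by positivity)

end LimitedRegularity

/-! ### From form bounds to `L²` bounds -/

section Operators

open scoped FourierTransform

variable {n : ℕ}

/-- The operator `F ↦ ∫ e^{-2πi⟨x,η⟩} σ(x,η) F(η) dη` is bounded on `L²` by any bound of the form of
`σ`. -/
theorem FormBound.eLpNorm_le {σ : Space n → Space n → ℂ} {M : ℝ} {N : ℝ≥0∞} (h : FormBound σ N)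
    (hσ : IsBddSymbol σ M) {F : Space n → ℂ} (hF : IsTest F) :
    eLpNorm (fun x => ∫ η, phase x η * σ x η * F η) 2 volume ≤ N * eLpNorm F 2 volume := by
  set W : Space n → ℂ := fun x => ∫ η, phase x η * σ x η * F η with hW
  have hWm : Measurable W := (((measurable_phase.mul hσ.measurable).mul
    (hF.measurable.comp measurable_snd)).stronglyMeasurable.integral_prod_right).measurable
  have hWb : ∀ x, ‖W x‖ ≤ ∫ η, M * ‖F η‖ := by
    intro x
    refine norm_integral_le_of_norm_le (hF.integrable.norm.const_mul M)
      (Filter.Eventually.of_forall fun η => ?_)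
    rw [norm_mul, norm_mul, norm_phase, one_mul]
    exact mul_le_mul_of_nonneg_right (hσ.bound x η) (norm_nonneg _)
  have key : ∀ r : ℝ, ∫⁻ x in Metric.ball (0 : Space n) r, ‖W x‖ₑ ^ 2 ≤
      (N * eLpNorm F 2 volume) ^ 2 := by
    intro r
    -- test against the truncation of the conjugate of `W`
    set v : Space n → ℂ := (Metric.ball (0 : Space n) r).indicator fun x => star (W x) with hv
    have hballm : MeasurableSet (Metric.ball (0 : Space n) r) := Metric.isOpen_ball.measurableSet
    have hball : volume (Metric.ball (0 : Space n) r) ≠ ⊤ := measure_ball_lt_top.ne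
    have hvm : Measurable v := (continuous_star.measurable.comp hWm).indicator hballm
    have hfin : ∀ p : ℝ≥0∞, MemLp v p := by
      intro p
      have : IsFiniteMeasure ((volume : Measure (Space n)).restrict (Metric.ball 0 r)) :=
        ⟨by simpa using hball.lt_top⟩
      rw [hv, memLp_indicator_iff_restrict hballm]
      exact MemLp.of_bound (continuous_star.measurable.comp hWm).aestronglyMeasurable _
        (Filter.Eventually.of_forall fun x => by rw [norm_star]; exact hWb x)
    have hvt : IsTest v := ⟨hvm, memLp_one_iff_integrable.mp (hfin 1), hfin 2⟩
    have hsq : eLpNorm v 2 volume ^ 2 = ∫⁻ x in Metric.ball (0 : Space n) r, ‖W x‖ₑ ^ 2 := by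
      rw [eLpNorm_two_sq, ← lintegral_indicator hballm]
      refine lintegral_congr fun x => ?_
      by_cases hx : x ∈ Metric.ball (0 : Space n) r
      · simp only [hv, Set.indicator_of_mem hx]
        rw [← ofReal_norm, norm_star, ofReal_norm]
      · simp only [hv, Set.indicator_of_notMem hx, enorm_zero, zero_pow two_ne_zero]
    have hform : ‖form σ F v‖ₑ = eLpNorm v 2 volume ^ 2 := by
      have h1 : form σ F v = ∫ x, ((‖v x‖ ^ 2 : ℝ) : ℂ) := by
        rw [form, integral_prod _ (hσ.integrable_integrand hF hvt)]
        refine integral_congr_ae (Filter.Eventually.of_forall fun x => ?_)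
        have h2 : ∀ η, phase x η * σ x η * (v x * F η) = v x * (phase x η * σ x η * F η) :=
          fun η => by ring
        simp only [h2, integral_const_mul]
        change v x * W x = _
        by_cases hx : x ∈ Metric.ball (0 : Space n) r
        · simp only [hv, Set.indicator_of_mem hx, norm_star]
          rw [RCLike.star_def, Complex.conj_mul']
          push_cast
          rfl
        · simp [hv, Set.indicator_of_notMem hx]
      have h0 : 0 ≤ ∫ x, ‖v x‖ ^ 2 := integral_nonneg fun x => by positivity
      rw [h1, integral_complex_ofReal, ← ofReal_norm, Complex.norm_real, Real.norm_of_nonneg h0,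
        eLpNorm_two_sq, ofReal_integral_eq_lintegral_ofReal ((hfin 2).integrable_norm_pow two_ne_zero)
          (Filter.Eventually.of_forall fun x => by positivity)]
      refine lintegral_congr fun x => ?_
      rw [ENNReal.ofReal_pow (norm_nonneg _), ofReal_norm]
    have h3 := h F v hF hvt
    rw [hform] at h3
    rw [← hsq]
    -- `‖v‖² ≤ N ‖F‖ ‖v‖` may be divided by `‖v‖`, which is finite
    have hle : eLpNorm v 2 volume ≤ N * eLpNorm F 2 volume := by
      by_cases h0 : eLpNorm v 2 volume = 0
      · rw [h0]; exact zero_le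
      · rw [sq, ← mul_assoc] at h3
        exact (ENNReal.mul_le_mul_iff_left h0 (hfin 2).eLpNorm_ne_top).mp h3
    gcongr
  have hlim := (aecover_ball (μ := (volume : Measure (Space n))) (x := 0)
    (Filter.tendsto_id (α := ℝ) (x := Filter.atTop))).lintegral_tendsto_of_countably_generated
    (f := fun x => ‖W x‖ₑ ^ 2) (hWm.enorm.pow_const 2).aemeasurable
  have h4 := le_of_tendsto' hlim key
  rw [← eLpNorm_two_sq] at h4
  exact (ENNReal.pow_le_pow_left_iff two_ne_zero).mp h4

theorem eLpNorm_comp_smul_sq {f : Space n → ℂ} (hf : Measurable f) {r : ℝ} (hr : r ≠ 0) :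
    eLpNorm (fun x => f (r • x)) 2 volume ^ 2 =
      ENNReal.ofReal |(r ^ n)⁻¹| * eLpNorm f 2 volume ^ 2 := by
  have h := Measure.map_addHaar_smul (volume : Measure (Space n)) hr
  rw [finrank_euclideanSpace_fin] at h
  rw [eLpNorm_two_sq, eLpNorm_two_sq, ← smul_eq_mul, ← lintegral_smul_measure, ← h,
    lintegral_map (hf.enorm.pow_const 2) (measurable_const_smul r)]

/-- `Op_h(a) f` in terms of the Fourier transform of `f`. -/
theorem Op_eq_integral_fourier {h : ℝ} (hh : 0 < h) (a : Space n → Space n → ℂ)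
    (f : 𝓢(Space n, ℂ)) (x : Space n) :
    Op h a f x = (((2 * Real.pi * h) ^ n : ℝ) : ℂ)⁻¹ *
      ∫ ξ, phase x ((2 * Real.pi * h)⁻¹ • ξ) * a x ξ * 𝓕 f (-((2 * Real.pi * h)⁻¹ • ξ)) := by
  rw [Op]
  congr 2
  funext ξ
  have hc : (h : ℂ) ≠ 0 := by exact_mod_cast hh.ne'
  have hpi : (Real.pi : ℂ) ≠ 0 := by exact_mod_cast Real.pi_ne_zero
  rw [SchwartzMap.fourier_coe, fourier_eq_integral_phase, ← integral_const_mul]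
  refine integral_congr_ae (Filter.Eventually.of_forall fun y => ?_)
  have he : Complex.exp (-(Complex.I / (h : ℂ)) * ((inner ℝ (x - y) ξ : ℝ) : ℂ)) =
      phase x ((2 * Real.pi * h)⁻¹ • ξ) * phase y (-((2 * Real.pi * h)⁻¹ • ξ)) := by
    simp only [phase, Real.fourierChar_apply]
    rw [← Complex.exp_add]
    congr 1
    rw [inner_neg_right, inner_smul_right, inner_smul_right, inner_sub_left]
    push_cast
    field_simp
    ring
  simp only [he]
  ring

theorem isTest_schwartz (G : 𝓢(Space n, ℂ)) : IsTest G :=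
  ⟨G.continuous.measurable, G.integrable, G.memLp 2⟩

theorem IsTest.comp_smul {f : Space n → ℂ} (hf : IsTest f) {r : ℝ} (hr : r ≠ 0) :
    IsTest fun x => f (r • x) where
  measurable := hf.measurable.comp (measurable_const_smul r)
  integrable := hf.integrable.comp_smul hr
  memLp := by
    refine ⟨(hf.measurable.comp (measurable_const_smul r)).aestronglyMeasurable, ?_⟩
    have h : eLpNorm (fun x => f (r • x)) 2 volume ^ 2 < ⊤ := by
      rw [eLpNorm_comp_smul_sq hf.measurable hr]
      exact ENNReal.mul_lt_top ENNReal.ofReal_lt_top (ENNReal.pow_lt_top hf.memLp.2)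
    simpa using h

theorem phase_smul_smul {r : ℝ} (hr : r ≠ 0) (x η : Space n) :
    phase (r • x) (r⁻¹ • η) = phase x η := by
  simp only [phase, inner_smul_left, inner_smul_right]
  simp [hr]

/-- The symbol `a(x,ξ)⟨ξ⟩^{-k}` in the variables `x = ρx'`, `ξ = ρη`, `ρ = (2πh)^{1/2}`, in which the
semiclassical phase is `e^{-2πi⟨x',η⟩}`. -/
noncomputable def rescaled (h k : ℝ) (a : Space n → Space n → ℂ) (x η : Space n) : ℂ :=
  a (√(2 * Real.pi * h) • x) (√(2 * Real.pi * h) • η) *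
    ((bracket (√(2 * Real.pi * h) • η) ^ (-k) : ℝ) : ℂ)

/-- The Fourier transform of `⟨hD⟩^k f` in the rescaled frequency variable, reflected at the origin
and multiplied by the normalizing factor `ρ^{-n}`, `ρ = (2πh)^{1/2}`. -/
noncomputable def rescaledFourier (h k : ℝ) (f : 𝓢(Space n, ℂ)) (η : Space n) : ℂ :=
  ((√(2 * Real.pi * h) ^ n : ℝ) : ℂ)⁻¹ *
    SchwartzMap.smulLeftCLM ℂ (bracketPow n h k) (𝓕 f) ((-(√(2 * Real.pi * h))⁻¹) • η)

theorem isTest_rescaledFourier {h : ℝ} (hh : 0 < h) (k : ℝ) (f : 𝓢(Space n, ℂ)) :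
    IsTest (rescaledFourier h k f) := by
  have hρ0 : 0 < √(2 * Real.pi * h) := Real.sqrt_pos.mpr (by positivity)
  exact ((isTest_schwartz _).comp_smul (neg_ne_zero.mpr (inv_ne_zero hρ0.ne'))).mul_bdd
    measurable_const fun _ => le_rfl

theorem rescaledFourier_add (h k : ℝ) (f g : 𝓢(Space n, ℂ)) (η : Space n) :
    rescaledFourier h k (f + g) η = rescaledFourier h k f η + rescaledFourier h k g η := by
  simp only [rescaledFourier, FourierTransform.fourier_add, map_add, add_apply, mul_add]

theorem rescaledFourier_smul (h k : ℝ) (c : ℂ) (f : 𝓢(Space n, ℂ)) (η : Space n) :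
    rescaledFourier h k (c • f) η = c * rescaledFourier h k f η := by
  simp only [rescaledFourier, FourierTransform.fourier_smul, map_smul, smul_apply,
    smul_eq_mul]
  ring

theorem eLpNorm_rescaledFourier_sq {h : ℝ} (hh : 0 < h) (k : ℝ) (f : 𝓢(Space n, ℂ)) :
    eLpNorm (rescaledFourier h k f) 2 volume ^ 2 =
      ENNReal.ofReal ((√(2 * Real.pi * h) ^ n)⁻¹) * ‖Sobolev.ofSchwartz n h k f‖ₑ ^ 2 := by
  set ρ : ℝ := √(2 * Real.pi * h) with hρ
  have hρ0 : 0 < ρ := Real.sqrt_pos.mpr (by positivity)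
  set G : 𝓢(Space n, ℂ) := SchwartzMap.smulLeftCLM ℂ (bracketPow n h k) (𝓕 f) with hG
  have hGn : ‖Sobolev.ofSchwartz n h k f‖ₑ = eLpNorm G 2 volume := by
    have h1 : ‖Sobolev.ofSchwartz n h k f‖ = ‖G.toLp 2‖ := by
      rw [Sobolev.norm_def, Sobolev.potential_ofSchwartz, ← SchwartzMap.norm_fourier_toL2_eq,
        SchwartzMap.fourierMultiplierCLM_apply, FourierTransform.fourier_fourierInv_eq]
    rw [← ofReal_norm, h1, ofReal_norm, Lp.enorm_def]
    exact eLpNorm_congr_ae (G.coeFn_toLp 2 volume)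
  have h1 : rescaledFourier h k f = (((ρ ^ n : ℝ) : ℂ)⁻¹) • fun η => G ((-ρ⁻¹) • η) := rfl
  have h2 := eLpNorm_comp_smul_sq G.continuous.measurable
    (neg_ne_zero.mpr (inv_ne_zero hρ0.ne') : (-ρ⁻¹) ≠ 0)
  have h3 : ‖((ρ ^ n : ℝ) : ℂ)⁻¹‖ₑ = ENNReal.ofReal ((ρ ^ n)⁻¹) := by
    rw [← ofReal_norm, norm_inv, Complex.norm_real, Real.norm_of_nonneg (by positivity)]
  have h4 : |((-ρ⁻¹) ^ n)⁻¹| = ρ ^ n := by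
    rw [abs_inv, abs_pow, abs_neg, abs_of_pos (inv_pos.mpr hρ0), inv_pow, inv_inv]
  rw [h1, eLpNorm_const_smul, mul_pow, h2, h3, h4, hGn, ← mul_assoc, sq, mul_assoc (ENNReal.ofReal _),
    ← ENNReal.ofReal_mul (by positivity), inv_mul_cancel₀ (by positivity), ENNReal.ofReal_one,
    mul_one]

/-- In the rescaled variables `Op_h(a) f` is an oscillatory integral against the Fourier transform
of `⟨hD⟩^k f`, with the symbol `a⟨ξ⟩^{-k}`. -/
theorem Op_eq_integral_rescaled {h : ℝ} (hh : 0 < h) (k : ℝ) (a : Space n → Space n → ℂ)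
    (f : 𝓢(Space n, ℂ)) (x : Space n) :
    Op h a f (√(2 * Real.pi * h) • x) =
      ∫ η, phase x η * rescaled h k a x η * rescaledFourier h k f η := by
  set ρ : ℝ := √(2 * Real.pi * h) with hρ
  have hp : 0 < 2 * Real.pi * h := by positivity
  have hρ0 : 0 < ρ := Real.sqrt_pos.mpr hp
  have hρ2 : ρ ^ 2 = 2 * Real.pi * h := Real.sq_sqrt hp.le
  rw [Op_eq_integral_fourier hh]
  set Φ : Space n → ℂ := fun ξ => phase (ρ • x) ((2 * Real.pi * h)⁻¹ • ξ) * a (ρ • x) ξ *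
    𝓕 f (-((2 * Real.pi * h)⁻¹ • ξ)) with hΦ
  have h1 := Measure.integral_comp_smul_of_nonneg (volume : Measure (Space n)) Φ ρ
    (hR := hρ0.le)
  rw [finrank_euclideanSpace_fin, Complex.real_smul] at h1
  have h2 : ∫ ξ, Φ ξ = ((ρ ^ n : ℝ) : ℂ) * ∫ η, Φ (ρ • η) := by
    have : ((ρ ^ n : ℝ) : ℂ) ≠ 0 := by exact_mod_cast (pow_pos hρ0 n).ne'
    rw [h1, Complex.ofReal_inv, mul_inv_cancel_left₀ this]
  rw [h2, ← hρ2, ← pow_mul, mul_comm 2 n, pow_mul, sq, Complex.ofReal_mul, mul_inv, mul_assoc,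
    inv_mul_cancel_left₀ (by exact_mod_cast (pow_pos hρ0 n).ne'), ← integral_const_mul]
  refine integral_congr_ae (Filter.Eventually.of_forall fun η => ?_)
  have h3 : (ρ ^ 2)⁻¹ • (ρ • η) = ρ⁻¹ • η := by
    rw [smul_smul]; congr 1; field_simp
  have h4 : 𝓕 f (-(ρ⁻¹ • η)) = ((bracket (ρ • η) ^ (-k) : ℝ) : ℂ) *
      SchwartzMap.smulLeftCLM ℂ (bracketPow n h k) (𝓕 f) ((-ρ⁻¹) • η) := by
    have h5 : bracketPow n h k ((-ρ⁻¹) • η) = ((bracket (ρ • η) ^ k : ℝ) : ℂ) := by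
      rw [bracketPow, ← hρ2, smul_smul, show ρ ^ 2 * -ρ⁻¹ = -ρ by field_simp]
      simp only [bracket, neg_smul, norm_neg]
    rw [SchwartzMap.smulLeftCLM_apply_apply (bracketPow_hasTemperateGrowth n h k), h5,
      smul_eq_mul, ← mul_assoc, ← Complex.ofReal_mul, ← Real.rpow_add (bracket_pos _)]
    simp
  simp only [hΦ, ← hρ2, h3, h4, phase_smul_smul hρ0.ne', rescaledFourier, rescaled]
  simp only [hρ2, ← hρ]
  ring

theorem Op_eq_comp_smul {h : ℝ} (hh : 0 < h) (k : ℝ) (a : Space n → Space n → ℂ)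
    (f : 𝓢(Space n, ℂ)) : Op h a f = fun x => (fun x => ∫ η, phase x η * rescaled h k a x η *
      rescaledFourier h k f η) ((√(2 * Real.pi * h))⁻¹ • x) := by
  have hρ0 : 0 < √(2 * Real.pi * h) := Real.sqrt_pos.mpr (by positivity)
  funext x
  have h1 := Op_eq_integral_rescaled hh k a f ((√(2 * Real.pi * h))⁻¹ • x)
  rwa [smul_inv_smul₀ hρ0.ne'] at h1

section Extension

variable {h k M : ℝ} {a : Space n → Space n → ℂ}

theorem integrable_phase_mul (hh : 0 < h) (hσ : IsBddSymbol (rescaled h k a) M)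
    (f : 𝓢(Space n, ℂ)) (x : Space n) :
    Integrable fun η => phase x η * rescaled h k a x η * rescaledFourier h k f η := by
  refine (isTest_rescaledFourier hh k f).integrable.bdd_mul (c := M)
    (((measurable_phase.mul hσ.measurable).comp measurable_prodMk_left).aestronglyMeasurable)
    (Filter.Eventually.of_forall fun η => ?_)
  rw [norm_mul, norm_phase, one_mul]
  exact hσ.bound x η

theorem measurable_Op (hh : 0 < h) (hσ : IsBddSymbol (rescaled h k a) M)
    (f : 𝓢(Space n, ℂ)) : Measurable (Op h a f) := by
  rw [Op_eq_comp_smul hh k]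
  have h1 : Measurable fun x => ∫ η, phase x η * rescaled h k a x η * rescaledFourier h k f η :=
    (((measurable_phase.mul hσ.measurable).mul ((isTest_rescaledFourier hh k f).measurable.comp
      measurable_snd)).stronglyMeasurable.integral_prod_right).measurable
  exact h1.comp (measurable_const_smul _)

theorem eLpNorm_Op_le (hh : 0 < h) {N : ℝ≥0∞} (hσ : IsBddSymbol (rescaled h k a) M)
    (hN : FormBound (rescaled h k a) N) (f : 𝓢(Space n, ℂ)) :
    eLpNorm (Op h a f) 2 volume ≤ N * ‖Sobolev.ofSchwartz n h k f‖ₑ := by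
  have hρ0 : 0 < √(2 * Real.pi * h) := Real.sqrt_pos.mpr (by positivity)
  set W : Space n → ℂ := fun x => ∫ η, phase x η * rescaled h k a x η * rescaledFourier h k f η
    with hW
  have hWm : Measurable W := (((measurable_phase.mul hσ.measurable).mul
    ((isTest_rescaledFourier hh k f).measurable.comp
      measurable_snd)).stronglyMeasurable.integral_prod_right).measurable
  have hWN := hN.eLpNorm_le hσ (isTest_rescaledFourier hh k f)
  have e3 : eLpNorm (Op h a f) 2 volume ^ 2 =
      ENNReal.ofReal (√(2 * Real.pi * h) ^ n) * eLpNorm W 2 volume ^ 2 := by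
    rw [Op_eq_comp_smul hh k, eLpNorm_comp_smul_sq hWm (inv_ne_zero hρ0.ne')]
    congr 2
    rw [inv_pow, inv_inv, abs_of_pos (by positivity)]
  rw [← ENNReal.pow_le_pow_left_iff two_ne_zero, mul_pow, e3]
  calc ENNReal.ofReal (√(2 * Real.pi * h) ^ n) * eLpNorm W 2 volume ^ 2
      ≤ ENNReal.ofReal (√(2 * Real.pi * h) ^ n) *
          (N * eLpNorm (rescaledFourier h k f) 2 volume) ^ 2 := by gcongr
    _ = (ENNReal.ofReal (√(2 * Real.pi * h) ^ n) * ENNReal.ofReal ((√(2 * Real.pi * h) ^ n)⁻¹)) *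
          (N ^ 2 * ‖Sobolev.ofSchwartz n h k f‖ₑ ^ 2) := by
        rw [mul_pow, eLpNorm_rescaledFourier_sq hh]; ring
    _ = _ := by
        rw [← ENNReal.ofReal_mul (by positivity), mul_inv_cancel₀ (by positivity),
          ENNReal.ofReal_one, one_mul]

/-- If the rescaled symbol has bounded form, then `Op_h(a)` has a bounded extension to the Sobolev
space, whose norm is at most every bound of the form. -/
theorem exists_isOpExtension (hh : 0 < h) {N₀ : ℝ} (hσ : IsBddSymbol (rescaled h k a) M)
    (hN₀ : FormBound (rescaled h k a) (ENNReal.ofReal N₀)) :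
    ∃ T : Sobolev n h k →L[ℂ] L2 n, IsOpExtension a T ∧
      ∀ N : ℝ, 0 ≤ N → FormBound (rescaled h k a) (ENNReal.ofReal N) → ‖T‖ ≤ N := by
  have hmem : ∀ f : 𝓢(Space n, ℂ), MemLp (Op h a f) 2 := fun f =>
    ⟨(measurable_Op hh hσ f).aestronglyMeasurable, (eLpNorm_Op_le hh hσ hN₀ f).trans_lt
      (ENNReal.mul_lt_top ENNReal.ofReal_lt_top enorm_lt_top)⟩
  let e : 𝓢(Space n, ℂ) →ₗ[ℂ] Sobolev n h k :=
    { toFun := Sobolev.ofSchwartz n h k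
      map_add' f g := Subtype.ext (map_add (SchwartzMap.toTemperedDistributionCLM (Space n) ℂ volume) f g)
      map_smul' c f := Subtype.ext
        (map_smul (SchwartzMap.toTemperedDistributionCLM (Space n) ℂ volume) c f) }
  let A : 𝓢(Space n, ℂ) →ₗ[ℂ] L2 n :=
    { toFun := fun f => (hmem f).toLp
      map_add' f g := by
        rw [← MemLp.toLp_add]
        congr 1
        funext x
        simp only [Op_eq_comp_smul hh k, Pi.add_apply, rescaledFourier_add, mul_add]
        exact integral_add (integrable_phase_mul hh hσ f _) (integrable_phase_mul hh hσ g _)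
      map_smul' c f := by
        rw [RingHom.id_apply, ← MemLp.toLp_const_smul]
        congr 1
        funext x
        simp only [Op_eq_comp_smul hh k, Pi.smul_apply, rescaledFourier_smul, smul_eq_mul]
        rw [← integral_const_mul]
        congr 1
        funext η
        ring }
  have hnorm : ∀ N : ℝ, 0 ≤ N → FormBound (rescaled h k a) (ENNReal.ofReal N) →
      ∀ f, ‖A f‖ ≤ N * ‖e f‖ := by
    intro N hN0 hN f
    have h1 : ‖A f‖ₑ ≤ ENNReal.ofReal N * ‖e f‖ₑ := by
      refine le_trans (le_of_eq ?_) (eLpNorm_Op_le hh hσ hN f)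
      exact Lp.enorm_toLp (hmem f)
    rw [← ofReal_norm, ← ofReal_norm, ← ENNReal.ofReal_mul hN0] at h1
    exact (ENNReal.ofReal_le_ofReal_iff (by positivity)).mp h1
  have hdense : DenseRange e := Sobolev.denseRange_ofSchwartz n h k
  have hN₀' : FormBound (rescaled h k a) (ENNReal.ofReal (max N₀ 0)) :=
    hN₀.mono (ENNReal.ofReal_le_ofReal (le_max_left _ _))
  refine ⟨A.extendOfNorm e, fun f => ?_, fun N hN0 hN =>
    LinearMap.opNorm_extendOfNorm_le hdense hN0 (hnorm N hN0 hN)⟩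
  have h1 : A.extendOfNorm e (Sobolev.ofSchwartz n h k f) = (hmem f).toLp :=
    LinearMap.extendOfNorm_eq hdense ⟨_, hnorm _ (le_max_right _ _) hN₀'⟩ f
  rw [h1]
  exact (hmem f).coeFn_toLp

end Extension

end Operators

/-! ### The symbol constants -/

section Constants

variable {n : ℕ} {k k' : ℝ} {μ : ℕ} {a : Space n → Space n → ℂ}
  {C : MultiIndex n → MultiIndex n → ℝ}

theorem IsSymbol.nonneg (ha : IsSymbol k μ a C) (α : MultiIndex n) {β : MultiIndex n}
    (hβ : order β ≤ μ) : 0 ≤ C α β :=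
  nonneg_of_mul_nonneg_left ((norm_nonneg _).trans (ha.bound α β hβ 0 0))
    (Real.rpow_pos_of_pos (bracket_pos _) _)

theorem IsSymbol.le_weightedSum (ha : IsSymbol k μ a C) {h : ℝ} (hh : 0 < h) {s : ℕ}
    {α β : MultiIndex n} (hβ : order β ≤ μ) (hs : order α + order β ≤ s) :
    h ^ (((order α : ℝ) + (order β : ℝ)) / 2) * C α β ≤ weightedSum s μ h C := by
  refine Finset.single_le_sum (f := fun p : MultiIndex n × MultiIndex n =>
    h ^ (((order p.1 : ℝ) + (order p.2 : ℝ)) / 2) * C p.1 p.2) (fun p hp => ?_)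
    (a := (α, β)) ?_
  · rw [Finset.mem_filter, Finset.mem_product, mem_indicesLE, mem_indicesLE] at hp
    exact mul_nonneg (Real.rpow_nonneg hh.le _) (ha.nonneg _ hp.1.2)
  · rw [Finset.mem_filter, Finset.mem_product, mem_indicesLE, mem_indicesLE]
    exact ⟨⟨by dsimp only; omega, hβ⟩, hs⟩

theorem IsSymbol.le_plainSum (ha : IsSymbol k μ a C) {m : ℕ} {α β : MultiIndex n}
    (hα : order α ≤ m) (hβ : order β ≤ μ) : C α β ≤ plainSum m μ C := by
  have h0 : ∀ α, ∀ β ∈ indicesLE n μ, 0 ≤ C α β := fun α β hβ =>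
    ha.nonneg α (mem_indicesLE.mp hβ)
  exact (Finset.single_le_sum (f := fun β => C α β) (h0 α) (mem_indicesLE.mpr hβ)).trans
    (Finset.single_le_sum (f := fun α => ∑ β ∈ indicesLE n μ, C α β)
      (fun α _ => Finset.sum_nonneg (h0 α)) (mem_indicesLE.mpr hα))

/-- The jet of the symbol `a(ρx, ξ)⟨ξ⟩^{-k}`, `ρ = (2πh)^{1/2}`. -/
noncomputable def rescaledJet (h k : ℝ) (a : Space n → Space n → ℂ) (S : Finset (Fin n))
    (β : MultiIndex n) (x ξ : Space n) : ℂ :=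
  ((√(2 * Real.pi * h) : ℝ) : ℂ) ^ order β *
    mulBracket (-k) (fun S β x ξ => symbolDeriv (indicator S) β a x ξ) S β
      (√(2 * Real.pi * h) • x) ξ

theorem IsSymbol.isJet_rescaledJet (ha : IsSymbol k μ a C) (h : ℝ) :
    IsJet μ (rescaledJet h k' a) :=
  (ha.isJet.mulBracket (-k')).scale_fst _

theorem rescaled_eq_rescaledJet (h : ℝ) (a : Space n → Space n → ℂ) :
    rescaled h k' a = fun x η => rescaledJet h k' a ∅ 0 x (√(2 * Real.pi * h) • η) := by
  funext x η
  simp [rescaled, rescaledJet, mulBracket, order_zero, indicator_empty, symbolDeriv, mderiv_zero,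
    bracketJet_empty]

/-- The constants in the bounds of the rescaled jet: a factor `ρ` for each derivative in `x`, and
the sum over the terms of the Leibniz rule. -/
noncomputable def jetBound (K h : ℝ) (C : MultiIndex n → MultiIndex n → ℝ) (S : Finset (Fin n))
    (β : MultiIndex n) : ℝ :=
  √(2 * Real.pi * h) ^ order β * (K * ∑ R ∈ S.powerset, C (indicator R) β)

theorem IsSymbol.norm_rescaledJet_le (ha : IsSymbol k μ a C) {K : ℝ}
    (hK : ∀ (S : Finset (Fin n)) (ξ : Space n),
      |bracketJet (-k') S ξ| ≤ K * bracket ξ ^ (-k' - S.card))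
    (h : ℝ) (S : Finset (Fin n)) (β : MultiIndex n) (hβ : order β ≤ μ) (x ξ : Space n) :
    ‖rescaledJet h k' a S β x ξ‖ ≤ jetBound K h C S β * bracket ξ ^ (-(k' - k) - S.card) := by
  rw [rescaledJet, jetBound, norm_mul, norm_pow, Complex.norm_real,
    Real.norm_of_nonneg (Real.sqrt_nonneg _), mul_assoc (_ ^ _)]
  refine mul_le_mul_of_nonneg_left ?_ (pow_nonneg (Real.sqrt_nonneg _) _)
  have hR : ∀ R, ‖symbolDeriv (indicator R) β a (√(2 * Real.pi * h) • x) ξ‖ ≤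
      C (indicator R) β * bracket ξ ^ (k - R.card) := by
    intro R
    have := ha.bound (indicator R) β hβ (√(2 * Real.pi * h) • x) ξ
    rwa [order_indicator] at this
  have h1 := norm_mulBracket_le (H := fun S β x ξ => symbolDeriv (indicator S) β a x ξ) hK S hR
  rwa [show k + -k' = -(k' - k) by ring] at h1

theorem sqrt_pow_eq {h : ℝ} (hh : 0 < h) (m : ℕ) :
    √(2 * Real.pi * h) ^ m = √(2 * Real.pi) ^ m * h ^ ((m : ℝ) / 2) := by
  rw [Real.sqrt_mul (by positivity), mul_pow, Real.sqrt_eq_rpow h, ← Real.rpow_natCast,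
    ← Real.rpow_natCast (h ^ (1 / 2 : ℝ)), ← Real.rpow_mul hh.le]
  congr 2
  ring

theorem one_le_sqrt_two_pi : 1 ≤ √(2 * Real.pi) :=
  Real.one_le_sqrt.mpr (by linarith [Real.pi_gt_three])

/-- The powers of `h` produced by the rescaling dominate those of the weighted sum. -/
theorem IsSymbol.jetBound_le_weightedSum (ha : IsSymbol k μ a C) {K : ℝ} (hK : 0 ≤ K) {h : ℝ}
    (hh : 0 < h) (hh1 : h ≤ 1) (S : Finset (Fin n)) {β : MultiIndex n} (hβ : order β ≤ μ)
    (hβn : order β ≤ n) :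
    √(2 * Real.pi * h) ^ S.card * jetBound K h C S β ≤
      √(2 * Real.pi) ^ (2 * n) * K * 2 ^ n * weightedSum (2 * n) μ h C := by
  have hSn : S.card ≤ n := by simpa using Finset.card_le_univ S
  have hW : 0 ≤ weightedSum (2 * n) μ h C := (mul_nonneg (Real.rpow_nonneg hh.le _)
    (ha.nonneg 0 hβ)).trans (ha.le_weightedSum hh hβ (by rw [order_zero]; omega))
  have h2π := one_le_sqrt_two_pi
  have hterm : ∀ R ∈ S.powerset, √(2 * Real.pi * h) ^ (S.card + order β) * C (indicator R) β ≤
      √(2 * Real.pi) ^ (2 * n) * weightedSum (2 * n) μ h C := by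
    intro R hR
    have hRS := Finset.card_le_card (Finset.mem_powerset.mp hR)
    rw [sqrt_pow_eq hh, mul_assoc]
    have h1 := ha.le_weightedSum hh (s := 2 * n) (α := indicator R) hβ
      (by rw [order_indicator]; omega)
    have h2 : h ^ (((S.card + order β : ℕ) : ℝ) / 2) * C (indicator R) β ≤
        weightedSum (2 * n) μ h C := by
      refine le_trans (mul_le_mul_of_nonneg_right ?_ (ha.nonneg _ hβ)) h1
      refine Real.rpow_le_rpow_of_exponent_ge hh hh1 ?_
      rw [order_indicator, Nat.cast_add]
      have : (R.card : ℝ) ≤ S.card := by exact_mod_cast hRS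
      linarith
    refine mul_le_mul (pow_le_pow_right₀ h2π (by omega)) h2
      (mul_nonneg (Real.rpow_nonneg hh.le _) (ha.nonneg _ hβ)) (by positivity)
  have hcard : ((S.powerset.card : ℕ) : ℝ) ≤ 2 ^ n := by
    rw [Finset.card_powerset]
    exact_mod_cast Nat.pow_le_pow_right (by norm_num) hSn
  calc √(2 * Real.pi * h) ^ S.card * jetBound K h C S β
      = K * ∑ R ∈ S.powerset, √(2 * Real.pi * h) ^ (S.card + order β) * C (indicator R) β := by
        rw [jetBound, ← Finset.mul_sum, pow_add]; ring
    _ ≤ K * ∑ R ∈ S.powerset, √(2 * Real.pi) ^ (2 * n) * weightedSum (2 * n) μ h C := by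
        exact mul_le_mul_of_nonneg_left (Finset.sum_le_sum hterm) hK
    _ = K * (S.powerset.card * (√(2 * Real.pi) ^ (2 * n) * weightedSum (2 * n) μ h C)) := by
        rw [Finset.sum_const, nsmul_eq_mul]
    _ ≤ K * (2 ^ n * (√(2 * Real.pi) ^ (2 * n) * weightedSum (2 * n) μ h C)) := by gcongr
    _ = _ := by ring

/-- The derivatives of order `μ` in `x` gain the full factor `ρ^μ`. -/
theorem IsSymbol.jetBound_le_plainSum (ha : IsSymbol k μ a C) {K : ℝ} (hK : 0 ≤ K) {h : ℝ}
    (hh : 0 < h) {m : ℕ} (hm : n ≤ m) (S : Finset (Fin n)) {β : MultiIndex n} (hβ : order β = μ) :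
    jetBound K h C S β ≤
      √(2 * Real.pi) ^ μ * K * 2 ^ n * (h ^ ((μ : ℝ) / 2) * plainSum m μ C) := by
  have hP : 0 ≤ plainSum m μ C := (ha.nonneg 0 hβ.le).trans
    (ha.le_plainSum (by rw [order_zero]; omega) hβ.le)
  have hsum : ∑ R ∈ S.powerset, C (indicator R) β ≤ 2 ^ n * plainSum m μ C := by
    calc ∑ R ∈ S.powerset, C (indicator R) β ≤ ∑ R ∈ S.powerset, plainSum m μ C :=
          Finset.sum_le_sum fun R _ => ha.le_plainSum (by
            rw [order_indicator]
            exact ((by simpa using Finset.card_le_univ R) : R.card ≤ n).trans hm) hβ.le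
      _ = 2 ^ S.card * plainSum m μ C := by simp
      _ ≤ 2 ^ n * plainSum m μ C := by
          gcongr
          · norm_num
          · simpa using Finset.card_le_univ S
  rw [jetBound, hβ, sqrt_pow_eq hh]
  calc √(2 * Real.pi) ^ μ * h ^ ((μ : ℝ) / 2) * (K * ∑ R ∈ S.powerset, C (indicator R) β)
      ≤ √(2 * Real.pi) ^ μ * h ^ ((μ : ℝ) / 2) * (K * (2 ^ n * plainSum m μ C)) := by gcongr
    _ = _ := by ring

/-- The two form bounds in terms of the symbol constants. -/
theorem exists_formBound_rescaled (n μ : ℕ) {k k' : ℝ} (hk : k < k') : ∃ K : ℝ, 0 < K ∧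
    ∀ h : ℝ, 0 < h → h ≤ 1 → ∀ (a : Space n → Space n → ℂ) (C : MultiIndex n → MultiIndex n → ℝ),
      IsSymbol k μ a C →
      (∃ M, IsBddSymbol (rescaled h k' a) M) ∧ 0 ≤ weightedSum (2 * n) μ h C ∧
      0 ≤ plainSum (n + 1) μ C ∧
      FormBound (rescaled h k' a) (ENNReal.ofReal (K * (weightedSum (2 * n) μ h C +
        h ^ ((μ : ℝ) / 2) * plainSum (n + 1) μ C))) ∧
      (n ≤ μ → FormBound (rescaled h k' a) (ENNReal.ofReal (K * weightedSum (2 * n) μ h C))) := by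
  obtain ⟨Kb, hKb0, hKb⟩ := exists_bracketJet_bound n (-k')
  have hδ : 0 < k' - k := by linarith
  obtain ⟨A₁, hA₁0, hA₁⟩ := exists_formBound_limited n μ hδ
  -- for `μ < n` the second bound is void, and so is the constant
  obtain ⟨A₂, hA₂0, hA₂⟩ : ∃ A : ℝ, 0 ≤ A ∧ (n ≤ μ →
      ∀ (H : Finset (Fin n) → MultiIndex n → Space n → Space n → ℂ)
        (D : Finset (Fin n) → MultiIndex n → ℝ), IsJet μ H →
        (∀ S β, order β ≤ μ → ∀ x ξ, ‖H S β x ξ‖ ≤ D S β) → ∀ ρ : ℝ, 0 < ρ →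
        FormBound (fun x η => H ∅ 0 x (ρ • η))
          (ENNReal.ofReal (A * ∑ S, ∑ B, ρ ^ S.card * D S (indicator B)))) := by
    by_cases hn : n ≤ μ
    · obtain ⟨A, hA0, hA⟩ := exists_formBound_regular hn
      exact ⟨A, hA0, fun _ => hA⟩
    · exact ⟨0, le_rfl, fun h => absurd h hn⟩
  set c₁ : ℝ := √(2 * Real.pi) ^ (2 * n) * Kb * 2 ^ n with hc₁
  set c₂ : ℝ := √(2 * Real.pi) ^ μ * Kb * 2 ^ n with hc₂
  have hc₁0 : 0 ≤ c₁ := by positivity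
  have hc₂0 : 0 ≤ c₂ := by positivity
  refine ⟨1 + A₁ * (2 ^ n * c₁ + c₂) + A₂ * (2 ^ n * (2 ^ n * c₁)), by positivity,
    fun h hh hh1 a C ha => ?_⟩
  have hρ0 : 0 < √(2 * Real.pi * h) := Real.sqrt_pos.mpr (by positivity)
  have h00 : order (0 : MultiIndex n) ≤ μ := by rw [order_zero]; exact Nat.zero_le _
  set W := weightedSum (2 * n) μ h C with hWdef
  set P := plainSum (n + 1) μ C with hPdef
  have hW : 0 ≤ W := (mul_nonneg (Real.rpow_nonneg hh.le _)
    (ha.nonneg 0 h00)).trans (ha.le_weightedSum hh h00 (by rw [order_zero]; omega))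
  have hP : 0 ≤ P := (ha.nonneg 0 h00).trans (ha.le_plainSum (by rw [order_zero]; omega) h00)
  have hhμ : 0 ≤ h ^ ((μ : ℝ) / 2) := Real.rpow_nonneg hh.le _
  have hJ := ha.isJet_rescaledJet (k' := k') h
  have hD := ha.norm_rescaledJet_le hKb h
  have hD0 : ∀ S β, order β ≤ μ → 0 ≤ jetBound Kb h C S β := fun S β hβ =>
    nonneg_of_mul_nonneg_left ((norm_nonneg _).trans (hD S β hβ 0 0))
      (Real.rpow_pos_of_pos (bracket_pos _) _)
  have hD' : ∀ S β, order β ≤ μ → ∀ x ξ, ‖rescaledJet h k' a S β x ξ‖ ≤ jetBound Kb h C S β := by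
    intro S β hβ x ξ
    refine (hD S β hβ x ξ).trans (mul_le_of_le_one_right (hD0 S β hβ) ?_)
    refine Real.rpow_le_one_of_one_le_of_nonpos (one_le_bracket _) ?_
    have : (0 : ℝ) ≤ S.card := Nat.cast_nonneg _
    linarith
  have hpow : ((Fintype.card (Finset (Fin n)) : ℕ) : ℝ) = 2 ^ n := by simp
  rw [rescaled_eq_rescaledJet]
  refine ⟨⟨jetBound Kb h C ∅ 0, ?_, fun x η => hD' _ _ h00 _ _⟩, hW, hP, ?_, fun hn => ?_⟩
  · exact ((hJ.continuous ∅ 0 h00).comp₂ continuous_fst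
      (continuous_snd.const_smul (√(2 * Real.pi * h)))).measurable
  · have hDD0 : 0 ≤ c₂ * (h ^ ((μ : ℝ) / 2) * P) := by positivity
    refine (hA₁ _ _ hJ hD (c₂ * (h ^ ((μ : ℝ) / 2) * P)) hDD0
      (fun β hβ => ha.jetBound_le_plainSum hKb0.le hh (by omega) _ hβ) _ hρ0).mono
      (ENNReal.ofReal_le_ofReal ?_)
    have hs : ∑ S : Finset (Fin n), √(2 * Real.pi * h) ^ S.card * jetBound Kb h C S 0 ≤
        2 ^ n * (c₁ * W) := by
      rw [← hpow, ← nsmul_eq_mul, ← Finset.card_univ]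
      exact Finset.sum_le_card_nsmul _ _ _ fun S _ =>
        ha.jetBound_le_weightedSum hKb0.le hh hh1 S h00 (by rw [order_zero]; omega)
    have hX : 0 ≤ h ^ ((μ : ℝ) / 2) * P := by positivity
    set X := h ^ ((μ : ℝ) / 2) * P with hXdef
    calc A₁ * (∑ S : Finset (Fin n), √(2 * Real.pi * h) ^ S.card * jetBound Kb h C S 0 + c₂ * X)
        ≤ A₁ * (2 ^ n * (c₁ * W) + c₂ * X) := by gcongr
      _ ≤ A₁ * ((2 ^ n * c₁ + c₂) * (W + X)) := by
          refine mul_le_mul_of_nonneg_left ?_ hA₁0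
          have e1 : 0 ≤ 2 ^ n * c₁ * X := by positivity
          have e2 : 0 ≤ c₂ * W := by positivity
          linarith
      _ ≤ _ := by
          have e3 : 0 ≤ (1 + A₂ * (2 ^ n * (2 ^ n * c₁))) * (W + X) := by positivity
          linarith
  · refine (hA₂ hn _ _ hJ hD' _ hρ0).mono (ENNReal.ofReal_le_ofReal ?_)
    have hs : ∑ S : Finset (Fin n), ∑ B : Finset (Fin n),
        √(2 * Real.pi * h) ^ S.card * jetBound Kb h C S (indicator B) ≤
        2 ^ n * (2 ^ n * (c₁ * W)) := by
      rw [← hpow, ← nsmul_eq_mul, ← nsmul_eq_mul, ← Finset.card_univ]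
      refine Finset.sum_le_card_nsmul _ _ _ fun S _ => Finset.sum_le_card_nsmul _ _ _ fun B _ => ?_
      have hB : order (indicator B) ≤ n := by
        rw [order_indicator]; simpa using Finset.card_le_univ B
      exact ha.jetBound_le_weightedSum hKb0.le hh hh1 S (hB.trans hn) hB
    calc _ ≤ A₂ * (2 ^ n * (2 ^ n * (c₁ * W))) := mul_le_mul_of_nonneg_left hs hA₂0
      _ ≤ _ := by
          have e3 : 0 ≤ (1 + A₁ * (2 ^ n * c₁ + c₂)) * W := by positivity
          linarith

end Constants

end SemiclassicalPsiDO

theorem proposition2p4 (d : ℕ) (hd : 2 ≤ d) :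
    ∃ s : ℕ, ∀ μ : ℕ, 1 ≤ μ → ∀ k k' : ℝ, k < k' →
      ∃ K : ℝ, 0 < K ∧
        ∀ h : ℝ, 0 < h → h ≤ 1 →
        ∀ (a : SemiclassicalPsiDO.Space (d - 1) → SemiclassicalPsiDO.Space (d - 1) → ℂ)
          (C : SemiclassicalPsiDO.MultiIndex (d - 1) → SemiclassicalPsiDO.MultiIndex (d - 1) → ℝ),
          SemiclassicalPsiDO.IsSymbol k μ a C →
          ∃ T : SemiclassicalPsiDO.Sobolev (d - 1) h k' →L[ℂ] SemiclassicalPsiDO.L2 (d - 1),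
            SemiclassicalPsiDO.IsOpExtension a T ∧
            ‖T‖ ≤ K * (SemiclassicalPsiDO.weightedSum s μ h C +
              h ^ ((μ : ℝ) / 2) * Real.log (1 + h⁻¹) * SemiclassicalPsiDO.plainSum d μ C) ∧
            (s ≤ μ → ‖T‖ ≤ K * SemiclassicalPsiDO.weightedSum s μ h C) := by
  -- each of the `d - 1` coordinates is differentiated at most once in `ξ` and once in `x`
  refine ⟨2 * (d - 1), fun μ _ k k' hk => ?_⟩
  obtain ⟨K, hK0, hK⟩ := SemiclassicalPsiDO.exists_formBound_rescaled (d - 1) μ hk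
  refine ⟨2 * K, by positivity, fun h hh hh1 a C ha => ?_⟩
  obtain ⟨⟨M, hM⟩, hW, hP, h1, h2⟩ := hK h hh hh1 a C ha
  rw [Nat.sub_add_cancel (by omega : 1 ≤ d)] at h1 hP
  obtain ⟨T, hT, hTN⟩ := SemiclassicalPsiDO.exists_isOpExtension hh hM h1
  have hhμ : 0 ≤ h ^ ((μ : ℝ) / 2) := Real.rpow_nonneg hh.le _
  refine ⟨T, hT, (hTN _ (by positivity) h1).trans ?_, fun hs => ?_⟩
  · -- the logarithm is at least `log 2 ≥ 1 / 2`
    have hlog : 1 / 2 ≤ Real.log (1 + h⁻¹) := by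
      have e1 : (2 : ℝ) ≤ 1 + h⁻¹ := by linarith [(one_le_inv₀ hh).mpr hh1]
      linarith [Real.log_le_log two_pos e1, Real.log_two_gt_d9]
    have hX : 0 ≤ h ^ ((μ : ℝ) / 2) * SemiclassicalPsiDO.plainSum d μ C := by positivity
    have e2 : h ^ ((μ : ℝ) / 2) * SemiclassicalPsiDO.plainSum d μ C ≤
        2 * (h ^ ((μ : ℝ) / 2) * Real.log (1 + h⁻¹) * SemiclassicalPsiDO.plainSum d μ C) := by
      have := mul_le_mul_of_nonneg_right hlog hX
      linarith
    have e3 := mul_le_mul_of_nonneg_left e2 hK0.le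
    have e4 := mul_nonneg hK0.le hW
    linarith
  · refine (hTN _ (by positivity) (h2 (by omega))).trans ?_
    have e4 := mul_nonneg hK0.le hW
    linarith
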